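/- Let $l,n\ge 1$ be integers, $0<p_1,\dots,p_l<\infty$, $\frac1p=\frac1{p_1}+\cdots+\frac1{p_l}$, $1<u<\infty$, $\frac1u+\frac1{u'}=1$ and $0<s<\infty$. Write $\widehat f(\xi)=\int f(x)e^{-2\pi i\langle x,\xi\rangle}\,dx$. For a function $F$ on $\mathbb R^{ln}$ put $\|F\|_{L^u_s(\mathbb R^{ln})}=\big\|\big[(1+4\pi^2|\cdot|^2)^{s/2}\widehat F\,\big]^\vee\big\|_{L^u(\mathbb R^{ln})}$ (in the sense of tempered distributions, with value $\infty$ if $F$ is not a tempered distribution or the bracket is not an $L^u$ function). Let $\Theta$ be a Schwartz function on $\mathbb R^{ln}$ with $\widehat\Theta$ supported in $\{\xi\in\mathbb R^{ln}:\frac12\le|\xi|\le2\}$, and for a measurable function $m$ on $\mathbb R^{ln}$ let $$\mathcal A^u_s[m]=\sup_{k\in\mathbb Z}\big\|m(2^k\,\cdot)\,\widehat\Theta\big\|_{L^u_s(\mathbb R^{ln})}.$$ For Schwartz functions $f_1,\dots,f_l$ on $\mathbb R^n$ let $$T_m(f_1,\dots,f_l)(x)=\int_{(\mathbb R^n)^l}m(\xi_1,\dots,\xi_l)\,\widehat{f_1}(\xi_1)\cdots\widehat{f_l}(\xi_l)\,e^{2\pi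 i\langle x,\xi_1+\cdots+\xi_l\rangle}\,d\xi_1\cdots d\xi_l .$$ Fix a Schwartz function $\Phi$ on $\mathbb R^n$ with $\int\Phi\ne0$ and let $\|f\|_{H^{q}(\mathbb R^n)}=\big\|\sup_{t>0}|\Phi_t*f|\big\|_{L^{q}(\mathbb R^n)}$, $\Phi_t(x)=t^{-n}\Phi(x/t)$, be the Hardy space quasi-norm. Suppose that for every measurable $m$ on $\mathbb R^{ln}$ with $\mathcal A^u_s[m]<\infty$ there is a finite constant $C$ (which may even depend on $m$) such that $$\|T_m(f_1,\dots,f_l)\|_{L^p(\mathbb R^n)}\le C\,\mathcal A^u_s[m]\prod_{i=1}^l\|f_i\|_{H^{p_i}(\mathbb R^n)}$$ for all Schwartz functions $f_1,\dots,f_l$ on $\mathbb R^n$. Then $$\frac sn>\max\Big\{\frac lu,\ \frac1p-\frac1{u'}\Big\}.$$ -/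

import Mathlib

open MeasureTheory
open scoped ENNReal NNReal SchwartzMap FourierTransform

namespace MultilinearMultiplier

/-- The space `(ℝⁿ)ˡ ≅ ℝ^{ln}` of frequency variables `ξ = (ξ₁, …, ξ_l)`, `ξᵢ ∈ ℝⁿ`, with its
Euclidean norm `|ξ|² = |ξ₁|² + ⋯ + |ξ_l|²` and Lebesgue measure. -/
abbrev FreqSpace (l n : ℕ) : Type := PiLp 2 (fun _ : Fin l => EuclideanSpace ℝ (Fin n))

section Sobolev

variable {E : Type*} [NormedAddCommGroup E] [InnerProductSpace ℝ E] [FiniteDimensional ℝ E]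
  [MeasurableSpace E] [BorelSpace E]

/-- The tempered distribution `T` is (integration against) the function `F`. -/
def IsRepresentedBy (T : 𝓢'(E, ℂ)) (F : E → ℂ) : Prop :=
  ∀ φ : 𝓢(E, ℂ), Integrable (fun x => φ x * F x) volume ∧ T φ = ∫ x, φ x * F x

/-- The operator `T ↦ [(1 + 4π²|·|²)^{s/2} T^]^∨` on tempered distributions, i.e. `(I - Δ)^{s/2}`
for the Fourier transform with kernel `e^{-2πi⟨x, ξ⟩}`. -/
noncomputable def besselOp (s : ℝ) : 𝓢'(E, ℂ) →L[ℂ] 𝓢'(E, ℂ) :=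
  TemperedDistribution.fourierMultiplierCLM ℂ
    (fun x : E => (((1 + 4 * Real.pi ^ 2 * ‖x‖ ^ 2) ^ (s / 2) : ℝ) : ℂ))

/-- The Sobolev norm `‖F‖_{L^u_s} = ‖[(1 + 4π²|·|²)^{s/2} F^]^∨‖_{L^u}`, with value `∞` if `F` is
not a tempered distribution or if `[(1 + 4π²|·|²)^{s/2} F^]^∨` is not an `L^u` function.
The distribution `T` and (almost everywhere) the function `g` below are determined by `F`, so the
infimum runs over at most one value. -/
noncomputable def sobolevNorm (u s : ℝ) (F : E → ℂ) : ℝ≥0∞ :=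
  ⨅ (T : 𝓢'(E, ℂ)) (_ : IsRepresentedBy T F) (g : E → ℂ) (_ : IsRepresentedBy (besselOp s T) g),
    eLpNorm g (ENNReal.ofReal u) volume

/-- `A^u_s[m] = sup_{k ∈ ℤ} ‖m(2ᵏ ·) Θ^‖_{L^u_s}`. -/
noncomputable def hormanderNorm (Θ : 𝓢(E, ℂ)) (u s : ℝ) (m : E → ℂ) : ℝ≥0∞ :=
  ⨆ k : ℤ, sobolevNorm u s (fun ξ => m ((2 : ℝ) ^ k • ξ) * 𝓕 Θ ξ)

end Sobolev

/-- The Hardy space quasi-norm `‖f‖_{H^p(ℝⁿ)} = ‖sup_{t > 0} |Φ_t * f|‖_{L^p(ℝⁿ)}`, where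
`Φ_t(x) = t^{-n} Φ(x / t)`. -/
noncomputable def hardyNorm {n : ℕ} (Φ : 𝓢(EuclideanSpace ℝ (Fin n), ℂ)) (p : ℝ)
    (f : EuclideanSpace ℝ (Fin n) → ℂ) : ℝ≥0∞ :=
  eLpNorm (fun x => ⨆ (t : ℝ) (_ : 0 < t),
    ‖∫ y, (((t ^ n)⁻¹ : ℝ) : ℂ) * Φ (t⁻¹ • (x - y)) * f y‖ₑ) (ENNReal.ofReal p) volume

/-- The `l`-linear multiplier operator
`T_m(f₁, …, f_l)(x) = ∫ m(ξ) f₁^(ξ₁) ⋯ f_l^(ξ_l) e^{2πi⟨x, ξ₁ + ⋯ + ξ_l⟩} dξ`. -/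
noncomputable def multiplierOp {l n : ℕ} (m : FreqSpace l n → ℂ)
    (f : Fin l → 𝓢(EuclideanSpace ℝ (Fin n), ℂ)) (x : EuclideanSpace ℝ (Fin n)) : ℂ :=
  ∫ ξ : FreqSpace l n, m ξ * (∏ i, 𝓕 (f i) (ξ i)) *
    Complex.exp (2 * Real.pi * Complex.I * ((inner ℝ x (∑ i, ξ i) : ℝ) : ℂ))

end MultilinearMultiplier

/-!
The hypothesis is tested against two explicit multipliers, one for each lower bound on `s / n`.
Only upper bounds for `A^u_s[m]` are needed, so the shape of `Θ` beyond its Fourier support plays no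
role.

*Test functions.* Every `f_i` is the same function `f_R = (R⁻¹ ∂_v)^K (e^{2πi R t₀⟨v, ·⟩} γ)`, where
`γ ≥ 0` is the inverse Fourier transform of a bump `η` supported near `0`, `|v| = 1`, and
`R = 2^{4N}`. Integrating by parts onto the mollifier gives `‖f_R‖_{H^{q_i}} = O(1)` uniformly in
`R`, for every `q_i > 0` once `K` is large (`exists_hardyNorm_test_le`). The Fourier transform of
`f_R` is `η(ξ - R t₀ v)` times a power of `⟨ξ, v⟩ / R`, which a fixed smooth factor of the
multiplier undoes (`exists_smooth_inverse_power`). So near the point `R a`, `a = (t₀v, …, t₀v)`,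
`|a| = 1`, the operator sees the multiplier at unit scale (`norm_multiplierOp_test`).

*One multiplier for all `N`.* Multipliers `A_N` living near `a` are placed at the frequency scales
`2^{4N}`. A dyadic annulus meets at most one of them, so the resulting `m` has `A^u_s[m]` bounded by
the supremum of the norms of the `A_N` (`exists_glidingHump`). The constant in the hypothesis, which
may depend on `m`, then serves all `N` at once (`exists_eLpNorm_layers_le`).

*Sobolev norms.* Let `ψ(2^j L(ξ - a))` be a cut-off in the direction of a linear map `L` of rank `δ`.
`(1 - Δ)^{s/2}` of it, times fixed smooth factors, is `O(2^{js})` in sup norm and `O(2^{j(s - δ)})`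
in `L¹` (`exists_besselFun_family_bound`). For integer powers of `1 - Δ` this is the chain rule;
for fractional powers it follows from the subordination formula
`w^β = c ∫₀^∞ t^{-β-1} (1 - e^{-tw})^M dt` and the fact that the heat semigroup contracts both norms
(`IsMinkowski.besselWeight_rpow_le`).

*The condition `s > ln / u`* (`lt_of_multiplier_bound`). If `s ≤ ln / u`, let `A_N` be `N^{-1/u}`
times the sum of `N` concentric bumps of radii `1, 2⁻¹, …` about `a` (`L = id`, `δ = ln`). The bumps
are spread over such different scales that `A_N` has `L^u_s` norm `O(1)`, yet it equals the value
`N^{1 - 1/u}` near `a`. Hence `|T_m(f_R, …, f_R)| = N^{1 - 1/u} γ^l`, which is unbounded in `L^p`.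

*The condition `s / n > 1 / p - 1 / u'`* (`sub_lt_of_multiplier_bound`). If it fails while
`s > ln / u`, then `p < 1`. Let `A_N` be the average over `i < J` of cut-offs
`η(2^j L(ξ - a))`, `j = 4N + i`, with `L ξ = ξ₁ + ⋯ + ξ_l`, `δ = n`, each normalized in `L^u_s` by
`2^{-j(s - n/u)}`. The triangle inequality bounds the `L^u_s` norm. On the other side, the `i`-th
cut-off contributes to `T_m` a nonnegative function of size at least
`2^{-4N(s - n/u)} 2^{-in/p}` on `|x| ≲ 2^i`, with a fixed `L^p` mass on the outer shell.
So the average of `J` of them has `L^p` quasi-norm at least a multiple of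
`J^{1/p - 1} 2^{-4N(s - n/u)}`, and `J` may be taken arbitrarily large depending on `N`.
-/

set_option linter.unusedSectionVars false

namespace MultilinearMultiplier

/-! ### Minkowski functionals and the heat semigroup of `1 - Δ` -/

section Bessel

variable {E : Type} [NormedAddCommGroup E] [InnerProductSpace ℝ E] [FiniteDimensional ℝ E]
  [MeasurableSpace E] [BorelSpace E]

/-- A functional on complex functions that is translation invariant and satisfies Minkowski's
integral inequality. The supremum and the `L¹` norm are the two instances that matter; treating
them together makes every kernel estimate below a statement about both. -/
structure IsMinkowski (N : (E → ℂ) → ℝ≥0∞) : Prop where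
  translate : ∀ (G : E → ℂ) (y : E), N (fun x => G (x + y)) = N G
  minkowski : ∀ {α : Type} [MeasurableSpace α] (μ : Measure α) [SFinite μ] (G : α → E → ℂ)
    (H : E → ℂ), Measurable (Function.uncurry G) → (∀ x, ‖H x‖ₑ ≤ ∫⁻ a, ‖G a x‖ₑ ∂μ) →
      N H ≤ ∫⁻ a, N (G a) ∂μ

lemma isMinkowski_sup : IsMinkowski (fun G : E → ℂ => ⨆ x, ‖G x‖ₑ) where
  translate G y := (Equiv.addRight y).iSup_comp (g := fun x => ‖G x‖ₑ)
  minkowski _ _ G _ _ h := iSup_le fun x => (h x).trans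
    (lintegral_mono fun a => le_iSup (fun x => ‖G a x‖ₑ) x)

lemma isMinkowski_lintegral : IsMinkowski (fun G : E → ℂ => ∫⁻ x, ‖G x‖ₑ) where
  translate G y := lintegral_add_right_eq_self (fun x => ‖G x‖ₑ) y
  minkowski μ _ G H hG h := by
    refine (lintegral_mono h).trans ?_
    rw [lintegral_lintegral_swap]
    exact (hG.comp measurable_swap).enorm.aemeasurable

namespace IsMinkowski

variable {N : (E → ℂ) → ℝ≥0∞}

lemma mono_mul (hN : IsMinkowski N) {G H : E → ℂ} (hG : Measurable G) (c : ℝ≥0)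
    (h : ∀ x, ‖H x‖ₑ ≤ c * ‖G x‖ₑ) : N H ≤ c * N G := by
  have := hN.minkowski (α := Unit) ((c : ℝ≥0∞) • Measure.dirac ()) (fun _ => G) H
    (hG.comp measurable_snd) (by simpa [mul_comm] using h)
  simpa [mul_comm] using this

lemma add_le (hN : IsMinkowski N) {G₁ G₂ H : E → ℂ} (h₁ : Measurable G₁) (h₂ : Measurable G₂)
    (h : ∀ x, ‖H x‖ₑ ≤ ‖G₁ x‖ₑ + ‖G₂ x‖ₑ) : N H ≤ N G₁ + N G₂ := by
  have := hN.minkowski (α := Bool) Measure.count (fun b => if b then G₁ else G₂) H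
    (by
      refine measurable_from_prod_countable_right fun b => ?_
      cases b <;> simpa [Function.uncurry] using by assumption)
    (fun x => by simpa [lintegral_fintype] using h x)
  simpa [lintegral_fintype] using this

end IsMinkowski

/-- The inverse Fourier transform of a jointly measurable family is jointly measurable. No
integrability is needed: where the integral diverges both sides are `0`. -/
lemma measurable_fourierInv_uncurry {α : Type} [MeasurableSpace α] {k : α → E → ℂ}
    (hk : Measurable (Function.uncurry k)) :
    Measurable (Function.uncurry fun a => 𝓕⁻ (k a)) := by
  have : (Function.uncurry fun a => 𝓕⁻ (k a)) = fun z : α × E =>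
      ∫ v, Complex.exp (((2 * Real.pi * inner ℝ v z.2 : ℝ) : ℂ) * Complex.I) • k z.1 v := by
    ext z
    simp [Function.uncurry, Real.fourierInv_eq']
  rw [this]
  refine (StronglyMeasurable.integral_prod_right (f := fun (z : α × E) v =>
    Complex.exp (((2 * Real.pi * inner ℝ v z.2 : ℝ) : ℂ) * Complex.I) • k z.1 v) ?_).measurable
  refine Measurable.stronglyMeasurable ?_
  have h1 : Measurable fun z : (α × E) × E =>
      Complex.exp (((2 * Real.pi * inner ℝ z.2 z.1.2 : ℝ) : ℂ) * Complex.I) :=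
    (Continuous.measurable (by fun_prop : Continuous fun y : E × E =>
      Complex.exp (((2 * Real.pi * inner ℝ y.1 y.2 : ℝ) : ℂ) * Complex.I))).comp
      (measurable_snd.prodMk measurable_fst.snd)
  have h2 : Measurable fun z : (α × E) × E => k z.1.1 z.2 :=
    hk.comp (measurable_fst.fst.prodMk measurable_snd)
  exact h1.mul h2

lemma measurable_fourierInv {γ : E → ℂ} (hγ : Measurable γ) : Measurable (𝓕⁻ γ) := by
  have h : Measurable (Function.uncurry fun _ : Unit => 𝓕⁻ γ) :=
    measurable_fourierInv_uncurry (k := fun _ => γ) (hγ.comp measurable_snd)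
  exact h.of_uncurry_left (x := ())

/-- A multiplier that is a superposition of multipliers `k a` acts, in any Minkowski functional,
no worse than the superposition of their actions. -/
lemma IsMinkowski.superpose {N : (E → ℂ) → ℝ≥0∞} (hN : IsMinkowski N) {α : Type}
    [MeasurableSpace α] (μ : Measure α) [SFinite μ] {k : α → E → ℂ} {γ : E → ℂ}
    (hk : Measurable (Function.uncurry k)) (hγ : Measurable γ)
    (hint : Integrable (fun z : α × E => k z.1 z.2 * γ z.2) (μ.prod volume)) :
    N (𝓕⁻ fun ξ => (∫ a, k a ξ ∂μ) * γ ξ) ≤ ∫⁻ a, N (𝓕⁻ fun ξ => k a ξ * γ ξ) ∂μ := by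
  refine hN.minkowski μ _ _ (measurable_fourierInv_uncurry (k := fun a ξ => k a ξ * γ ξ)
    (hk.mul (hγ.comp measurable_snd))) fun x => ?_
  have key : 𝓕⁻ (fun ξ => (∫ a, k a ξ ∂μ) * γ ξ) x = ∫ a, 𝓕⁻ (fun ξ => k a ξ * γ ξ) x ∂μ := by
    simp only [Real.fourierInv_eq', smul_eq_mul]
    rw [integral_integral_swap]
    · congr 1 with v
      rw [← integral_mul_const, ← integral_const_mul]
    · refine hint.bdd_mul (c := 1) (Measurable.aestronglyMeasurable ?_) ?_
      · exact (Continuous.measurable (by fun_prop : Continuous fun y : E =>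
          Complex.exp (((2 * Real.pi * inner ℝ y x : ℝ) : ℂ) * Complex.I))).comp measurable_snd
      · refine Filter.Eventually.of_forall fun z => ?_
        rw [Complex.norm_exp_ofReal_mul_I]
  rw [key]
  exact enorm_integral_le_lintegral_enorm _

/-- The Fourier weight `1 + 4π²|x|²` of `1 - Δ`. -/
noncomputable def besselWeight (x : E) : ℝ := 1 + 4 * Real.pi ^ 2 * ‖x‖ ^ 2

lemma one_le_besselWeight (x : E) : 1 ≤ besselWeight x := by
  unfold besselWeight; nlinarith [mul_nonneg (sq_nonneg (2 * Real.pi)) (sq_nonneg ‖x‖)]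

lemma besselWeight_pos (x : E) : 0 < besselWeight x := one_pos.trans_le (one_le_besselWeight x)

@[fun_prop]
lemma continuous_besselWeight : Continuous (besselWeight : E → ℝ) := by
  unfold besselWeight; fun_prop

/-- The heat multiplier `e^{-tw}` is a subprobability superposition of characters: the Gaussian is
the Fourier transform of a Gaussian. -/
lemma exp_neg_besselWeight_eq (t : ℝ) (ht : 0 ≤ t) (ξ : E) :
    ((Real.exp (-(t * besselWeight ξ)) : ℝ) : ℂ) =
      ∫ y, ((Real.exp (-t) : ℝ) : ℂ) *
        Complex.exp (((2 * Real.pi * inner ℝ ξ (√(2 * t) • y) : ℝ) : ℂ) * Complex.I)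
        ∂(ProbabilityTheory.stdGaussian E) := by
  have h := ProbabilityTheory.charFun_stdGaussian (E := E) ((2 * Real.pi * √(2 * t)) • ξ)
  rw [charFun_apply] at h
  rw [integral_const_mul]
  have h2 : ∀ y : E, Complex.exp (((2 * Real.pi * inner ℝ ξ (√(2 * t) • y) : ℝ) : ℂ) * Complex.I)
      = Complex.exp (((inner ℝ y ((2 * Real.pi * √(2 * t)) • ξ) : ℝ) : ℂ) * Complex.I) := by
    intro y
    rw [inner_smul_right, inner_smul_right, real_inner_comm]
    congr 3
    ring
  simp_rw [h2]
  rw [h, norm_smul, Real.norm_of_nonneg (by positivity)]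
  rw [Complex.ofReal_exp, Complex.ofReal_exp, ← Complex.exp_add]
  congr 1
  have hs : √(2 * t) ^ 2 = 2 * t := Real.sq_sqrt (by positivity)
  norm_cast
  unfold besselWeight
  rw [mul_pow, mul_pow, hs]
  ring

/-- The heat semigroup of `1 - Δ` contracts every Minkowski functional: it averages translates
against a Gaussian probability measure. -/
lemma IsMinkowski.heat {N : (E → ℂ) → ℝ≥0∞} (hN : IsMinkowski N) {γ : E → ℂ}
    (hγ : Measurable γ) (hi : Integrable γ) {t : ℝ} (ht : 0 ≤ t) :
    N (𝓕⁻ fun ξ => ((Real.exp (-(t * besselWeight ξ)) : ℝ) : ℂ) * γ ξ) ≤ N (𝓕⁻ γ) := by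
  simp_rw [exp_neg_besselWeight_eq t ht]
  have hcont : Continuous (fun z : E × E => ((Real.exp (-t) : ℝ) : ℂ) *
        Complex.exp (((2 * Real.pi * inner ℝ z.2 (√(2 * t) • z.1) : ℝ) : ℂ) * Complex.I)) := by
    fun_prop
  have hb : Real.exp (-t) ≤ 1 := Real.exp_le_one_iff.2 (by linarith)
  refine (hN.superpose (ProbabilityTheory.stdGaussian E) (k := fun y ξ =>
    ((Real.exp (-t) : ℝ) : ℂ) *
        Complex.exp (((2 * Real.pi * inner ℝ ξ (√(2 * t) • y) : ℝ) : ℂ) * Complex.I)) (γ := γ)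
    hcont.measurable hγ ?_).trans ?_
  · refine Integrable.bdd_mul (c := 1) (hi.comp_snd _) hcont.aestronglyMeasurable
      (Filter.Eventually.of_forall fun z => ?_)
    rw [norm_mul, Complex.norm_exp_ofReal_mul_I, Complex.norm_real,
      Real.norm_of_nonneg (Real.exp_pos _).le]
    simpa using hb
  · calc _ ≤ ∫⁻ _ : E, N (𝓕⁻ γ) ∂(ProbabilityTheory.stdGaussian E) := by
          refine lintegral_mono fun y => ?_
          rw [← hN.translate (𝓕⁻ γ) (√(2 * t) • y)]
          have := hN.mono_mul (G := fun x => 𝓕⁻ γ (x + √(2 * t) • y)) (H := 𝓕⁻ fun ξ =>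
            ((Real.exp (-t) : ℝ) : ℂ) *
            Complex.exp (((2 * Real.pi * inner ℝ ξ (√(2 * t) • y) : ℝ) : ℂ) * Complex.I) * γ ξ)
            ((measurable_fourierInv hγ).comp (measurable_add_const _)) 1 ?_
          · simpa using this
          intro x
          have e : 𝓕⁻ (fun ξ => ((Real.exp (-t) : ℝ) : ℂ) *
            Complex.exp (((2 * Real.pi * inner ℝ ξ (√(2 * t) • y) : ℝ) : ℂ) * Complex.I) * γ ξ) x
              = ((Real.exp (-t) : ℝ) : ℂ) * 𝓕⁻ γ (x + √(2 * t) • y) := by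
            simp only [Real.fourierInv_eq', smul_eq_mul]
            rw [← integral_const_mul]
            congr 1 with v
            rw [inner_add_right, mul_add, Complex.ofReal_add, add_mul, Complex.exp_add]
            ring
          rw [e, enorm_mul]
          refine mul_le_mul_left ?_ _
          rw [← ofReal_norm, Complex.norm_real, Real.norm_of_nonneg (Real.exp_pos _).le]
          simpa using ENNReal.ofReal_le_ofReal hb
      _ = N (𝓕⁻ γ) := by simp

/-- The multiplier `1 - e^{-tw}`. -/
noncomputable def heatDiff (t : ℝ) (ξ : E) : ℂ := ((1 - Real.exp (-(t * besselWeight ξ)) : ℝ) : ℂ)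

lemma continuous_heatDiff_uncurry : Continuous (fun z : ℝ × E => heatDiff z.1 z.2) := by
  unfold heatDiff; fun_prop

lemma continuous_heatDiff (t : ℝ) : Continuous (heatDiff t : E → ℂ) := by
  unfold heatDiff; fun_prop

lemma norm_heatDiff_le {t : ℝ} (ht : 0 ≤ t) (ξ : E) : ‖heatDiff t ξ‖ ≤ 1 := by
  have h1 : Real.exp (-(t * besselWeight ξ)) ≤ 1 :=
    Real.exp_le_one_iff.2 (by have := mul_nonneg ht (besselWeight_pos ξ).le; linarith)
  rw [heatDiff, Complex.norm_real, Real.norm_of_nonneg (by linarith)]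
  linarith [Real.exp_pos (-(t * besselWeight ξ))]

lemma fourierInv_sub_of_integrable {γ₁ γ₂ : E → ℂ} (h₁ : Integrable γ₁) (h₂ : Integrable γ₂) (x : E) :
    𝓕⁻ (fun ξ => γ₁ ξ - γ₂ ξ) x = 𝓕⁻ γ₁ x - 𝓕⁻ γ₂ x := by
  simp only [Real.fourierInv_eq']
  have hb : ∀ γ : E → ℂ, Integrable γ → Integrable fun v =>
      Complex.exp (((2 * Real.pi * inner ℝ v x : ℝ) : ℂ) * Complex.I) • γ v := fun γ hγ => by
    refine hγ.bdd_mul (c := 1) (Continuous.aestronglyMeasurable (by fun_prop))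
      (Filter.Eventually.of_forall fun v => ?_)
    rw [Complex.norm_exp_ofReal_mul_I]
  rw [← integral_sub (hb _ h₁) (hb _ h₂)]
  simp only [smul_sub]

lemma integrable_heatDiff_mul {γ : E → ℂ} (hi : Integrable γ) {t : ℝ} (ht : 0 ≤ t) (M : ℕ) :
    Integrable fun ξ => heatDiff t ξ ^ M * γ ξ := by
  refine hi.bdd_mul (c := 1) (((continuous_heatDiff t).pow M).aestronglyMeasurable)
    (Filter.Eventually.of_forall fun v => ?_)
  rw [norm_pow]
  exact pow_le_one₀ (norm_nonneg _) (norm_heatDiff_le ht v)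

lemma IsMinkowski.heatDiff_le_two {N : (E → ℂ) → ℝ≥0∞} (hN : IsMinkowski N) {γ : E → ℂ}
    (hγ : Measurable γ) (hi : Integrable γ) {t : ℝ} (ht : 0 ≤ t) :
    N (𝓕⁻ fun ξ => heatDiff t ξ * γ ξ) ≤ 2 * N (𝓕⁻ γ) := by
  have hc : Continuous (fun ξ : E => ((Real.exp (-(t * besselWeight ξ)) : ℝ) : ℂ)) := by fun_prop
  have hi2 : Integrable fun ξ : E => ((Real.exp (-(t * besselWeight ξ)) : ℝ) : ℂ) * γ ξ := by
    refine hi.bdd_mul (c := 1) hc.aestronglyMeasurable (Filter.Eventually.of_forall fun v => ?_)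
    rw [Complex.norm_real, Real.norm_of_nonneg (Real.exp_pos _).le]
    exact Real.exp_le_one_iff.2 (by have := mul_nonneg ht (besselWeight_pos v).le; linarith)
  rw [two_mul]
  refine (hN.add_le (measurable_fourierInv hγ) (measurable_fourierInv (hc.measurable.mul hγ))
    fun x => ?_).trans (add_le_add le_rfl (hN.heat hγ hi ht))
  have : (fun ξ => heatDiff t ξ * γ ξ) = fun ξ =>
      γ ξ - ((Real.exp (-(t * besselWeight ξ)) : ℝ) : ℂ) * γ ξ := by
    ext ξ; simp [heatDiff]; ring
  rw [this, fourierInv_sub_of_integrable hi hi2]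
  exact enorm_sub_le

/-- `1 - e^{-tw} = ∫₀ᵗ w e^{-rw} dr`, which trades one heat difference for a factor `t (1 - Δ)`. -/
lemma heatDiff_eq_integral {t : ℝ} (ht : 0 ≤ t) (ξ : E) :
    heatDiff t ξ = ∫ r in Set.Ioc 0 t, ((Real.exp (-(r * besselWeight ξ)) * besselWeight ξ : ℝ) : ℂ) := by
  rw [integral_complex_ofReal, ← intervalIntegral.integral_of_le ht, heatDiff]
  congr 1
  have := intervalIntegral.integral_eq_sub_of_hasDerivAt (a := 0) (b := t)
    (f := fun r => -Real.exp (-(r * besselWeight ξ)))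
    (f' := fun r => Real.exp (-(r * besselWeight ξ)) * besselWeight ξ) (fun r _ => by
      have h := (((hasDerivAt_id r).mul_const (besselWeight ξ)).neg.exp).neg
      simpa [Pi.neg_def] using h) (Continuous.intervalIntegrable (by fun_prop) _ _)
  rw [this]; simp; ring

lemma IsMinkowski.heatDiff_le_mul {N : (E → ℂ) → ℝ≥0∞} (hN : IsMinkowski N) {γ : E → ℂ}
    (hγ : Measurable γ) (hi : Integrable fun ξ => (besselWeight ξ : ℂ) * γ ξ) {t : ℝ}
    (ht : 0 ≤ t) :
    N (𝓕⁻ fun ξ => heatDiff t ξ * γ ξ) ≤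
      ENNReal.ofReal t * N (𝓕⁻ fun ξ => (besselWeight ξ : ℂ) * γ ξ) := by
  simp_rw [heatDiff_eq_integral ht]
  have hmw : Measurable fun ξ => (besselWeight ξ : ℂ) * γ ξ :=
    (Continuous.measurable (by fun_prop)).mul hγ
  have hc : Continuous (Function.uncurry fun (r : ℝ) (ξ : E) =>
      ((Real.exp (-(r * besselWeight ξ)) * besselWeight ξ : ℝ) : ℂ)) := by
    unfold Function.uncurry; fun_prop
  refine (hN.superpose (volume.restrict (Set.Ioc 0 t)) hc.measurable hγ ?_).trans ?_
  · have h1 : Integrable (fun z : ℝ × E => ((Real.exp (-(z.1 * besselWeight z.2)) : ℝ) : ℂ) *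
        ((besselWeight z.2 : ℂ) * γ z.2)) ((volume.restrict (Set.Ioc 0 t)).prod volume) := by
      refine Integrable.bdd_mul (c := 1) (hi.comp_snd _)
        (Continuous.aestronglyMeasurable (by fun_prop)) ?_
      have : (volume.restrict (Set.Ioc 0 t)).prod (volume : Measure E) =
          ((volume : Measure ℝ).prod volume).restrict (Set.Ioc 0 t ×ˢ Set.univ) := by
        rw [← Measure.prod_restrict, Measure.restrict_univ]
      rw [this]
      refine (ae_restrict_iff' (measurableSet_Ioc.prod MeasurableSet.univ)).2
        (Filter.Eventually.of_forall fun z hz => ?_)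
      rw [Complex.norm_real, Real.norm_of_nonneg (Real.exp_pos _).le]
      exact Real.exp_le_one_iff.2
        (by have := mul_nonneg hz.1.1.le (besselWeight_pos z.2).le; linarith)
    refine h1.congr (Filter.Eventually.of_forall fun z => ?_)
    simp; ring
  · calc _ ≤ ∫⁻ _ in Set.Ioc 0 t, N (𝓕⁻ fun ξ => (besselWeight ξ : ℂ) * γ ξ) := by
          refine setLIntegral_mono' measurableSet_Ioc fun r hr => ?_
          have := hN.heat hmw hi hr.1.le
          refine le_trans (le_of_eq ?_) this
          congr 2 with ξ
          push_cast; ring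
      _ = _ := by simp [mul_comm]

lemma IsMinkowski.heatDiff_pow_le_two {N : (E → ℂ) → ℝ≥0∞} (hN : IsMinkowski N) {t : ℝ}
    (ht : 0 ≤ t) (M : ℕ) {γ : E → ℂ} (hγ : Measurable γ) (hi : Integrable γ) :
    N (𝓕⁻ fun ξ => heatDiff t ξ ^ M * γ ξ) ≤ 2 ^ M * N (𝓕⁻ γ) := by
  induction M with
  | zero => simp
  | succ M ih =>
    have := hN.heatDiff_le_two (((continuous_heatDiff t).measurable.pow_const M).mul hγ)
      (integrable_heatDiff_mul hi ht M) ht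
    simp_rw [pow_succ']
    rw [mul_assoc]
    refine le_trans (le_of_eq ?_) (this.trans (mul_le_mul_right ih _))
    congr 2 with ξ
    simp [mul_assoc]

lemma IsMinkowski.heatDiff_pow_le_mul {N : (E → ℂ) → ℝ≥0∞} (hN : IsMinkowski N) {t : ℝ}
    (ht : 0 ≤ t) (M : ℕ) {γ : E → ℂ} (hγ : Measurable γ)
    (hi : ∀ i : ℕ, Integrable fun ξ => (besselWeight ξ : ℂ) ^ i * γ ξ) :
    N (𝓕⁻ fun ξ => heatDiff t ξ ^ M * γ ξ) ≤
      ENNReal.ofReal t ^ M * N (𝓕⁻ fun ξ => (besselWeight ξ : ℂ) ^ M * γ ξ) := by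
  induction M generalizing γ with
  | zero => simp
  | succ M ih =>
    have hw : Measurable fun ξ : E => (besselWeight ξ : ℂ) := Continuous.measurable (by fun_prop)
    have h1 := hN.heatDiff_le_mul (((continuous_heatDiff t).measurable.pow_const M).mul hγ)
      (by
        refine (integrable_heatDiff_mul (hi 1) ht M).congr (Filter.Eventually.of_forall fun ξ => ?_)
        simp; ring) ht
    have h2 := ih (γ := fun ξ => (besselWeight ξ : ℂ) * γ ξ) (hw.mul hγ) (fun i => by
        refine (hi (i + 1)).congr (Filter.Eventually.of_forall fun ξ => ?_)
        simp; ring)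
    have e1 : (fun ξ => heatDiff t ξ ^ (M + 1) * γ ξ) = fun ξ =>
        heatDiff t ξ * (heatDiff t ξ ^ M * γ ξ) := by ext ξ; ring
    have e2 : (fun ξ => (besselWeight ξ : ℂ) ^ (M + 1) * γ ξ) = fun ξ =>
        (besselWeight ξ : ℂ) ^ M * ((besselWeight ξ : ℂ) * γ ξ) := by ext ξ; ring
    have e3 : (fun ξ => (besselWeight ξ : ℂ) * (heatDiff t ξ ^ M * γ ξ)) = fun ξ =>
        heatDiff t ξ ^ M * ((besselWeight ξ : ℂ) * γ ξ) := by ext ξ; ring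
    rw [e1, e2, pow_succ', mul_assoc]
    refine h1.trans (mul_le_mul_right ?_ _)
    simp only [Pi.mul_apply] at *
    rw [e3]
    exact h2

end Bessel

/-! ### Fractional powers of `1 - Δ` by subordination -/

section FractionalPower

lemma setIntegral_rpow_mul_comp (φ : ℝ → ℝ) (β : ℝ) {c : ℝ} (hc : 0 < c) :
    ∫ t in Set.Ioi (0 : ℝ), t ^ (-β - 1) * φ (t * c) =
      c ^ β * ∫ t in Set.Ioi (0 : ℝ), t ^ (-β - 1) * φ t := by
  have h := integral_comp_mul_right_Ioi (fun t : ℝ => t ^ (-β - 1) * φ t) 0 hc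
  rw [zero_mul] at h
  have e : ∀ t ∈ Set.Ioi (0 : ℝ), t ^ (-β - 1) * φ (t * c) =
      c ^ (β + 1) * ((t * c) ^ (-β - 1) * φ (t * c)) := by
    intro t ht
    rw [Real.mul_rpow (le_of_lt ht) hc.le, show -β - 1 = -(β + 1) by ring, Real.rpow_neg hc.le]
    have := (Real.rpow_pos_of_pos hc (β + 1)).ne'
    field_simp
  rw [setIntegral_congr_fun measurableSet_Ioi e, integral_const_mul, h, smul_eq_mul, ← mul_assoc,
    Real.rpow_add_one hc.ne']
  congr 1
  field_simp

lemma integrableOn_rpow_mul_comp {φ : ℝ → ℝ} {β : ℝ}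
    (h : IntegrableOn (fun t => t ^ (-β - 1) * φ t) (Set.Ioi 0)) {c : ℝ} (hc : 0 < c) :
    IntegrableOn (fun t => t ^ (-β - 1) * φ (t * c)) (Set.Ioi 0) := by
  have h1 := (integrableOn_Ioi_comp_mul_right_iff (fun t : ℝ => t ^ (-β - 1) * φ t) 0 hc).2
    (by simpa using h)
  refine IntegrableOn.congr_fun (f := fun t => c ^ (β + 1) * ((t * c) ^ (-β - 1) * φ (t * c)))
    (h1.const_mul (c ^ (β + 1))) (fun t ht => ?_) measurableSet_Ioi
  have ht' : (0 : ℝ) < t := ht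
  simp only
  rw [Real.mul_rpow ht'.le hc.le, show -β - 1 = -(β + 1) by ring, Real.rpow_neg hc.le]
  have := (Real.rpow_pos_of_pos hc (β + 1)).ne'
  field_simp

/-- The majorant of the subordination integral: `t^M` tames `t^{-β-1}` at `0` because `β < M`, and
the constant `2^M` suffices at `∞`. -/
lemma integrableOn_rpow_mul_min {β : ℝ} {M : ℕ} (hβ : 0 < β) (hM : β < M) :
    IntegrableOn (fun t : ℝ => t ^ (-β - 1) * min (2 ^ M) (t ^ M)) (Set.Ioi 0) := by
  have hm : ∀ s : Set ℝ, AEStronglyMeasurable (fun t : ℝ => t ^ (-β - 1) * min (2 ^ M) (t ^ M))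
      (volume.restrict s) := fun s => (by fun_prop : Measurable
        (fun t : ℝ => t ^ (-β - 1) * min (2 ^ M) (t ^ M))).aestronglyMeasurable
  rw [← Set.Ioc_union_Ioi_eq_Ioi (zero_le_one (α := ℝ))]
  refine IntegrableOn.union ?_ ?_
  · have h1 : IntegrableOn (fun t : ℝ => t ^ ((M : ℝ) - β - 1)) (Set.Ioc 0 1) :=
      (intervalIntegrable_iff_integrableOn_Ioc_of_le zero_le_one).1
        (intervalIntegral.intervalIntegrable_rpow' (by linarith))
    refine h1.mono' (hm _) ((ae_restrict_iff' measurableSet_Ioc).2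
      (Filter.Eventually.of_forall fun t ht => ?_))
    have ht0 : 0 < t := ht.1
    rw [Real.norm_of_nonneg (by positivity)]
    calc _ ≤ t ^ (-β - 1) * t ^ M := by gcongr; exact min_le_right _ _
      _ = _ := by rw [← Real.rpow_natCast, ← Real.rpow_add ht0]; congr 1; ring
  · have h1 : IntegrableOn (fun t : ℝ => t ^ (-β - 1)) (Set.Ioi 1) :=
      integrableOn_Ioi_rpow_of_lt (by linarith) one_pos
    refine (h1.mul_const ((2 : ℝ) ^ M)).mono' (hm _) ((ae_restrict_iff' measurableSet_Ioi).2
      (Filter.Eventually.of_forall fun t ht => ?_))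
    have ht0 : 0 < t := one_pos.trans ht
    rw [Real.norm_of_nonneg (by positivity)]
    gcongr
    exact min_le_left _ _

lemma one_sub_exp_neg_pow_le {t : ℝ} (ht : 0 < t) (M : ℕ) :
    0 < (1 - Real.exp (-t)) ^ M ∧ (1 - Real.exp (-t)) ^ M ≤ min (2 ^ M) (t ^ M) := by
  have h1 : Real.exp (-t) < 1 := by
    rw [← Real.exp_zero]; exact Real.exp_lt_exp.2 (by linarith)
  have h2 := Real.add_one_le_exp (-t)
  have h3 := Real.exp_pos (-t)
  refine ⟨pow_pos (by linarith) _, le_min ?_ ?_⟩ <;>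
  exact pow_le_pow_left₀ (by linarith) (by linarith) _

/-- The constant `∫₀^∞ t^{-β-1} (1 - e^{-t})^M dt` in the subordination formula for `w^β`. -/
noncomputable def subordinationConst (β : ℝ) (M : ℕ) : ℝ :=
  ∫ t in Set.Ioi (0 : ℝ), t ^ (-β - 1) * (1 - Real.exp (-t)) ^ M

lemma integrableOn_subordination {β : ℝ} {M : ℕ} (hβ : 0 < β) (hM : β < M) :
    IntegrableOn (fun t : ℝ => t ^ (-β - 1) * (1 - Real.exp (-t)) ^ M) (Set.Ioi 0) := by
  refine (integrableOn_rpow_mul_min hβ hM).mono' (by fun_prop : Measurable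
      (fun t : ℝ => t ^ (-β - 1) * (1 - Real.exp (-t)) ^ M)).aestronglyMeasurable
      ((ae_restrict_iff' measurableSet_Ioi).2 (Filter.Eventually.of_forall fun t ht => ?_))
  have ht' : (0 : ℝ) < t := ht
  obtain ⟨h1, h2⟩ := one_sub_exp_neg_pow_le ht' M
  rw [Real.norm_of_nonneg (by positivity)]
  gcongr

lemma subordinationConst_pos {β : ℝ} {M : ℕ} (hβ : 0 < β) (hM : β < M) :
    0 < subordinationConst β M := by
  unfold subordinationConst
  rw [setIntegral_pos_iff_support_of_nonneg_ae _ (integrableOn_subordination hβ hM)]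
  · refine lt_of_lt_of_le (by simp : (0 : ℝ≥0∞) < volume (Set.Ioi (0 : ℝ))) (measure_mono ?_)
    intro t ht
    have ht' : (0 : ℝ) < t := ht
    have := (one_sub_exp_neg_pow_le ht' M).1
    exact ⟨(mul_pos (Real.rpow_pos_of_pos ht' _) this).ne', ht⟩
  · refine (ae_restrict_iff' measurableSet_Ioi).2 (Filter.Eventually.of_forall fun t ht => ?_)
    have ht' : (0 : ℝ) < t := ht
    have := (one_sub_exp_neg_pow_le ht' M).1
    simp only [Pi.zero_apply]
    positivity

variable {E : Type} [NormedAddCommGroup E] [InnerProductSpace ℝ E] [FiniteDimensional ℝ E]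
  [MeasurableSpace E] [BorelSpace E]

lemma heatDiff_pow_eq (t : ℝ) (ξ : E) (M : ℕ) :
    heatDiff t ξ ^ M = (((1 - Real.exp (-(t * besselWeight ξ))) ^ M : ℝ) : ℂ) := by
  simp [heatDiff]

/-- The subordination formula `w^β = c ∫₀^∞ t^{-β-1} (1 - e^{-tw})^M dt`. -/
lemma besselWeight_rpow_eq_integral {β : ℝ} {M : ℕ} (hβ : 0 < β) (hM : β < M) (ξ : E) :
    ((besselWeight ξ ^ β : ℝ) : ℂ) = ∫ t in Set.Ioi (0 : ℝ),
      (((subordinationConst β M)⁻¹ * t ^ (-β - 1) : ℝ) : ℂ) * heatDiff t ξ ^ M := by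
  have h := setIntegral_rpow_mul_comp (fun t => (1 - Real.exp (-t)) ^ M) β (besselWeight_pos ξ)
  simp_rw [heatDiff_pow_eq, ← Complex.ofReal_mul, mul_assoc]
  rw [integral_complex_ofReal, integral_const_mul, h, ← subordinationConst]
  congr 1
  have := (subordinationConst_pos hβ hM).ne'
  field_simp

/-- The moment inequality for fractional powers of `1 - Δ`: if `N` controls a function by `B` and
`(1 - Δ)^M` of it by `R^{2M} B`, then it controls `(1 - Δ)^β` of it by a multiple of `R^{2β} B`
for all `0 < β < M`. Here `γ` is the Fourier transform of the function. -/
lemma IsMinkowski.besselWeight_rpow_le {β : ℝ} {M : ℕ} (hβ : 0 < β) (hM : β < M) :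
    ∃ C : ℝ≥0, ∀ (N : (E → ℂ) → ℝ≥0∞), IsMinkowski N → ∀ γ : E → ℂ, Measurable γ →
      (∀ i : ℕ, Integrable fun ξ => (besselWeight ξ : ℂ) ^ i * γ ξ) →
      ∀ (R : ℝ) (B : ℝ≥0∞), 0 < R → N (𝓕⁻ γ) ≤ B →
      N (𝓕⁻ fun ξ => (besselWeight ξ : ℂ) ^ M * γ ξ) ≤ ENNReal.ofReal (R ^ (2 * M)) * B →
      N (𝓕⁻ fun ξ => ((besselWeight ξ ^ β : ℝ) : ℂ) * γ ξ) ≤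
        C * ENNReal.ofReal (R ^ (2 * β)) * B := by
  set K := ∫ t in Set.Ioi (0 : ℝ), t ^ (-β - 1) * min (2 ^ M) (t ^ M) with hK
  have hI := subordinationConst_pos hβ hM
  refine ⟨Real.toNNReal ((subordinationConst β M)⁻¹ * K),
    fun N hN γ hγ hi R B hR h0 h1 => ?_⟩
  have hi0 : Integrable γ := by simpa using hi 0
  simp_rw [besselWeight_rpow_eq_integral hβ hM]
  have hkm : Measurable (Function.uncurry fun (t : ℝ) (ξ : E) =>
      (((subordinationConst β M)⁻¹ * t ^ (-β - 1) : ℝ) : ℂ) * heatDiff t ξ ^ M) := by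
    refine Measurable.mul (f := fun z : ℝ × E =>
      (((subordinationConst β M)⁻¹ * z.1 ^ (-β - 1) : ℝ) : ℂ)) (by fun_prop) ?_
    exact (continuous_heatDiff_uncurry.measurable.pow_const M)
  refine (hN.superpose (volume.restrict (Set.Ioi (0 : ℝ))) hkm hγ ?_).trans ?_
  · have hm : AEStronglyMeasurable (fun z : ℝ × E =>
        (((subordinationConst β M)⁻¹ * z.1 ^ (-β - 1) : ℝ) : ℂ) * heatDiff z.1 z.2 ^ M * γ z.2)
        ((volume.restrict (Set.Ioi 0)).prod volume) :=
      (hkm.mul (hγ.comp measurable_snd)).aestronglyMeasurable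
    rw [integrable_prod_iff' hm]
    have hnorm : ∀ ξ : E, ∀ t ∈ Set.Ioi (0 : ℝ),
        ‖(((subordinationConst β M)⁻¹ * t ^ (-β - 1) : ℝ) : ℂ) * heatDiff t ξ ^ M * γ ξ‖ =
        ((subordinationConst β M)⁻¹ * ‖γ ξ‖) *
          (t ^ (-β - 1) * (1 - Real.exp (-(t * besselWeight ξ))) ^ M) := by
      intro ξ t ht
      have ht' : (0 : ℝ) < t := ht
      have := (one_sub_exp_neg_pow_le (mul_pos ht' (besselWeight_pos ξ)) M).1
      rw [norm_mul, norm_mul, heatDiff_pow_eq, Complex.norm_real, Complex.norm_real,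
        Real.norm_of_nonneg (by positivity), Real.norm_of_nonneg (by positivity)]
      ring
    refine ⟨Filter.Eventually.of_forall fun ξ => ?_, ?_⟩
    · have h := ((integrableOn_rpow_mul_comp (φ := fun t => (1 - Real.exp (-t)) ^ M)
        (integrableOn_subordination hβ hM) (besselWeight_pos ξ)).const_mul
          ((subordinationConst β M)⁻¹ * ‖γ ξ‖))
      have hm2 : Measurable fun t : ℝ =>
          (((subordinationConst β M)⁻¹ * t ^ (-β - 1) : ℝ) : ℂ) * heatDiff t ξ ^ M * γ ξ :=
        (hkm.of_uncurry_right (y := ξ)).mul measurable_const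
      refine h.mono' hm2.aestronglyMeasurable
        ((ae_restrict_iff' measurableSet_Ioi).2 (Filter.Eventually.of_forall fun t ht => ?_))
      exact (hnorm ξ t ht).le
    · have e : ∀ ξ : E, ∫ t in Set.Ioi (0 : ℝ),
          ‖(((subordinationConst β M)⁻¹ * t ^ (-β - 1) : ℝ) : ℂ) * heatDiff t ξ ^ M * γ ξ‖ =
          besselWeight ξ ^ β * ‖γ ξ‖ := by
        intro ξ
        rw [setIntegral_congr_fun measurableSet_Ioi (hnorm ξ), integral_const_mul,
          setIntegral_rpow_mul_comp (fun t => (1 - Real.exp (-t)) ^ M) β (besselWeight_pos ξ),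
          ← subordinationConst]
        have := hI.ne'
        field_simp
      simp only [e]
      refine (hi M).norm.mono' ?_ (Filter.Eventually.of_forall fun ξ => ?_)
      · exact ((continuous_besselWeight.measurable.pow_const β).mul hγ.norm).aestronglyMeasurable
      · have hw := one_le_besselWeight ξ
        rw [Real.norm_of_nonneg (by positivity), norm_mul, norm_pow, Complex.norm_real,
          Real.norm_of_nonneg (by positivity), ← Real.rpow_natCast]
        gcongr
  · have hb : ∀ t ∈ Set.Ioi (0 : ℝ), N (𝓕⁻ fun ξ =>
        (((subordinationConst β M)⁻¹ * t ^ (-β - 1) : ℝ) : ℂ) * heatDiff t ξ ^ M * γ ξ) ≤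
        ENNReal.ofReal ((subordinationConst β M)⁻¹ *
          (t ^ (-β - 1) * min (2 ^ M) ((t * R ^ 2) ^ M))) * B := by
      intro t ht
      have ht' : (0 : ℝ) < t := ht
      have hc0 : 0 ≤ (subordinationConst β M)⁻¹ * t ^ (-β - 1) := by positivity
      have s1 := hN.mono_mul (G := 𝓕⁻ fun ξ => heatDiff t ξ ^ M * γ ξ) (H := 𝓕⁻ fun ξ =>
        (((subordinationConst β M)⁻¹ * t ^ (-β - 1) : ℝ) : ℂ) * heatDiff t ξ ^ M * γ ξ)
        (measurable_fourierInv (((continuous_heatDiff t).measurable.pow_const M).mul hγ))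
        (Real.toNNReal ((subordinationConst β M)⁻¹ * t ^ (-β - 1))) (by
          intro x
          have : 𝓕⁻ (fun ξ => (((subordinationConst β M)⁻¹ * t ^ (-β - 1) : ℝ) : ℂ) *
              heatDiff t ξ ^ M * γ ξ) x = (((subordinationConst β M)⁻¹ * t ^ (-β - 1) : ℝ) : ℂ) *
              𝓕⁻ (fun ξ => heatDiff t ξ ^ M * γ ξ) x := by
            simp only [Real.fourierInv_eq', smul_eq_mul]
            rw [← integral_const_mul]
            congr 1 with v
            ring
          rw [this, enorm_mul, ← ofReal_norm, Complex.norm_real, Real.norm_of_nonneg hc0]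
          rfl)
      refine s1.trans ?_
      have s2 : N (𝓕⁻ fun ξ => heatDiff t ξ ^ M * γ ξ) ≤
          ENNReal.ofReal (min (2 ^ M) ((t * R ^ 2) ^ M)) * B := by
        rcases le_total ((2 : ℝ) ^ M) ((t * R ^ 2) ^ M) with h | h
        · rw [min_eq_left h]
          refine (hN.heatDiff_pow_le_two ht'.le M hγ hi0).trans ?_
          rw [ENNReal.ofReal_pow (by norm_num), ENNReal.ofReal_ofNat]
          gcongr
        · rw [min_eq_right h]
          refine (hN.heatDiff_pow_le_mul ht'.le M hγ hi).trans ?_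
          rw [mul_pow, ENNReal.ofReal_mul (by positivity), ENNReal.ofReal_pow ht'.le, mul_assoc]
          gcongr
          rwa [← pow_mul]
      rw [← mul_assoc, ENNReal.ofReal_mul hc0, mul_assoc]
      exact mul_le_mul_right s2 _
    refine (setLIntegral_mono' measurableSet_Ioi hb).trans ?_
    rw [lintegral_mul_const _ (by fun_prop)]
    gcongr
    rw [← ofReal_integral_eq_lintegral_ofReal]
    · rw [integral_const_mul, setIntegral_rpow_mul_comp (fun t => min (2 ^ M) (t ^ M)) β
        (by positivity : (0 : ℝ) < R ^ 2), ← hK]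
      rw [← Real.rpow_natCast R 2, ← Real.rpow_mul hR.le, Nat.cast_ofNat]
      have hK0 : 0 ≤ K := setIntegral_nonneg measurableSet_Ioi fun t ht => by
        have ht' : (0 : ℝ) < t := ht
        positivity
      rw [show (↑(Real.toNNReal ((subordinationConst β M)⁻¹ * K)) : ℝ≥0∞) =
        ENNReal.ofReal ((subordinationConst β M)⁻¹ * K) from rfl,
        ← ENNReal.ofReal_mul (by positivity)]
      refine ENNReal.ofReal_le_ofReal (le_of_eq ?_)
      ring
    · exact (integrableOn_rpow_mul_comp (φ := fun t => min (2 ^ M) (t ^ M))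
        (integrableOn_rpow_mul_min hβ hM) (by positivity : (0 : ℝ) < R ^ 2)).const_mul _
    · refine (ae_restrict_iff' measurableSet_Ioi).2 (Filter.Eventually.of_forall fun t ht => ?_)
      have ht' : (0 : ℝ) < t := ht
      simp only [Pi.zero_apply]
      positivity

end FractionalPower

/-! ### Bessel potentials of Schwartz functions with symbol estimates -/

section SobolevUpper

variable {E : Type} [NormedAddCommGroup E] [InnerProductSpace ℝ E] [FiniteDimensional ℝ E]
  [MeasurableSpace E] [BorelSpace E]

/-- The function `(1 - Δ)^{s/2} F` for a Schwartz function `F`. -/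
noncomputable def besselFun (s : ℝ) (F : 𝓢(E, ℂ)) : E → ℂ :=
  𝓕⁻ fun ξ => ((besselWeight ξ ^ (s / 2) : ℝ) : ℂ) * 𝓕 F ξ

lemma hasTemperateGrowth_besselWeight_rpow (r : ℝ) :
    (fun x : E => ((besselWeight x ^ r : ℝ) : ℂ)).HasTemperateGrowth := by
  have h1 := (Function.hasTemperateGrowth_one_add_norm_sq_rpow E r).comp
    (((2 * Real.pi) • ContinuousLinearMap.id ℝ E).hasTemperateGrowth)
  have h2 := Function.Complex.hasTemperateGrowth_ofReal.comp h1
  refine (congrArg Function.HasTemperateGrowth (funext fun x => ?_)).mp h2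
  have : ‖(2 * Real.pi) • x‖ ^ 2 = 4 * Real.pi ^ 2 * ‖x‖ ^ 2 := by
    rw [norm_smul, Real.norm_of_nonneg (by positivity)]
    ring
  simp [Function.comp, besselWeight, this]

lemma besselFun_eq (s : ℝ) (F : 𝓢(E, ℂ)) :
    besselFun s F = SchwartzMap.fourierMultiplierCLM ℂ
      (fun x : E => ((besselWeight x ^ (s / 2) : ℝ) : ℂ)) F := by
  rw [SchwartzMap.fourierMultiplierCLM_apply, SchwartzMap.fourierInv_coe, besselFun]
  congr 1
  ext ξ
  rw [SchwartzMap.smulLeftCLM_apply_apply (hasTemperateGrowth_besselWeight_rpow _), smul_eq_mul]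

lemma isRepresentedBy_coe (F : 𝓢(E, ℂ)) : IsRepresentedBy (F : 𝓢'(E, ℂ)) F := by
  intro φ
  refine ⟨?_, ?_⟩
  · exact (F.integrable (μ := volume)).bdd_mul (c := SchwartzMap.seminorm ℝ 0 0 φ)
      φ.continuous.aestronglyMeasurable
      (Filter.Eventually.of_forall fun x => SchwartzMap.norm_le_seminorm ℝ φ x)
  · simp [SchwartzMap.toTemperedDistributionCLM_apply_apply]

/-- For a Schwartz function the infimum defining the Sobolev norm is bounded by its value at the
classical `(1 - Δ)^{s/2} F`. -/
lemma sobolevNorm_le_eLpNorm_besselFun (u s : ℝ) (F : 𝓢(E, ℂ)) :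
    sobolevNorm u s F ≤ eLpNorm (besselFun s F) (ENNReal.ofReal u) volume := by
  refine (iInf_le _ (F : 𝓢'(E, ℂ))).trans ((iInf_le _ (isRepresentedBy_coe F)).trans
    ((iInf_le _ (besselFun s F)).trans (iInf_le _ ?_)))
  have : besselOp s (F : 𝓢'(E, ℂ)) = ((SchwartzMap.fourierMultiplierCLM ℂ
      (fun x : E => ((besselWeight x ^ (s / 2) : ℝ) : ℂ)) F : 𝓢(E, ℂ)) : 𝓢'(E, ℂ)) :=
    TemperedDistribution.fourierMultiplierCLM_toTemperedDistributionCLM_eq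
      (hasTemperateGrowth_besselWeight_rpow (s / 2)) F
  rw [this, besselFun_eq]
  exact isRepresentedBy_coe _

lemma continuous_besselFun (s : ℝ) (F : 𝓢(E, ℂ)) : Continuous (besselFun s F) := by
  rw [besselFun_eq]; exact SchwartzMap.continuous _

lemma besselFun_sum {ι : Type*} (s : ℝ) (J : Finset ι) (c : ι → ℂ) (F : ι → 𝓢(E, ℂ)) (x : E) :
    besselFun s (∑ j ∈ J, c j • F j) x = ∑ j ∈ J, c j * besselFun s (F j) x := by
  simp only [besselFun_eq, map_sum, map_smul]
  simp

open Laplacian in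
/-- The operator `1 - Δ` on Schwartz functions. -/
noncomputable def oneSubLaplacian (F : 𝓢(E, ℂ)) : 𝓢(E, ℂ) := F - Δ F

lemma fourier_oneSubLaplacian (F : 𝓢(E, ℂ)) (ξ : E) :
    𝓕 (oneSubLaplacian F) ξ = (besselWeight ξ : ℂ) * 𝓕 F ξ := by
  have hg : (fun x : E => ‖x‖ ^ 2).HasTemperateGrowth := by fun_prop
  rw [oneSubLaplacian, SchwartzMap.laplacian_eq_fourierMultiplierCLM, sub_eq_add_neg,
    FourierTransform.fourier_add, FourierTransform.fourier_neg, FourierTransform.fourier_smul,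
    SchwartzMap.fourierMultiplierCLM_apply]
  rw [FourierTransform.fourier_fourierInv_eq]
  have e : SchwartzMap.smulLeftCLM ℂ (‖·‖ ^ 2 : E → ℝ) (𝓕 F) ξ = (‖ξ‖ ^ 2 : ℝ) • 𝓕 F ξ :=
    SchwartzMap.smulLeftCLM_apply_apply hg _ _
  simp only [add_apply, neg_apply, smul_apply, besselWeight]
  rw [e]
  simp only [Complex.real_smul]
  push_cast
  ring

lemma fourier_oneSubLaplacian_iterate (M : ℕ) (F : 𝓢(E, ℂ)) (ξ : E) :
    𝓕 (oneSubLaplacian^[M] F) ξ = (besselWeight ξ : ℂ) ^ M * 𝓕 F ξ := by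
  induction M with
  | zero => simp
  | succ M ih => rw [Function.iterate_succ_apply', fourier_oneSubLaplacian, ih]; ring

lemma fourierInv_besselWeight_pow (M : ℕ) (F : 𝓢(E, ℂ)) :
    (𝓕⁻ fun ξ => (besselWeight ξ : ℂ) ^ M * 𝓕 F ξ) = oneSubLaplacian^[M] F := by
  have : (fun ξ => (besselWeight ξ : ℂ) ^ M * 𝓕 F ξ) =
      ((𝓕 (oneSubLaplacian^[M] F) : 𝓢(E, ℂ)) : E → ℂ) := by
    ext ξ; rw [fourier_oneSubLaplacian_iterate]
  rw [this, ← SchwartzMap.fourierInv_coe, FourierTransform.fourierInv_fourier_eq]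

open LineDeriv in
lemma norm_iteratedFDeriv_lineDerivOp_le (v : E) (F : 𝓢(E, ℂ)) (k : ℕ) (x : E) :
    ‖iteratedFDeriv ℝ k (∂_{v} F : 𝓢(E, ℂ)) x‖ ≤ ‖v‖ * ‖iteratedFDeriv ℝ (k + 1) F x‖ := by
  have e : ((∂_{v} F : 𝓢(E, ℂ)) : E → ℂ) =
      (ContinuousLinearMap.apply ℝ ℂ v) ∘ (fderiv ℝ F) := by
    ext y; simp [SchwartzMap.lineDerivOp_apply_eq_fderiv]
  rw [e, ← norm_iteratedFDeriv_fderiv]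
  refine ((ContinuousLinearMap.apply ℝ ℂ v).norm_iteratedFDeriv_comp_left
    (f := fderiv ℝ F) (n := k) (((F.smooth (k + 1)).fderiv_right (m := k) le_rfl).contDiffAt)
    le_rfl).trans ?_
  gcongr
  refine ContinuousLinearMap.opNorm_le_bound _ (norm_nonneg _) fun T => ?_
  simpa [mul_comm] using T.le_opNorm v

/-- `F` obeys symbol estimates at frequency scale `R` with amplitude `a` and constants `c`. -/
def SymbolBound (c : ℕ → ℝ) (a R : ℝ) (F : 𝓢(E, ℂ)) : Prop :=
  ∀ k x, ‖iteratedFDeriv ℝ k F x‖ ≤ a * c k * R ^ k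

lemma SymbolBound.oneSubLaplacian {c : ℕ → ℝ} (hc : ∀ k, 0 ≤ c k) {a R : ℝ} (ha : 0 ≤ a)
    (hR : 1 ≤ R) {F : 𝓢(E, ℂ)} (hF : SymbolBound c a R F) :
    SymbolBound (fun k => c k + Module.finrank ℝ E * c (k + 2)) (a * R ^ 2) R
      (oneSubLaplacian F) := by
  intro k x
  set b := stdOrthonormalBasis ℝ E
  have e : ((MultilinearMultiplier.oneSubLaplacian F : 𝓢(E, ℂ)) : E → ℂ) =
      fun y => F y - ∑ i, (LineDeriv.lineDerivOp (b i) (LineDeriv.lineDerivOp (b i) F) : 𝓢(E, ℂ)) y := by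
    ext y
    simp [MultilinearMultiplier.oneSubLaplacian, SchwartzMap.laplacian_eq_sum b]
  have hsm : ∀ (G : 𝓢(E, ℂ)), ContDiffAt ℝ k G x := fun G => (G.smooth k).contDiffAt
  rw [e]
  have e2 : (fun y => F y - ∑ i, (LineDeriv.lineDerivOp (b i)
      (LineDeriv.lineDerivOp (b i) F) : 𝓢(E, ℂ)) y) =
      (F : E → ℂ) - fun y => ∑ i, (LineDeriv.lineDerivOp (b i)
      (LineDeriv.lineDerivOp (b i) F) : 𝓢(E, ℂ)) y := rfl
  rw [e2, iteratedFDeriv_sub_apply (hsm F) (ContDiffAt.sum fun i _ => hsm _),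
    iteratedFDeriv_fun_sum_apply (fun i _ => hsm _)]
  have h2 : ∀ i, ‖iteratedFDeriv ℝ k (LineDeriv.lineDerivOp (b i)
      (LineDeriv.lineDerivOp (b i) F) : 𝓢(E, ℂ)) x‖ ≤ a * c (k + 2) * R ^ (k + 2) := fun i => by
    refine (norm_iteratedFDeriv_lineDerivOp_le _ _ _ _).trans ?_
    rw [b.norm_eq_one, one_mul]
    refine (norm_iteratedFDeriv_lineDerivOp_le _ _ _ _).trans ?_
    rw [b.norm_eq_one, one_mul]
    exact hF _ _
  calc _ ≤ a * c k * R ^ k + ∑ _i : Fin (Module.finrank ℝ E), a * c (k + 2) * R ^ (k + 2) := by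
        refine (norm_sub_le _ _).trans (add_le_add (hF k x) ((norm_sum_le _ _).trans ?_))
        exact Finset.sum_le_sum fun i _ => h2 i
    _ ≤ _ := by
        simp only [Finset.sum_const, Finset.card_univ, Fintype.card_fin, nsmul_eq_mul]
        have h3 : a * c k * R ^ k * 1 ≤ a * c k * R ^ k * R ^ 2 := by
          refine mul_le_mul_of_nonneg_left (one_le_pow₀ hR) ?_
          have := hc k
          positivity
        rw [pow_add]
        linarith

lemma exists_symbolBound_iterate (M : ℕ) (c : ℕ → ℝ) (hc : ∀ k, 0 ≤ c k) :
    ∃ c' : ℕ → ℝ, (∀ k, 0 ≤ c' k) ∧ ∀ (a R : ℝ) (F : 𝓢(E, ℂ)), 0 ≤ a → 1 ≤ R →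
      SymbolBound c a R F → SymbolBound c' (a * R ^ (2 * M)) R (oneSubLaplacian^[M] F) := by
  induction M with
  | zero => exact ⟨c, hc, fun a R F _ _ h => by simpa using h⟩
  | succ M ih =>
    obtain ⟨c', hc', h⟩ := ih
    refine ⟨fun k => c' k + Module.finrank ℝ E * c' (k + 2), ?_, fun a R F ha hR hF => ?_⟩
    rotate_left
    · rw [Function.iterate_succ_apply']
      have := (h a R F ha hR hF).oneSubLaplacian hc' (by positivity) hR
      rw [mul_assoc, ← pow_add] at this
      exact this
    · intro k
      have := hc' k; have := hc' (k + 2)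
      positivity

lemma tsupport_oneSubLaplacian_subset (F : 𝓢(E, ℂ)) :
    tsupport (oneSubLaplacian F) ⊆ tsupport F := by
  refine closure_minimal (fun x hx => ?_) (isClosed_tsupport _)
  by_contra h
  refine hx ?_
  have h1 : F x = 0 := image_eq_zero_of_notMem_tsupport h
  have h2 : ∀ v : E, (LineDeriv.lineDerivOp v (LineDeriv.lineDerivOp v F) : 𝓢(E, ℂ)) x = 0 :=
    fun v => image_eq_zero_of_notMem_tsupport fun hh =>
      h (SchwartzMap.tsupport_lineDerivOp_subset _ _
        (SchwartzMap.tsupport_lineDerivOp_subset _ _ hh))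
  simp [oneSubLaplacian, SchwartzMap.laplacian_eq_sum (stdOrthonormalBasis ℝ E), h1, h2]

lemma tsupport_oneSubLaplacian_iterate_subset (M : ℕ) (F : 𝓢(E, ℂ)) :
    tsupport (oneSubLaplacian^[M] F) ⊆ tsupport F := by
  induction M with
  | zero => rfl
  | succ M ih =>
    rw [Function.iterate_succ_apply']
    exact (tsupport_oneSubLaplacian_subset _).trans ih

/-- Symbol estimates at scale `R` control `(1 - Δ)^{s/2}`, in sup norm and in `L¹` norm. -/
lemma exists_besselFun_bound {s : ℝ} (hs : 0 < s) (c : ℕ → ℝ) (hc : ∀ k, 0 ≤ c k) :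
    ∃ C : ℝ≥0, ∀ (R : ℝ) (S : Set E) (F : 𝓢(E, ℂ)), 1 ≤ R → SymbolBound c 1 R F →
      tsupport F ⊆ S → (∀ x, ‖besselFun s F x‖ₑ ≤ C * ENNReal.ofReal (R ^ s)) ∧
      ∫⁻ x, ‖besselFun s F x‖ₑ ≤ C * ENNReal.ofReal (R ^ s) * volume S := by
  obtain ⟨M, hM⟩ := exists_nat_gt (s / 2)
  obtain ⟨C, hC⟩ := IsMinkowski.besselWeight_rpow_le (E := E) (half_pos hs) hM
  obtain ⟨c', hc', h'⟩ := exists_symbolBound_iterate (E := E) M c hc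
  set D : ℝ := max (c 0) (c' 0)
  have hD : 0 ≤ D := (hc 0).trans (le_max_left _ _)
  refine ⟨C * D.toNNReal, fun R S F hR hF hS => ?_⟩
  have hR0 : 0 < R := one_pos.trans_le hR
  have hM' := h' 1 R F zero_le_one hR hF
  have b0 : ∀ x, ‖F x‖ₑ ≤ D.toNNReal := fun x => by
    have h := hF 0 x
    rw [norm_iteratedFDeriv_zero] at h
    rw [← ofReal_norm]
    exact ENNReal.ofReal_le_ofReal (by simpa using h.trans (by simp [D]))
  have bM : ∀ x, ‖(oneSubLaplacian^[M] F) x‖ₑ ≤ ENNReal.ofReal (R ^ (2 * M)) * D.toNNReal :=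
    fun x => by
    have h := hM' 0 x
    rw [norm_iteratedFDeriv_zero] at h
    rw [← ofReal_norm, show (D.toNNReal : ℝ≥0∞) = ENNReal.ofReal D from rfl,
      ← ENNReal.ofReal_mul (by positivity)]
    refine ENNReal.ofReal_le_ofReal (h.trans ?_)
    rw [one_mul, pow_zero, mul_one]
    gcongr
    exact le_max_right _ _
  have hγ : Measurable (𝓕 F : 𝓢(E, ℂ)) := (𝓕 F).continuous.measurable
  have hi : ∀ i : ℕ, Integrable fun ξ => (besselWeight ξ : ℂ) ^ i * 𝓕 F ξ := fun i => by
    refine ((𝓕 (oneSubLaplacian^[i] F)).integrable (μ := volume)).congr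
      (Filter.Eventually.of_forall fun ξ => ?_)
    exact fourier_oneSubLaplacian_iterate i F ξ
  have e0 : 𝓕⁻ ((𝓕 F : 𝓢(E, ℂ)) : E → ℂ) = F := by
    rw [← SchwartzMap.fourierInv_coe, FourierTransform.fourierInv_fourier_eq]
  have eR : R ^ (2 * (s / 2)) = R ^ s := by congr 1; ring
  have hl : ∀ (G : 𝓢(E, ℂ)) (b : ℝ≥0∞), tsupport G ⊆ S → (∀ x, ‖G x‖ₑ ≤ b) →
      ∫⁻ x, ‖G x‖ₑ ≤ b * volume S := by
    intro G b hGS hb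
    calc ∫⁻ x, ‖G x‖ₑ = ∫⁻ x in tsupport G, ‖G x‖ₑ := by
          rw [setLIntegral_eq_of_support_subset]
          intro x hx
          refine subset_tsupport G ?_
          simpa using hx
      _ ≤ ∫⁻ _ in tsupport G, b := lintegral_mono fun x => hb x
      _ ≤ _ := by
          rw [setLIntegral_const]
          gcongr
  constructor
  · intro x
    have h := hC _ isMinkowski_sup (𝓕 F : 𝓢(E, ℂ)) hγ hi R D.toNNReal hR0
      (by rw [e0]; exact iSup_le b0)
      (by rw [fourierInv_besselWeight_pow]; exact iSup_le bM)
    refine (le_iSup (fun x => ‖besselFun s F x‖ₑ) x).trans (h.trans (le_of_eq ?_))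
    rw [eR, ENNReal.coe_mul]; ring
  · have h := hC _ isMinkowski_lintegral (𝓕 F : 𝓢(E, ℂ)) hγ hi R (D.toNNReal * volume S) hR0
      (by rw [e0]; exact hl F _ hS b0)
      (by
        rw [fourierInv_besselWeight_pow, ← mul_assoc]
        exact hl _ _ ((tsupport_oneSubLaplacian_iterate_subset M F).trans hS) bM)
    refine h.trans (le_of_eq ?_)
    rw [eR, ENNReal.coe_mul]; ring

end SobolevUpper

/-! ### Dilated cut-offs along a linear map -/

section Families

open scoped ContDiff

variable {E : Type} [NormedAddCommGroup E] [InnerProductSpace ℝ E] [FiniteDimensional ℝ E]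
  [MeasurableSpace E] [BorelSpace E]
variable {W : Type} [NormedAddCommGroup W] [NormedSpace ℝ W]

lemma exists_iteratedFDeriv_bound {f : W → ℂ} (hf : ContDiff ℝ ∞ f) (hc : HasCompactSupport f) :
    ∃ c : ℕ → ℝ, (∀ k, 0 ≤ c k) ∧ ∀ k x, ‖iteratedFDeriv ℝ k f x‖ ≤ c k := by
  have h : ∀ k, ∃ C, ∀ x, ‖iteratedFDeriv ℝ k f x‖ ≤ C := fun k =>
    (hc.iteratedFDeriv k).exists_bound_of_continuous
      (hf.continuous_iteratedFDeriv (mod_cast le_top))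
  choose c hc using h
  exact ⟨c, fun k => (norm_nonneg _).trans (hc k 0), hc⟩

lemma norm_iteratedFDeriv_comp_dilate_le {ψ : W → ℂ} (hψ : ContDiff ℝ ∞ ψ) (L : E →L[ℝ] W)
    (b : E) {R : ℝ} (hR : 0 ≤ R) {c : ℕ → ℝ} (hc : ∀ k x, ‖iteratedFDeriv ℝ k ψ x‖ ≤ c k)
    (k : ℕ) (ξ : E) :
    ‖iteratedFDeriv ℝ k (fun ξ => ψ (R • L (ξ - b))) ξ‖ ≤ c k * ‖L‖ ^ k * R ^ k := by
  have e : (fun ξ => ψ (R • L (ξ - b))) = fun ξ => (ψ ∘ (R • L)) (ξ - b) := by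
    ext ξ; simp
  have hk : (k : WithTop ℕ∞) ≤ (⊤ : ℕ∞) := mod_cast le_top
  rw [e, iteratedFDeriv_comp_sub, (R • L).iteratedFDeriv_comp_right hψ _ hk]
  refine (ContinuousMultilinearMap.norm_compContinuousLinearMap_le _ _).trans ?_
  simp only [Finset.prod_const, Finset.card_univ, Fintype.card_fin]
  rw [norm_smul, Real.norm_of_nonneg hR, mul_pow, mul_assoc, mul_comm (R ^ k)]
  gcongr
  exact hc _ _

/-- Cut-offs of dilates of a fixed profile in the direction of a linear map satisfy symbol
estimates uniformly in the dilation. -/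
lemma exists_symbolBound_dilate {ψ : W → ℂ} (hψ : ContDiff ℝ ∞ ψ) (hψc : HasCompactSupport ψ)
    {h : E → ℂ} (hh : ContDiff ℝ ∞ h) (hhc : HasCompactSupport h) (L : E →L[ℝ] W) :
    ∃ c : ℕ → ℝ, (∀ k, 0 ≤ c k) ∧ ∀ (b : E) (R : ℝ), 1 ≤ R → ∀ F : 𝓢(E, ℂ),
      (∀ ξ, F ξ = ψ (R • L (ξ - b)) * h ξ) → SymbolBound c 1 R F := by
  obtain ⟨c₁, hc₁, h₁⟩ := exists_iteratedFDeriv_bound hψ hψc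
  obtain ⟨c₂, hc₂, h₂⟩ := exists_iteratedFDeriv_bound hh hhc
  refine ⟨fun k => ∑ i ∈ Finset.range (k + 1), (k.choose i : ℝ) * (c₁ i * ‖L‖ ^ i) * c₂ (k - i),
    fun k => Finset.sum_nonneg fun i _ => ?_, fun b R hR F hF k ξ => ?_⟩
  · have := hc₁ i; have := hc₂ (k - i)
    positivity
  · have hR0 : 0 ≤ R := zero_le_one.trans hR
    have e : (F : E → ℂ) = fun ξ => ψ (R • L (ξ - b)) * h ξ := funext hF
    have hd : ContDiff ℝ ∞ fun ξ => ψ (R • L (ξ - b)) := by fun_prop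
    rw [e, one_mul, Finset.sum_mul]
    refine (norm_iteratedFDeriv_mul_le hd hh ξ (mod_cast le_top : (k : WithTop ℕ∞) ≤ (⊤ : ℕ∞))).trans
      (Finset.sum_le_sum fun i hi => ?_)
    have hik : i ≤ k := by simpa [Nat.lt_succ_iff] using hi
    have s1 := norm_iteratedFDeriv_comp_dilate_le hψ L b hR0 h₁ i ξ
    have s2 := h₂ (k - i) ξ
    have s3 : R ^ i ≤ R ^ k := pow_le_pow_right₀ hR hik
    have := hc₁ i; have := hc₂ (k - i)
    calc _ ≤ (k.choose i : ℝ) * (c₁ i * ‖L‖ ^ i * R ^ k) * c₂ (k - i) := by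
          gcongr
          exact s1.trans (by gcongr)
      _ = _ := by ring

/-- The slabs `{|L(ξ - b)| ≤ r}` inside the ball of radius `2` have volume `O(r^δ)`: the number `δ`
is the rank of `L`. -/
def SlabBound (L : E →L[ℝ] W) (δ : ℝ) : Prop :=
  ∃ V : ℝ≥0, ∀ (b : E) (r : ℝ), 0 < r →
    volume {ξ : E | ‖L (ξ - b)‖ ≤ r ∧ ‖ξ‖ ≤ 2} ≤ V * ENNReal.ofReal (r ^ δ)

/-- The cut-offs `ψ(R L(τ ξ - a))`, multiplied by fixed smooth functions, obey the bounds `O(R^s)`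
in sup norm and `O(R^{s - δ})` in `L¹` after applying `(1 - Δ)^{s/2}`. The dilation `τ` is there
because a dyadic annulus and the support of the hump need not be aligned. -/
lemma exists_besselFun_family_bound {Θ : 𝓢(E, ℂ)}
    (hΘ : ∀ ξ, 𝓕 Θ ξ ≠ 0 → 1 / 2 ≤ ‖ξ‖ ∧ ‖ξ‖ ≤ 2) {ψ : W → ℂ} (hψ : ContDiff ℝ ∞ ψ)
    (hψc : HasCompactSupport ψ) {H : E → ℂ} (hH : ContDiff ℝ ∞ H) {L : E →L[ℝ] W} {δ : ℝ}
    (hL : SlabBound L δ) (a : E) {s : ℝ} (hs : 0 < s) {τ : ℝ} (hτ : 0 < τ) :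
    ∃ C : ℝ≥0, ∀ R : ℝ, 1 ≤ R → ∃ F : 𝓢(E, ℂ),
      (∀ ξ, F ξ = ψ (R • L (τ • ξ - a)) * H (τ • ξ) * 𝓕 Θ ξ) ∧
      (∀ x, ‖besselFun s F x‖ₑ ≤ C * ENNReal.ofReal (R ^ s)) ∧
      ∫⁻ x, ‖besselFun s F x‖ₑ ≤ C * ENNReal.ofReal (R ^ (s - δ)) := by
  obtain ⟨V, hV⟩ := hL
  obtain ⟨ρ, hρ⟩ := hψc.isCompact.isBounded.subset_closedBall 0
  set ρ' := max ρ 1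
  have hρ' : 0 < ρ' := one_pos.trans_le (le_max_right _ _)
  have hΘs : tsupport (𝓕 Θ : 𝓢(E, ℂ)) ⊆ Metric.closedBall 0 2 := by
    refine closure_minimal (fun ξ hξ => ?_) Metric.isClosed_closedBall
    simpa using (hΘ ξ hξ).2
  have hΘc : HasCompactSupport (𝓕 Θ : 𝓢(E, ℂ)) :=
    HasCompactSupport.of_support_subset_isCompact (isCompact_closedBall 0 2)
      ((subset_tsupport _).trans hΘs)
  set h : E → ℂ := fun ξ => H (τ • ξ) * 𝓕 Θ ξ
  have hh : ContDiff ℝ ∞ h := (hH.comp (contDiff_const_smul τ)).mul ((𝓕 Θ).smooth ⊤)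
  have hhc : HasCompactSupport h := hΘc.mul_left
  have hψτ : ContDiff ℝ ∞ fun w => ψ (τ • w) := hψ.comp (contDiff_const_smul τ)
  have hψτc : HasCompactSupport fun w => ψ (τ • w) :=
    hψc.comp_homeomorph (Homeomorph.smulOfNeZero τ hτ.ne')
  obtain ⟨c, hc, hcb⟩ := exists_symbolBound_dilate hψτ hψτc hh hhc L
  obtain ⟨C, hC⟩ := exists_besselFun_bound hs c hc (E := E)
  refine ⟨C + C * (V * ((ρ' / τ) ^ δ).toNNReal), fun R hR => ?_⟩
  have hR0 : 0 < R := one_pos.trans_le hR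
  have hsm : ContDiff ℝ ∞ fun ξ => ψ (τ • (R • L (ξ - τ⁻¹ • a))) * h ξ := by fun_prop
  have hcs : HasCompactSupport fun ξ => ψ (τ • (R • L (ξ - τ⁻¹ • a))) * h ξ := hhc.mul_left
  set F : 𝓢(E, ℂ) := hcs.toSchwartzMap hsm
  have hF : ∀ ξ, F ξ = ψ (τ • (R • L (ξ - τ⁻¹ • a))) * h ξ := fun ξ => rfl
  obtain ⟨h1, h2⟩ := hC R {ξ : E | ‖L (ξ - τ⁻¹ • a)‖ ≤ ρ' / τ / R ∧ ‖ξ‖ ≤ 2} F hR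
    (hcb (τ⁻¹ • a) R hR F hF) (by
      refine closure_minimal (fun ξ hξ => ?_) ?_
      · have hξ' : F ξ ≠ 0 := hξ
        rw [hF] at hξ'
        have k1 := left_ne_zero_of_mul hξ'
        have k2 := right_ne_zero_of_mul (right_ne_zero_of_mul hξ')
        refine ⟨?_, (hΘ ξ k2).2⟩
        have k3 := hρ (subset_tsupport _ k1)
        rw [mem_closedBall_zero_iff, norm_smul, norm_smul, Real.norm_of_nonneg hτ.le,
          Real.norm_of_nonneg hR0.le] at k3
        rw [le_div_iff₀ hR0, le_div_iff₀ hτ]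
        have : ρ ≤ ρ' := le_max_left _ _
        linarith
      · exact (isClosed_le ((L.continuous.comp (continuous_id.sub continuous_const)).norm)
          continuous_const).inter
          (isClosed_le continuous_norm continuous_const))
  refine ⟨F, fun ξ => ?_, fun x => (h1 x).trans ?_, h2.trans ?_⟩
  · rw [hF, smul_comm, ← map_smul, smul_sub, smul_smul, mul_inv_cancel₀ hτ.ne', one_smul, mul_assoc]
  · gcongr
    exact le_self_add
  · calc _ ≤ C * ENNReal.ofReal (R ^ s) * (V * ENNReal.ofReal ((ρ' / τ / R) ^ δ)) := by
          gcongr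
          exact hV _ _ (by positivity)
      _ = (C * (V * ((ρ' / τ) ^ δ).toNNReal) : ℝ≥0) * ENNReal.ofReal (R ^ (s - δ)) := by
          rw [Real.div_rpow (by positivity) hR0.le, Real.rpow_sub hR0, ENNReal.coe_mul,
            ENNReal.coe_mul, show ((((ρ' / τ) ^ δ).toNNReal : ℝ≥0) : ℝ≥0∞) =
              ENNReal.ofReal ((ρ' / τ) ^ δ) from rfl, div_eq_mul_inv _ (R ^ δ),
            div_eq_mul_inv _ (R ^ δ), ENNReal.ofReal_mul (by positivity),
            ENNReal.ofReal_mul (by positivity)]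
          ring
      _ ≤ _ := by
          gcongr
          exact le_add_self

end Families

/-! ### Sums of functions of geometrically growing height -/

section LayerSums

variable {X : Type*} [MeasurableSpace X] {μ : Measure X}

/-- Bernoulli's inequality in the form needed for telescoping powers of partial sums. -/
lemma rpow_add_le_rpow_add_mul {u x y : ℝ} (hu : 1 ≤ u) (hx : 0 ≤ x) (hy : 0 ≤ y) :
    (x + y) ^ u ≤ x ^ u + u * y * (x + y) ^ (u - 1) := by
  rcases eq_or_lt_of_le (add_nonneg hx hy) with h0 | h0
  · have hx0 : x = 0 := by linarith
    have hy0 : y = 0 := by linarith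
    subst hx0 hy0
    simp
  have hB := one_add_mul_self_le_rpow_one_add (s := -(y / (x + y))) (by
    have : y / (x + y) ≤ 1 := (div_le_one h0).2 (by linarith)
    linarith) hu
  have e1 : 1 + -(y / (x + y)) = x / (x + y) := by field_simp; ring
  rw [e1, Real.div_rpow hx h0.le, le_div_iff₀ (Real.rpow_pos_of_pos h0 u)] at hB
  have e2 : (x + y) ^ u = (x + y) ^ (u - 1) * (x + y) := by
    rw [← Real.rpow_add_one h0.ne']; ring_nf
  have e3 : u * (y / (x + y)) * (x + y) ^ u = u * y * (x + y) ^ (u - 1) := by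
    rw [e2]; field_simp
  linarith

/-- If the terms grow at most geometrically, the power of the sum is controlled by a weighted sum
of the terms. -/
lemma rpow_sum_le_of_geometric {u q : ℝ} (hu : 1 ≤ u) (hq : 1 < q) {C : ℝ} (hC : 0 ≤ C)
    {b : ℕ → ℝ} (hb : ∀ j, 0 ≤ b j) (hbq : ∀ j, b j ≤ C * q ^ j) (N : ℕ) :
    (∑ j ∈ Finset.range N, b j) ^ u ≤
      u * (C * q / (q - 1)) ^ (u - 1) * ∑ j ∈ Finset.range N, b j * (q ^ j) ^ (u - 1) := by
  have hq1 : 0 < q - 1 := by linarith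
  have hS : ∀ N, ∑ j ∈ Finset.range (N + 1), b j ≤ C * q / (q - 1) * q ^ N := by
    intro N
    calc _ ≤ ∑ j ∈ Finset.range (N + 1), C * q ^ j := Finset.sum_le_sum fun j _ => hbq j
      _ = C * ((q ^ (N + 1) - 1) / (q - 1)) := by
          rw [← Finset.mul_sum, geom_sum_eq hq.ne']
      _ ≤ C * (q ^ (N + 1) / (q - 1)) := by gcongr; linarith
      _ = _ := by rw [pow_succ]; ring
  induction N with
  | zero => simp [Real.zero_rpow (by linarith : u ≠ 0)]
  | succ N ih =>
    rw [Finset.sum_range_succ, Finset.sum_range_succ _ N, mul_add]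
    have h0 : 0 ≤ ∑ j ∈ Finset.range N, b j := Finset.sum_nonneg fun j _ => hb j
    refine (rpow_add_le_rpow_add_mul hu h0 (hb N)).trans (add_le_add ih ?_)
    have h1 := hS N
    rw [Finset.sum_range_succ] at h1
    have h2 : (∑ j ∈ Finset.range N, b j + b N) ^ (u - 1) ≤
        (C * q / (q - 1)) ^ (u - 1) * (q ^ N) ^ (u - 1) := by
      rw [← Real.mul_rpow (by positivity) (by positivity)]
      exact Real.rpow_le_rpow (add_nonneg h0 (hb N)) h1 (by linarith)
    calc _ ≤ u * b N * ((C * q / (q - 1)) ^ (u - 1) * (q ^ N) ^ (u - 1)) :=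
          mul_le_mul_of_nonneg_left h2 (mul_nonneg (by linarith) (hb N))
      _ = _ := by ring

/-- A function bounded by `K` with `L¹` norm at most `I` has `L^u` norm at most
`K^{1-1/u} I^{1/u}`. -/
lemma eLpNorm_le_of_sup_of_lintegral {u : ℝ} (hu : 1 ≤ u) {g : X → ℂ} {K : ℝ≥0} {I : ℝ≥0∞}
    (hg : ∀ x, ‖g x‖ₑ ≤ K) (hI : ∫⁻ x, ‖g x‖ₑ ∂μ ≤ I) :
    eLpNorm g (ENNReal.ofReal u) μ ≤ ((K : ℝ≥0∞) ^ (u - 1) * I) ^ (1 / u) := by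
  have hu0 : 0 < u := one_pos.trans_le hu
  rw [eLpNorm_eq_lintegral_rpow_enorm_toReal (by simpa using hu0) ENNReal.ofReal_ne_top,
    ENNReal.toReal_ofReal hu0.le]
  refine ENNReal.rpow_le_rpow ?_ (by positivity)
  calc ∫⁻ x, ‖g x‖ₑ ^ u ∂μ ≤ ∫⁻ x, ‖g x‖ₑ * (K : ℝ≥0∞) ^ (u - 1) ∂μ := by
        refine lintegral_mono fun x => ?_
        simp only
        rw [show u = 1 + (u - 1) by ring, ENNReal.rpow_add_of_nonneg _ _ zero_le_one (by linarith),
          ENNReal.rpow_one, add_sub_cancel_left]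
        exact mul_le_mul_right (ENNReal.rpow_le_rpow (hg x) (by linarith)) _
    _ ≤ _ := by
        rw [lintegral_mul_const' _ _ (ENNReal.rpow_ne_top_of_nonneg (by linarith)
          ENNReal.coe_ne_top), mul_comm]
        gcongr

/-- Functions `g_j` of height `q^j` and `L^u` norm `O(1)` are so far from being aligned that the
`L^u` norm of the sum of `N` of them is only `O(N^{1/u})`. -/
lemma exists_eLpNorm_sum_le {u q : ℝ} (hu : 1 ≤ u) (hq : 1 < q) (C : ℝ≥0) :
    ∃ C' : ℝ≥0, ∀ g : ℕ → X → ℂ, (∀ j, Measurable (g j)) →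
      (∀ j x, ‖g j x‖ₑ ≤ C * ENNReal.ofReal (q ^ j)) →
      (∀ j, ∫⁻ x, ‖g j x‖ₑ ∂μ ≤ C * ENNReal.ofReal (((q ^ j) ^ (u - 1))⁻¹)) →
      ∀ N : ℕ, eLpNorm (fun x => ∑ j ∈ Finset.range N, g j x) (ENNReal.ofReal u) μ ≤
        C' * (N : ℝ≥0∞) ^ (1 / u) := by
  have hu0 : 0 < u := one_pos.trans_le hu
  have hq1 : 0 < q - 1 := by linarith
  set K : ℝ := u * (C * q / (q - 1)) ^ (u - 1)
  have hK : 0 ≤ K := by positivity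
  refine ⟨(K.toNNReal * C) ^ (1 / u), fun g hg hsup hint N => ?_⟩
  rw [eLpNorm_eq_lintegral_rpow_enorm_toReal (by simpa using hu0) ENNReal.ofReal_ne_top,
    ENNReal.toReal_ofReal hu0.le, ENNReal.coe_rpow_of_nonneg _ (by positivity),
    ← ENNReal.mul_rpow_of_nonneg _ _ (by positivity)]
  refine ENNReal.rpow_le_rpow ?_ (by positivity)
  have hpt : ∀ x, ‖∑ j ∈ Finset.range N, g j x‖ₑ ^ u ≤
      ENNReal.ofReal K * ∑ j ∈ Finset.range N, ‖g j x‖ₑ * ENNReal.ofReal ((q ^ j) ^ (u - 1)) := by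
    intro x
    have h1 := rpow_sum_le_of_geometric hu hq C.coe_nonneg (b := fun j => ‖g j x‖) (fun j => norm_nonneg _)
      (fun j => by
        have := hsup j x
        rw [← ofReal_norm, ← ENNReal.ofReal_coe_nnreal, ← ENNReal.ofReal_mul C.coe_nonneg] at this
        exact (ENNReal.ofReal_le_ofReal_iff (by positivity)).1 this) N
    have h2 : ‖∑ j ∈ Finset.range N, g j x‖ ^ u ≤ (∑ j ∈ Finset.range N, ‖g j x‖) ^ u :=
      Real.rpow_le_rpow (norm_nonneg _) (norm_sum_le _ _) hu0.le
    rw [← ofReal_norm, ENNReal.ofReal_rpow_of_nonneg (norm_nonneg _) hu0.le]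
    refine (ENNReal.ofReal_le_ofReal (h2.trans h1)).trans (le_of_eq ?_)
    rw [ENNReal.ofReal_mul hK, ENNReal.ofReal_sum_of_nonneg fun j _ => by positivity]
    congr 1
    refine Finset.sum_congr rfl fun j _ => ?_
    rw [ENNReal.ofReal_mul (norm_nonneg _), ofReal_norm]
  calc _ ≤ ∫⁻ x, ENNReal.ofReal K * ∑ j ∈ Finset.range N,
          ‖g j x‖ₑ * ENNReal.ofReal ((q ^ j) ^ (u - 1)) ∂μ := lintegral_mono hpt
    _ = ENNReal.ofReal K * ∑ j ∈ Finset.range N,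
          (∫⁻ x, ‖g j x‖ₑ ∂μ) * ENNReal.ofReal ((q ^ j) ^ (u - 1)) := by
        rw [lintegral_const_mul _ (by fun_prop), lintegral_finsetSum _ (by fun_prop)]
        congr 1
        exact Finset.sum_congr rfl fun j _ => lintegral_mul_const _ (by fun_prop)
    _ ≤ ENNReal.ofReal K * ∑ j ∈ Finset.range N, (C : ℝ≥0∞) := by
        gcongr with j _
        calc _ ≤ (C : ℝ≥0∞) * ENNReal.ofReal (((q ^ j) ^ (u - 1))⁻¹) *
              ENNReal.ofReal ((q ^ j) ^ (u - 1)) := by gcongr; exact hint j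
          _ = _ := by
              have : 0 < (q ^ j) ^ (u - 1) := by positivity
              rw [mul_assoc, ← ENNReal.ofReal_mul (by positivity), inv_mul_cancel₀ this.ne',
                ENNReal.ofReal_one, mul_one]
    _ = _ := by
        rw [Finset.sum_const, Finset.card_range, nsmul_eq_mul, ENNReal.coe_mul]
        rw [show ((K.toNNReal : ℝ≥0) : ℝ≥0∞) = ENNReal.ofReal K from rfl]
        ring

end LayerSums

/-! ### Hardy quasi-norms of scaled derivatives -/

section Hardy

variable {n : ℕ}

lemma exists_one_add_pow_mul_le {V F : Type*} [NormedAddCommGroup V] [NormedSpace ℝ V]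
    [NormedAddCommGroup F] [NormedSpace ℝ F] (Ψ : 𝓢(V, F)) (M : ℕ) :
    ∃ B : ℝ, 0 ≤ B ∧ ∀ x, (1 + ‖x‖) ^ M * ‖Ψ x‖ ≤ B := by
  refine ⟨_, ?_, fun x => by
    simpa using SchwartzMap.one_add_le_sup_seminorm_apply (𝕜 := ℝ) (m := (M, 0)) (k := M) (n := 0)
      le_rfl le_rfl Ψ x⟩
  positivity

lemma integrable_one_add_pow_mul {V : Type*} [NormedAddCommGroup V] [NormedSpace ℝ V]
    [FiniteDimensional ℝ V] [MeasurableSpace V] [BorelSpace V] (μ : Measure V) [μ.IsAddHaarMeasure]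
    {g : V → ℂ} (hg : Continuous g) {M : ℕ} {C : ℝ}
    (h : ∀ x, (1 + ‖x‖) ^ (M + Module.finrank ℝ V + 1) * ‖g x‖ ≤ C) :
    Integrable (fun x => (1 + ‖x‖) ^ M * ‖g x‖) μ ∧
      ∫ x, (1 + ‖x‖) ^ M * ‖g x‖ ∂μ ≤
        C * ∫ x : V, (1 + ‖x‖) ^ (-((Module.finrank ℝ V + 1 : ℕ) : ℝ)) ∂μ := by
  have hi : Integrable (fun x : V => C * (1 + ‖x‖) ^ (-((Module.finrank ℝ V + 1 : ℕ) : ℝ))) μ :=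
    (integrable_one_add_norm (by push_cast; linarith)).const_mul C
  have hb : ∀ x : V, (1 + ‖x‖) ^ M * ‖g x‖ ≤
      C * (1 + ‖x‖) ^ (-((Module.finrank ℝ V + 1 : ℕ) : ℝ)) := fun x => by
    rw [Real.rpow_neg (by positivity), Real.rpow_natCast, ← div_eq_mul_inv,
      le_div_iff₀ (by positivity)]
    refine le_trans (le_of_eq ?_) (h x)
    rw [add_assoc, pow_add]; ring
  have hI : Integrable (fun x => (1 + ‖x‖) ^ M * ‖g x‖) μ := by
    refine hi.mono' (Continuous.aestronglyMeasurable (by fun_prop))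
      (Filter.Eventually.of_forall fun x => ?_)
    rw [Real.norm_of_nonneg (by positivity)]
    exact hb x
  refine ⟨hI, ?_⟩
  rw [← integral_const_mul]
  exact integral_mono hI hi hb

/-- The mollification `Φ_t * f`. -/
noncomputable def mollify (Φ : EuclideanSpace ℝ (Fin n) → ℂ) (t : ℝ)
    (f : EuclideanSpace ℝ (Fin n) → ℂ) (x : EuclideanSpace ℝ (Fin n)) : ℂ :=
  ∫ y, (((t ^ n)⁻¹ : ℝ) : ℂ) * Φ (t⁻¹ • (x - y)) * f y

open LineDeriv in
/-- A derivative of `g` falls on the mollifier at the price of `t⁻¹`. -/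
lemma mollify_lineDerivOp (Φ g : 𝓢(EuclideanSpace ℝ (Fin n), ℂ)) (t : ℝ)
    (v x : EuclideanSpace ℝ (Fin n)) :
    mollify Φ t (∂_{v} g : 𝓢(EuclideanSpace ℝ (Fin n), ℂ)) x =
      (t⁻¹ : ℝ) * mollify (∂_{v} Φ : 𝓢(EuclideanSpace ℝ (Fin n), ℂ)) t g x := by
  have hd : ∀ y, HasFDerivAt (fun y => Φ (t⁻¹ • (x - y)))
      ((fderiv ℝ Φ (t⁻¹ • (x - y))).comp (t⁻¹ • -(ContinuousLinearMap.id ℝ _))) y := by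
    intro y
    have h1 : HasFDerivAt (fun y : EuclideanSpace ℝ (Fin n) => t⁻¹ • (x - y))
        (t⁻¹ • -(ContinuousLinearMap.id ℝ _)) y :=
      ((hasFDerivAt_id y).const_sub x).const_smul t⁻¹
    exact (Φ.differentiableAt.hasFDerivAt).comp y h1
  have hd' : ∀ y, fderiv ℝ (fun y => Φ (t⁻¹ • (x - y))) y v =
      -((t⁻¹ : ℝ) : ℂ) * (∂_{v} Φ : 𝓢(EuclideanSpace ℝ (Fin n), ℂ)) (t⁻¹ • (x - y)) := by
    intro y
    rw [(hd y).fderiv, SchwartzMap.lineDerivOp_apply_eq_fderiv]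
    simp
  have hbd : ∀ (Ψ h : 𝓢(EuclideanSpace ℝ (Fin n), ℂ)),
      Integrable fun y => Ψ (t⁻¹ • (x - y)) * h y := fun Ψ h =>
    (h.integrable (μ := volume)).bdd_mul (c := SchwartzMap.seminorm ℝ 0 0 Ψ)
      (Continuous.aestronglyMeasurable (by fun_prop))
      (Filter.Eventually.of_forall fun y => SchwartzMap.norm_le_seminorm ℝ Ψ _)
  have key := integral_mul_fderiv_eq_neg_fderiv_mul_of_integrable (μ := volume) (v := v)
    (f := fun y => Φ (t⁻¹ • (x - y))) (g := g)
    (by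
      simp only [hd', mul_assoc]
      exact (hbd _ _).const_mul _)
    (by
      simp only [← SchwartzMap.lineDerivOp_apply_eq_fderiv]
      exact hbd _ _) (hbd _ _) (fun y _ => (hd y).differentiableAt)
    (fun y _ => g.differentiableAt)
  simp only [mollify, mul_assoc, integral_const_mul, SchwartzMap.lineDerivOp_apply_eq_fderiv]
    at key ⊢
  rw [key]
  simp only [hd', SchwartzMap.lineDerivOp_apply_eq_fderiv, mul_assoc, integral_const_mul]
  ring

lemma integrable_mollifier_kernel {F : EuclideanSpace ℝ (Fin n) → ℝ} (hF : Integrable F) {t : ℝ}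
    (ht : 0 < t) (x : EuclideanSpace ℝ (Fin n)) :
    Integrable (fun y => (t ^ n)⁻¹ * F (t⁻¹ • (x - y))) ∧
      ∫ y, (t ^ n)⁻¹ * F (t⁻¹ • (x - y)) = ∫ y, F y := by
  have h1 : Integrable (fun y => F (t⁻¹ • y)) := hF.comp_smul (inv_ne_zero ht.ne')
  refine ⟨(h1.comp_sub_left x).const_mul _, ?_⟩
  rw [integral_const_mul, integral_sub_left_eq_self (fun y => F (t⁻¹ • y)),
    Measure.integral_comp_smul]
  simp only [finrank_euclideanSpace, Fintype.card_fin, inv_pow, inv_inv, smul_eq_mul]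
  rw [abs_of_pos (by positivity), ← mul_assoc, inv_mul_cancel₀ (by positivity), one_mul]

/-- Mollification at scales `t ≤ 1` preserves polynomial decay. -/
lemma one_add_pow_mul_norm_mollify_le_of_le_one {Φ f : EuclideanSpace ℝ (Fin n) → ℂ} {M : ℕ}
    {C : ℝ} (hΦ : Integrable fun y => (1 + ‖y‖) ^ M * ‖Φ y‖) (hf : ∀ y, (1 + ‖y‖) ^ M * ‖f y‖ ≤ C)
    {t : ℝ} (ht : 0 < t) (ht1 : t ≤ 1) (x : EuclideanSpace ℝ (Fin n)) :
    (1 + ‖x‖) ^ M * ‖mollify Φ t f x‖ ≤ C * ∫ y, (1 + ‖y‖) ^ M * ‖Φ y‖ := by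
  obtain ⟨h1, h2⟩ := integrable_mollifier_kernel hΦ ht x
  rw [← h2, ← integral_const_mul, mollify]
  have hx : 0 < (1 + ‖x‖) ^ M := by positivity
  rw [mul_comm, ← le_div_iff₀ hx, div_eq_inv_mul, ← integral_const_mul]
  refine norm_integral_le_of_norm_le ((h1.const_mul _).const_mul _)
    (Filter.Eventually.of_forall fun y => ?_)
  rw [norm_mul, norm_mul, Complex.norm_real, Real.norm_of_nonneg (by positivity),
    le_inv_mul_iff₀ hx, mul_comm ((1 + ‖x‖) ^ M)]
  -- Peetre's inequality, using `t ≤ 1`.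
  have hP : 1 + ‖x‖ ≤ (1 + ‖t⁻¹ • (x - y)‖) * (1 + ‖y‖) := by
    have e1 : ‖x - y‖ ≤ ‖t⁻¹ • (x - y)‖ := by
      rw [norm_smul, Real.norm_of_nonneg (by positivity)]
      exact le_mul_of_one_le_left (norm_nonneg _) ((one_le_inv₀ ht).2 ht1)
    have e2 : ‖x‖ ≤ ‖x - y‖ + ‖y‖ := by simpa using norm_add_le (x - y) y
    nlinarith [norm_nonneg y, norm_nonneg (x - y),
      mul_nonneg (norm_nonneg (t⁻¹ • (x - y))) (norm_nonneg y)]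
  have hP' : (1 + ‖x‖) ^ M ≤ (1 + ‖t⁻¹ • (x - y)‖) ^ M * (1 + ‖y‖) ^ M := by
    rw [← mul_pow]
    exact pow_le_pow_left₀ (by positivity) hP M
  calc (t ^ n)⁻¹ * ‖Φ (t⁻¹ • (x - y))‖ * ‖f y‖ * (1 + ‖x‖) ^ M
      ≤ (t ^ n)⁻¹ * ‖Φ (t⁻¹ • (x - y))‖ * ‖f y‖ *
        ((1 + ‖t⁻¹ • (x - y)‖) ^ M * (1 + ‖y‖) ^ M) := by gcongr
    _ = ((t ^ n)⁻¹ * ((1 + ‖t⁻¹ • (x - y)‖) ^ M * ‖Φ (t⁻¹ • (x - y))‖)) *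
        ((1 + ‖y‖) ^ M * ‖f y‖) := by ring
    _ ≤ ((t ^ n)⁻¹ * ((1 + ‖t⁻¹ • (x - y)‖) ^ M * ‖Φ (t⁻¹ • (x - y))‖)) * C := by
        gcongr
        exact hf y
    _ = _ := by ring

/-- At scales `t ≥ 1` mollification loses at most a factor `t^M` of polynomial decay. -/
lemma one_add_pow_mul_norm_mollify_le_of_one_le {Φ g : EuclideanSpace ℝ (Fin n) → ℂ} {M : ℕ}
    {B : ℝ} (hΦ : ∀ y, (1 + ‖y‖) ^ M * ‖Φ y‖ ≤ B) (hg : Integrable fun y => (1 + ‖y‖) ^ M * ‖g y‖)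
    {t : ℝ} (ht1 : 1 ≤ t) (x : EuclideanSpace ℝ (Fin n)) :
    (1 + ‖x‖) ^ M * ‖mollify Φ t g x‖ ≤ t ^ M * (B * ∫ y, (1 + ‖y‖) ^ M * ‖g y‖) := by
  have ht : 0 < t := one_pos.trans_le ht1
  rw [← integral_const_mul, ← integral_const_mul, mollify]
  have hx : 0 < (1 + ‖x‖) ^ M := by positivity
  rw [mul_comm, ← le_div_iff₀ hx, div_eq_inv_mul, ← integral_const_mul]
  refine norm_integral_le_of_norm_le (((hg.const_mul _).const_mul _).const_mul _)
    (Filter.Eventually.of_forall fun y => ?_)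
  rw [norm_mul, norm_mul, Complex.norm_real, Real.norm_of_nonneg (by positivity),
    le_inv_mul_iff₀ hx, mul_comm ((1 + ‖x‖) ^ M)]
  -- Peetre's inequality for the dilated kernel, using `1 ≤ t`.
  have hP : 1 + ‖x‖ ≤ t * ((1 + ‖t⁻¹ • (x - y)‖) * (1 + ‖y‖)) := by
    have e1 : t * ‖t⁻¹ • (x - y)‖ = ‖x - y‖ := by
      rw [norm_smul, Real.norm_of_nonneg (by positivity)]
      field_simp
    have e2 : ‖x‖ ≤ ‖x - y‖ + ‖y‖ := by simpa using norm_add_le (x - y) y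
    have e3 : t * ((1 + ‖t⁻¹ • (x - y)‖) * (1 + ‖y‖)) =
        t + t * ‖y‖ + ‖x - y‖ * (1 + ‖y‖) := by rw [← e1]; ring
    rw [e3]
    nlinarith [norm_nonneg y, norm_nonneg (x - y), mul_nonneg (norm_nonneg (x - y)) (norm_nonneg y)]
  have hP' : (1 + ‖x‖) ^ M ≤ t ^ M * ((1 + ‖t⁻¹ • (x - y)‖) ^ M * (1 + ‖y‖) ^ M) := by
    rw [← mul_pow, ← mul_pow]
    exact pow_le_pow_left₀ (by positivity) hP M
  have htn : (t ^ n)⁻¹ ≤ 1 := inv_le_one_of_one_le₀ (one_le_pow₀ ht1)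
  calc (t ^ n)⁻¹ * ‖Φ (t⁻¹ • (x - y))‖ * ‖g y‖ * (1 + ‖x‖) ^ M
      ≤ 1 * ‖Φ (t⁻¹ • (x - y))‖ * ‖g y‖ *
        (t ^ M * ((1 + ‖t⁻¹ • (x - y)‖) ^ M * (1 + ‖y‖) ^ M)) := by gcongr
    _ = t ^ M * (((1 + ‖t⁻¹ • (x - y)‖) ^ M * ‖Φ (t⁻¹ • (x - y))‖) *
        ((1 + ‖y‖) ^ M * ‖g y‖)) := by ring
    _ ≤ t ^ M * (B * ((1 + ‖y‖) ^ M * ‖g y‖)) := by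
        gcongr
        exact hΦ _

/-- A pointwise bound on all mollifications gives a bound of the Hardy quasi-norm. -/
lemma hardyNorm_le_of_decay (Φ : 𝓢(EuclideanSpace ℝ (Fin n), ℂ)) {q : ℝ} (hq : 0 < q) {M : ℕ}
    {D : ℝ} (f : EuclideanSpace ℝ (Fin n) → ℂ)
    (h : ∀ t, 0 < t → ∀ x, (1 + ‖x‖) ^ M * ‖mollify Φ t f x‖ ≤ D) :
    hardyNorm Φ q f ≤ (∫⁻ x : EuclideanSpace ℝ (Fin n),
      ENNReal.ofReal ((D / (1 + ‖x‖) ^ M) ^ q)) ^ (1 / q) := by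
  have hD : 0 ≤ D := le_trans (by positivity) (h 1 one_pos 0)
  rw [hardyNorm, eLpNorm_eq_lintegral_rpow_enorm_toReal (by simpa using hq) ENNReal.ofReal_ne_top,
    ENNReal.toReal_ofReal hq.le]
  refine ENNReal.rpow_le_rpow (lintegral_mono fun x => ?_) (by positivity)
  rw [← ENNReal.ofReal_rpow_of_nonneg (by positivity) hq.le]
  refine ENNReal.rpow_le_rpow ?_ hq.le
  rw [enorm_eq_self]
  refine iSup₂_le fun t ht => ?_
  have := h t ht x
  rw [← ofReal_norm]
  refine ENNReal.ofReal_le_ofReal ?_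
  rw [le_div_iff₀ (by positivity), mul_comm]
  exact this

lemma lintegral_decay_lt_top {q : ℝ} {M : ℕ} (hM : n < M * q) (D : ℝ) (hD : 0 ≤ D) :
    ∫⁻ x : EuclideanSpace ℝ (Fin n), ENNReal.ofReal ((D / (1 + ‖x‖) ^ M) ^ q) < ∞ := by
  have hi : Integrable (fun x : EuclideanSpace ℝ (Fin n) => D ^ q * (1 + ‖x‖) ^ (-(M * q))) :=
    (integrable_one_add_norm (by simpa using hM)).const_mul _
  have e : ∀ x : EuclideanSpace ℝ (Fin n),
      (D / (1 + ‖x‖) ^ M) ^ q = D ^ q * (1 + ‖x‖) ^ (-(M * q)) := fun x => by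
    rw [Real.div_rpow hD (by positivity), Real.rpow_neg (by positivity), Real.rpow_mul
      (by positivity), Real.rpow_natCast, div_eq_mul_inv]
  simp_rw [e]
  exact hi.lintegral_lt_top

open LineDeriv in
/-- The scaled derivative `R⁻¹ ∂_v`. -/
noncomputable def scaledDeriv (R : ℝ) (v : EuclideanSpace ℝ (Fin n))
    (g : 𝓢(EuclideanSpace ℝ (Fin n), ℂ)) : 𝓢(EuclideanSpace ℝ (Fin n), ℂ) :=
  ((R⁻¹ : ℝ) : ℂ) • ∂_{v} g

lemma mollify_scaledDeriv_iterate (K : ℕ) (Φ g : 𝓢(EuclideanSpace ℝ (Fin n), ℂ)) (t R : ℝ)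
    (v x : EuclideanSpace ℝ (Fin n)) :
    mollify Φ t ((scaledDeriv R v)^[K] g) x =
      (((R * t)⁻¹ ^ K : ℝ) : ℂ) * mollify ((scaledDeriv 1 v)^[K] Φ) t g x := by
  induction K generalizing Φ with
  | zero => simp
  | succ K ih =>
    have h1 : mollify Φ t ((scaledDeriv R v)^[K + 1] g) x = (((R * t)⁻¹ : ℝ) : ℂ) *
        mollify (scaledDeriv 1 v Φ) t ((scaledDeriv R v)^[K] g) x := by
      have hs : ∀ (c : ℂ) (Ψ h : EuclideanSpace ℝ (Fin n) → ℂ),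
          mollify Ψ t (c • h) x = c * mollify Ψ t h x := fun c Ψ h => by
        simp only [mollify, ← integral_const_mul, Pi.smul_apply, smul_eq_mul]
        congr 1 with y; ring
      rw [Function.iterate_succ_apply', scaledDeriv]
      have := hs ((R⁻¹ : ℝ) : ℂ) Φ (LineDeriv.lineDerivOp v ((scaledDeriv R v)^[K] g) :
        𝓢(EuclideanSpace ℝ (Fin n), ℂ))
      rw [← FunLike.coe_smul] at this
      rw [this, mollify_lineDerivOp Φ]
      simp [scaledDeriv]
      ring
    rw [h1, ih, Function.iterate_succ_apply]
    push_cast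
    ring

/-- Uniform control of the Hardy quasi-norm of `(R⁻¹ ∂_v)^M g` for large `R`: at scales `t ≤ 1` the
function itself decays, and at scales `t ≥ 1` its `M` derivatives fall on the mollifier. -/
lemma exists_hardyNorm_scaledDeriv_le (Φ : 𝓢(EuclideanSpace ℝ (Fin n), ℂ)) {q : ℝ} (hq : 0 < q)
    {M : ℕ} (hM : n < M * q) (v : EuclideanSpace ℝ (Fin n)) (C : ℝ) :
    ∃ C' : ℝ≥0, ∀ (R : ℝ) (g : 𝓢(EuclideanSpace ℝ (Fin n), ℂ)), 1 ≤ R →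
      (∀ x, (1 + ‖x‖) ^ (M + n + 1) * ‖g x‖ ≤ C) →
      (∀ x, (1 + ‖x‖) ^ M * ‖((scaledDeriv R v)^[M] g) x‖ ≤ C) →
      hardyNorm Φ q ((scaledDeriv R v)^[M] g) ≤ C' := by
  obtain ⟨B₁, hB₁0, hB₁⟩ := exists_one_add_pow_mul_le Φ (M + n + 1)
  obtain ⟨B₂, hB₂0, hB₂⟩ := exists_one_add_pow_mul_le ((scaledDeriv 1 v)^[M] Φ) M
  set I := ∫ x : EuclideanSpace ℝ (Fin n), (1 + ‖x‖) ^
    (-((Module.finrank ℝ (EuclideanSpace ℝ (Fin n)) + 1 : ℕ) : ℝ))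
  have hI : 0 ≤ I := integral_nonneg fun x => by positivity
  set D : ℝ := max (C * (B₁ * I)) (B₂ * (C * I))
  refine ⟨((∫⁻ x : EuclideanSpace ℝ (Fin n),
    ENNReal.ofReal ((max D 0 / (1 + ‖x‖) ^ M) ^ q)) ^ (1 / q)).toNNReal,
      fun R g hR hg hf => ?_⟩
  rw [ENNReal.coe_toNNReal (ENNReal.rpow_ne_top_of_nonneg (by positivity)
    (lintegral_decay_lt_top hM _ (le_max_right _ _)).ne)]
  have hC : 0 ≤ C := le_trans (by positivity) (hf 0)
  have hg' : ∀ x, (1 + ‖x‖) ^ (M + Module.finrank ℝ (EuclideanSpace ℝ (Fin n)) + 1) * ‖g x‖ ≤ C :=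
    by simpa using hg
  have hΦ' : ∀ x, (1 + ‖x‖) ^ (M + Module.finrank ℝ (EuclideanSpace ℝ (Fin n)) + 1) * ‖Φ x‖ ≤ B₁ :=
    by simpa using hB₁
  obtain ⟨hg1, hg2⟩ := integrable_one_add_pow_mul volume g.continuous hg'
  obtain ⟨hΦ1, hΦ2⟩ := integrable_one_add_pow_mul volume Φ.continuous hΦ'
  refine hardyNorm_le_of_decay Φ hq _ fun t ht x => ?_
  refine le_trans ?_ (le_max_left _ _)
  rcases le_total t 1 with ht1 | ht1
  · refine (one_add_pow_mul_norm_mollify_le_of_le_one hΦ1 hf ht ht1 x).trans ?_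
    exact (mul_le_mul_of_nonneg_left hΦ2 hC).trans (le_max_left _ _)
  · rw [mollify_scaledDeriv_iterate M Φ g, norm_mul, Complex.norm_real]
    have h2 := one_add_pow_mul_norm_mollify_le_of_one_le hB₂ hg1 ht1 x
    have hRt : ‖(R * t)⁻¹ ^ M‖ * t ^ M ≤ 1 := by
      rw [Real.norm_of_nonneg (by positivity), ← mul_pow]
      refine pow_le_one₀ (by positivity) ?_
      rw [mul_inv, mul_assoc, inv_mul_cancel₀ ht.ne', mul_one]
      exact inv_le_one_of_one_le₀ hR
    have hX : 0 ≤ B₂ * ∫ y, (1 + ‖y‖) ^ M * ‖g y‖ :=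
      mul_nonneg hB₂0 (integral_nonneg fun y => by positivity)
    calc _ = ‖(R * t)⁻¹ ^ M‖ * ((1 + ‖x‖) ^ M * ‖mollify ((scaledDeriv 1 v)^[M] Φ) t g x‖) := by ring
      _ ≤ ‖(R * t)⁻¹ ^ M‖ * (t ^ M * (B₂ * ∫ y, (1 + ‖y‖) ^ M * ‖g y‖)) := by gcongr
      _ = (‖(R * t)⁻¹ ^ M‖ * t ^ M) * (B₂ * ∫ y, (1 + ‖y‖) ^ M * ‖g y‖) := by ring
      _ ≤ 1 * (B₂ * ∫ y, (1 + ‖y‖) ^ M * ‖g y‖) := by gcongr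
      _ ≤ B₂ * (C * I) := by rw [one_mul]; gcongr
      _ ≤ _ := le_max_right _ _

end Hardy

/-! ### Multipliers assembled from humps at separated scales -/

section GlidingHump

variable {E : Type} [NormedAddCommGroup E] [InnerProductSpace ℝ E] [FiniteDimensional ℝ E]
  [MeasurableSpace E] [BorelSpace E]

lemma sobolevNorm_zero (u s : ℝ) : sobolevNorm u s (fun _ : E => 0) = 0 := by
  have h := sobolevNorm_le_eLpNorm_besselFun u s (0 : 𝓢(E, ℂ))
  have e : besselFun s (0 : 𝓢(E, ℂ)) = 0 := by
    rw [besselFun_eq, map_zero]; rfl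
  rw [e, eLpNorm_zero] at h
  exact le_antisymm h bot_le

/-- Dyadic dilates by at least `4` of the annulus `[1/2, 2]` miss `[3/4, 5/4]`. -/
lemma abs_le_one_of_zpow_mul_mem {z : ℤ} {r : ℝ} (h1 : 1 / 2 ≤ r) (h2 : r ≤ 2)
    (h3 : 3 / 4 ≤ (2 : ℝ) ^ z * r) (h4 : (2 : ℝ) ^ z * r ≤ 5 / 4) : |z| ≤ 1 := by
  rw [abs_le]
  constructor
  · by_contra! h
    have : (2 : ℝ) ^ z ≤ 2 ^ (-2 : ℤ) := zpow_le_zpow_right₀ (by norm_num) (by omega)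
    norm_num at this
    nlinarith
  · by_contra! h
    have : (2 : ℝ) ^ (2 : ℤ) ≤ 2 ^ z := zpow_le_zpow_right₀ (by norm_num) (by omega)
    norm_num at this
    nlinarith

/-- Placing the `N`-th of a sequence of multipliers living on the unit annulus at frequency scale
`2^{4N}` gives one multiplier whose Hörmander norm is the supremum of theirs: each dyadic annulus
meets at most one of the pieces. -/
lemma exists_glidingHump {Θ : 𝓢(E, ℂ)} (hΘ : ∀ ξ, 𝓕 Θ ξ ≠ 0 → 1 / 2 ≤ ‖ξ‖ ∧ ‖ξ‖ ≤ 2) (u s : ℝ)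
    {A : ℕ → E → ℂ} (hmeas : ∀ N, Measurable (A N))
    (hsupp : ∀ N ξ, A N ξ ≠ 0 → 3 / 4 ≤ ‖ξ‖ ∧ ‖ξ‖ ≤ 5 / 4) {B : ℝ≥0∞}
    (hB : ∀ N, ∀ e : ℤ, |e| ≤ 1 →
      sobolevNorm u s (fun ξ => A N ((2 : ℝ) ^ e • ξ) * 𝓕 Θ ξ) ≤ B) :
    ∃ m : E → ℂ, Measurable m ∧ hormanderNorm Θ u s m ≤ B ∧
      ∀ (N : ℕ) (ξ : E), 1 / 2 ≤ ‖ξ‖ → ‖ξ‖ ≤ 2 → m ((2 : ℝ) ^ (4 * N : ℤ) • ξ) = A N ξ := by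
  have hz : ∀ (N : ℕ) (z : ℤ) (ξ : E), 1 / 2 ≤ ‖ξ‖ → ‖ξ‖ ≤ 2 → 1 < |z| →
      A N ((2 : ℝ) ^ z • ξ) = 0 := by
    intro N z ξ h1 h2 h
    by_contra hne
    obtain ⟨h3, h4⟩ := hsupp N _ hne
    rw [norm_smul, Real.norm_of_nonneg (by positivity)] at h3 h4
    exact absurd (abs_le_one_of_zpow_mul_mem h1 h2 h3 h4) (by omega)
  set a : ℕ → E → ℂ := fun N ξ => A N ((2 : ℝ) ^ (-(4 * N : ℤ)) • ξ) with ha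
  have ha' : ∀ (N : ℕ) (k : ℤ) (ξ : E), a N ((2 : ℝ) ^ k • ξ) = A N ((2 : ℝ) ^ (k - 4 * N) • ξ) := by
    intro N k ξ
    simp only [ha, smul_smul]
    rw [← zpow_add₀ two_ne_zero]
    congr 3; ring
  have hother : ∀ (N N' : ℕ) (ξ : E), a N ξ ≠ 0 → N' ≠ N → a N' ξ = 0 := by
    intro N N' ξ hne hN
    obtain ⟨h3, h4⟩ := hsupp N _ hne
    have e : ξ = (2 : ℝ) ^ (4 * N : ℤ) • ((2 : ℝ) ^ (-(4 * N : ℤ)) • ξ) := by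
      rw [smul_smul, ← zpow_add₀ two_ne_zero]; simp
    rw [e, ha']
    exact hz _ _ _ (by linarith) (by linarith) (by rw [lt_abs]; omega)
  have hsum : ∀ ξ, Summable fun N => a N ξ := by
    intro ξ
    by_cases h : ∃ N, a N ξ ≠ 0
    · obtain ⟨N, hN⟩ := h
      exact (hasSum_single N fun N' hN' => hother N N' ξ hN hN').summable
    · push Not at h
      simp [h]
  have hsingle : ∀ (N : ℕ) (e : ℤ) (ξ : E), 1 / 2 ≤ ‖ξ‖ → ‖ξ‖ ≤ 2 → |e| ≤ 1 →
      ∑' N', a N' ((2 : ℝ) ^ (4 * N + e : ℤ) • ξ) = A N ((2 : ℝ) ^ e • ξ) := by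
    intro N e ξ h1 h2 he
    rw [tsum_eq_single N fun N' hN' => ?_, ha']
    · congr 3; ring
    · rw [ha']
      rw [abs_le] at he
      exact hz _ _ _ h1 h2 (by rw [lt_abs]; omega)
  -- The annulus `2^{k-1} ≤ |ξ| ≤ 2^{k+1}` meets the `N`-th hump only if `|k - 4N| ≤ 1`.
  refine ⟨fun ξ => ∑' N, a N ξ, ?_, ?_, fun N ξ h1 h2 => ?_⟩
  · refine measurable_of_tendsto_metrizable (f := fun (k : ℕ) ξ => ∑ N ∈ Finset.range k, a N ξ)
      (fun k => ?_) (tendsto_pi_nhds.2 fun ξ => (hsum ξ).hasSum.tendsto_sum_nat)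
    exact Finset.measurable_fun_sum _ fun N _ => (hmeas N).comp (measurable_const_smul _)
  · refine iSup_le fun k => ?_
    by_cases hk : ∃ N : ℕ, |k - 4 * N| ≤ 1
    · obtain ⟨N, hN⟩ := hk
      refine le_trans (le_of_eq ?_) (hB N (k - 4 * N) hN)
      congr 1
      ext ξ
      by_cases h0 : 𝓕 Θ ξ = 0
      · simp [h0]
      · obtain ⟨h1, h2⟩ := hΘ ξ h0
        have := hsingle N (k - 4 * N) ξ h1 h2 hN
        rw [show (4 * N + (k - 4 * N) : ℤ) = k by ring] at this
        simp only [this]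
    · push Not at hk
      refine le_trans (le_of_eq ?_) ((sobolevNorm_zero (E := E) u s).le.trans (zero_le (a := B)))
      congr 1
      ext ξ
      by_cases h0 : 𝓕 Θ ξ = 0
      · simp [h0]
      · obtain ⟨h1, h2⟩ := hΘ ξ h0
        have : ∀ N, a N ((2 : ℝ) ^ k • ξ) = 0 := fun N => by
          rw [ha']; exact hz _ _ _ h1 h2 (hk N)
        simp [this]
  · simpa using hsingle N 0 ξ h1 h2 (by simp)

end GlidingHump

/-! ### Volumes of slabs -/

section SlabVolume

variable {E : Type} [NormedAddCommGroup E] [InnerProductSpace ℝ E] [FiniteDimensional ℝ E]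
  [MeasurableSpace E] [BorelSpace E]
variable {W : Type} [NormedAddCommGroup W] [InnerProductSpace ℝ W] [FiniteDimensional ℝ W]
  [MeasurableSpace W] [BorelSpace W]

/-- A linear map with a right inverse satisfies the slab bound with the dimension of its target:
average the volume of the slab over translates by the image of the unit ball. -/
lemma slabBound_of_rightInverse (L : E →L[ℝ] W) (ι : W →L[ℝ] E) (h : ∀ y, L (ι y) = y) :
    SlabBound L (Module.finrank ℝ W) := by
  set β := volume (Metric.ball (0 : W) 1)
  have hβ0 : β ≠ 0 := (Metric.measure_ball_pos _ _ one_pos).ne'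
  have hβ1 : β ≠ ∞ := measure_ball_lt_top.ne
  set κ := volume (Metric.closedBall (0 : E) (2 + ‖ι‖))
  have hκ1 : κ ≠ ∞ := measure_closedBall_lt_top.ne
  refine ⟨κ.toNNReal, fun b r hr => ?_⟩
  rw [ENNReal.coe_toNNReal hκ1]
  set S := {ξ : E | ‖L (ξ - b)‖ ≤ r ∧ ‖ξ‖ ≤ 2}
  have hS : MeasurableSet S := by
    have hc : Continuous fun ξ : E => ‖L (ξ - b)‖ :=
      (L.continuous.comp (continuous_id.sub continuous_const)).norm
    exact ((isClosed_le hc continuous_const).inter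
      (isClosed_le continuous_norm continuous_const)).measurableSet
  have hm : Measurable fun z : W × E => S.indicator (fun _ => (1 : ℝ≥0∞)) (z.2 - ι z.1) :=
    (measurable_const.indicator hS).comp
      (measurable_snd.sub (ι.continuous.measurable.comp measurable_fst))
  have e1 : β * volume S =
      ∫⁻ y in Metric.ball (0 : W) 1, ∫⁻ ξ, S.indicator (fun _ => (1 : ℝ≥0∞)) (ξ - ι y) := by
    have : ∀ y, ∫⁻ ξ, S.indicator (fun _ => (1 : ℝ≥0∞)) (ξ - ι y) = volume S := fun y => by
      rw [lintegral_sub_right_eq_self (fun ξ => S.indicator (fun _ => (1 : ℝ≥0∞)) ξ),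
        lintegral_indicator hS]
      simp
    simp_rw [this]
    rw [setLIntegral_const, mul_comm]
  have e2 : β * volume S ≤ β * (κ * ENNReal.ofReal (r ^ (Module.finrank ℝ W : ℝ))) := by
    rw [e1, lintegral_lintegral_swap hm.aemeasurable]
    calc _ ≤ ∫⁻ ξ, (Metric.closedBall (0 : E) (2 + ‖ι‖)).indicator
          (fun _ => ENNReal.ofReal (r ^ (Module.finrank ℝ W : ℝ)) * β) ξ := by
          refine lintegral_mono fun ξ => ?_
          by_cases hξ : ξ ∈ Metric.closedBall (0 : E) (2 + ‖ι‖)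
          · rw [Set.indicator_of_mem hξ]
            calc _ ≤ ∫⁻ y, (Metric.closedBall (L (ξ - b)) r).indicator (fun _ => (1 : ℝ≥0∞)) y := by
                  refine (setLIntegral_le_lintegral _ _).trans (lintegral_mono fun y => ?_)
                  by_cases hy : ξ - ι y ∈ S
                  · have hy' : y ∈ Metric.closedBall (L (ξ - b)) r := by
                      rw [mem_closedBall_iff_norm']
                      have := hy.1
                      rwa [show ξ - ι y - b = (ξ - b) - ι y by abel, map_sub, h] at this
                    rw [Set.indicator_of_mem hy, Set.indicator_of_mem hy']
                  · simp [Set.indicator_of_notMem hy]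
              _ = volume (Metric.closedBall (L (ξ - b)) r) := by
                  rw [lintegral_indicator Metric.isClosed_closedBall.measurableSet]
                  simp
              _ = _ := by
                  rw [Measure.addHaar_closedBall _ _ hr.le, Real.rpow_natCast]
          · rw [Set.indicator_of_notMem hξ]
            refine le_of_eq ?_
            rw [setLIntegral_congr_fun (g := fun _ => 0) Metric.isOpen_ball.measurableSet
              fun y hy => ?_, lintegral_zero]
            refine Set.indicator_of_notMem (fun hyS => hξ ?_) _
            rw [mem_closedBall_zero_iff]
            have h1 : ‖ξ‖ ≤ ‖ξ - ι y‖ + ‖ι y‖ := by simpa using norm_add_le (ξ - ι y) (ι y)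
            have h2 : ‖ι y‖ ≤ ‖ι‖ * 1 := (ι.le_opNorm y).trans
              (mul_le_mul_of_nonneg_left (by simpa using (mem_ball_zero_iff.1 hy).le)
                (norm_nonneg _))
            have h3 : ‖ξ - ι y‖ ≤ 2 := hyS.2
            linarith
      _ = _ := by
          rw [lintegral_indicator Metric.isClosed_closedBall.measurableSet, setLIntegral_const]
          ring
  exact (ENNReal.mul_le_mul_iff_right hβ0 hβ1).1 e2

end SlabVolume

/-! ### The test functions -/

section TestFunctions

open scoped ContDiff

variable {V : Type} [NormedAddCommGroup V] [InnerProductSpace ℝ V] [FiniteDimensional ℝ V]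
  [MeasurableSpace V] [BorelSpace V]

lemma conj_fourier_eq_of_even_real {b : V → ℝ} (hb : ∀ x, b (-x) = b x) (x : V) :
    (starRingEnd ℂ) (𝓕 (fun y => (b y : ℂ)) x) = 𝓕 (fun y => (b y : ℂ)) x := by
  simp only [Real.fourier_eq', smul_eq_mul]
  rw [← integral_conj, ← integral_neg_eq_self]
  congr 1 with y
  rw [map_mul, Complex.conj_ofReal, hb, ← Complex.exp_conj]
  simp [Complex.conj_ofNat]

/-- There are compactly supported smooth frequency profiles with a nonnegative inverse Fourier
transform: the autocorrelation of an even bump. -/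
lemma exists_profile {ρ : ℝ} (hρ : 0 < ρ) :
    ∃ (η : 𝓢(V, ℂ)) (γ : V → ℝ), (∀ x, η x ≠ 0 → ‖x‖ ≤ ρ) ∧ Continuous γ ∧ (∀ x, 0 ≤ γ x) ∧
      0 < γ 0 ∧ ∀ x, 𝓕⁻ η x = (γ x : ℂ) := by
  let b : ContDiffBump (0 : V) := ⟨ρ / 4, ρ / 2, by positivity, by linarith⟩
  have hbc : HasCompactSupport (fun x => (b x : ℂ)) :=
    b.hasCompactSupport.comp_left (g := fun r : ℝ => (r : ℂ)) (by simp)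
  have hbs : ContDiff ℝ ∞ (fun x => (b x : ℂ)) := Complex.ofRealCLM.contDiff.comp b.contDiff
  set B : 𝓢(V, ℂ) := hbc.toSchwartzMap hbs
  have hB : (B : V → ℂ) = fun x => (b x : ℂ) := rfl
  have hBf : ∀ x, ((𝓕 B x).re : ℂ) = 𝓕 B x := fun x => by
    rw [← Complex.conj_eq_iff_re, SchwartzMap.fourier_coe, hB]
    exact conj_fourier_eq_of_even_real (fun x => b.neg x) x
  set η := SchwartzMap.convolution (ContinuousLinearMap.mul ℂ ℂ) B B
  refine ⟨η, fun x => (𝓕 B (-x)).re ^ 2, fun x hx => ?_, ?_, fun x => sq_nonneg _, ?_, fun x => ?_⟩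
  · rw [SchwartzMap.convolution_apply] at hx
    have h1 := support_convolution_subset (ContinuousLinearMap.mul ℂ ℂ) (μ := volume)
      (f := (B : V → ℂ)) (g := (B : V → ℂ)) hx
    obtain ⟨y, hy, z, hz, rfl⟩ := h1
    have h2 : ∀ y, B y ≠ 0 → ‖y‖ ≤ ρ / 2 := fun y hy => by
      have : y ∈ Function.support b := by
        intro h
        exact hy (by rw [hB]; simp [h])
      rw [b.support_eq, mem_ball_zero_iff] at this
      exact this.le
    have h3 := h2 y hy
    have h4 := h2 z hz
    exact (norm_add_le y z).trans (by linarith)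
  · have := (𝓕 B).continuous
    fun_prop
  · have e : 𝓕 B (-0) = ((∫ x, b x : ℝ) : ℂ) := by
      rw [SchwartzMap.fourier_coe, hB, Real.fourier_eq']
      simp only [neg_zero, inner_zero_right, mul_zero, Complex.ofReal_zero, zero_mul,
        Complex.exp_zero, one_smul]
      exact integral_ofReal
    beta_reduce
    rw [e, Complex.ofReal_re]
    have := b.integral_pos (μ := volume)
    positivity
  · rw [SchwartzMap.fourierInv_apply_eq]
    simp only [SchwartzMap.compCLMOfContinuousLinearEquiv_apply, Function.comp]
    rw [SchwartzMap.fourier_convolution]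
    simp only [SchwartzMap.pairing_apply_apply]
    push_cast
    rw [hBf]
    simp [sq]

/-- Multiplication by the character `x ↦ e^{2πi⟨b, x⟩}`, as a translation on the Fourier side. -/
noncomputable def modulate (b : V) (h : 𝓢(V, ℂ)) : 𝓢(V, ℂ) :=
  𝓕⁻ (SchwartzMap.compSubConstCLM ℂ b (𝓕 h))

lemma fourier_modulate (b : V) (h : 𝓢(V, ℂ)) (ξ : V) : 𝓕 (modulate b h) ξ = 𝓕 h (ξ - b) := by
  rw [modulate, FourierTransform.fourier_fourierInv_eq, SchwartzMap.compSubConstCLM_apply]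

lemma modulate_apply (b : V) (h : 𝓢(V, ℂ)) (x : V) : modulate b h x =
    Complex.exp (((2 * Real.pi * inner ℝ b x : ℝ) : ℂ) * Complex.I) * h x := by
  have e1 : h x = 𝓕⁻ (𝓕 h) x := by rw [FourierTransform.fourierInv_fourier_eq]
  rw [e1, modulate, SchwartzMap.fourierInv_coe, SchwartzMap.fourierInv_coe, Real.fourierInv_eq',
    Real.fourierInv_eq', ← integral_add_right_eq_self _ b, ← integral_const_mul]
  congr 1 with ξ
  rw [SchwartzMap.compSubConstCLM_apply, add_sub_cancel_right, inner_add_left, mul_add,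
    Complex.ofReal_add, add_mul, Complex.exp_add]
  simp only [smul_eq_mul]
  ring

lemma norm_modulate_apply (b : V) (h : 𝓢(V, ℂ)) (x : V) : ‖modulate b h x‖ = ‖h x‖ := by
  rw [modulate_apply, norm_mul, Complex.norm_exp_ofReal_mul_I, one_mul]

variable {n : ℕ}

lemma fourier_scaledDeriv (R : ℝ) (v : EuclideanSpace ℝ (Fin n))
    (g : 𝓢(EuclideanSpace ℝ (Fin n), ℂ)) (ξ : EuclideanSpace ℝ (Fin n)) :
    𝓕 (scaledDeriv R v g) ξ =
      (2 * Real.pi * Complex.I * ((inner ℝ ξ v / R : ℝ) : ℂ)) * 𝓕 g ξ := by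
  rw [scaledDeriv, FourierTransform.fourier_smul, SchwartzMap.fourier_lineDerivOp_eq]
  have : (inner ℝ · v : EuclideanSpace ℝ (Fin n) → ℝ).HasTemperateGrowth := by fun_prop
  rw [smul_apply, smul_apply, SchwartzMap.smulLeftCLM_apply_apply this]
  simp only [smul_eq_mul, Complex.real_smul]
  push_cast
  ring

lemma fourier_scaledDeriv_iterate (K : ℕ) (R : ℝ) (v : EuclideanSpace ℝ (Fin n))
    (g : 𝓢(EuclideanSpace ℝ (Fin n), ℂ)) (ξ : EuclideanSpace ℝ (Fin n)) :
    𝓕 ((scaledDeriv R v)^[K] g) ξ =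
      (2 * Real.pi * Complex.I * ((inner ℝ ξ v / R : ℝ) : ℂ)) ^ K * 𝓕 g ξ := by
  induction K with
  | zero => simp
  | succ K ih => rw [Function.iterate_succ_apply', fourier_scaledDeriv, ih]; ring

/-- The operator `2πit₀ + R⁻¹ ∂_v`, the conjugate of `R⁻¹ ∂_v` by a modulation. -/
noncomputable def shiftedDeriv (t₀ R : ℝ) (v : EuclideanSpace ℝ (Fin n))
    (h : 𝓢(EuclideanSpace ℝ (Fin n), ℂ)) : 𝓢(EuclideanSpace ℝ (Fin n), ℂ) :=
  (2 * Real.pi * Complex.I * (t₀ : ℂ)) • h + scaledDeriv R v h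

lemma scaledDeriv_modulate {t₀ R : ℝ} (hR : R ≠ 0) {v : EuclideanSpace ℝ (Fin n)} (hv : ‖v‖ = 1)
    (h : 𝓢(EuclideanSpace ℝ (Fin n), ℂ)) :
    scaledDeriv R v (modulate (R • t₀ • v) h) = modulate (R • t₀ • v) (shiftedDeriv t₀ R v h) := by
  have key : 𝓕 (scaledDeriv R v (modulate (R • t₀ • v) h)) =
      𝓕 (modulate (R • t₀ • v) (shiftedDeriv t₀ R v h)) := by
    ext ξ
    rw [fourier_scaledDeriv, fourier_modulate, fourier_modulate, shiftedDeriv,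
      FourierTransform.fourier_add, FourierTransform.fourier_smul, add_apply, fourier_scaledDeriv,
      smul_apply, inner_sub_left, inner_smul_left, inner_smul_left, real_inner_self_eq_norm_sq, hv]
    have : (R : ℂ) ≠ 0 := by exact_mod_cast hR
    simp
    field_simp
    ring
  have := congrArg (fun F => 𝓕⁻ F) key
  simpa [FourierTransform.fourierInv_fourier_eq] using this

lemma scaledDeriv_iterate_modulate (K : ℕ) {t₀ R : ℝ} (hR : R ≠ 0)
    {v : EuclideanSpace ℝ (Fin n)} (hv : ‖v‖ = 1) (h : 𝓢(EuclideanSpace ℝ (Fin n), ℂ)) :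
    (scaledDeriv R v)^[K] (modulate (R • t₀ • v) h) =
      modulate (R • t₀ • v) ((shiftedDeriv t₀ R v)^[K] h) := by
  induction K with
  | zero => rfl
  | succ K ih =>
    rw [Function.iterate_succ_apply', ih, scaledDeriv_modulate hR hv, Function.iterate_succ_apply']

lemma exists_seminorm_shiftedDeriv_iterate_le (t₀ : ℝ) (v : EuclideanSpace ℝ (Fin n))
    (hv : ‖v‖ = 1) (h : 𝓢(EuclideanSpace ℝ (Fin n), ℂ)) (K : ℕ) : ∀ k m : ℕ, ∃ C : ℝ,
    ∀ R : ℝ, 1 ≤ R → SchwartzMap.seminorm ℝ k m ((shiftedDeriv t₀ R v)^[K] h) ≤ C := by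
  induction K with
  | zero => exact fun k m => ⟨SchwartzMap.seminorm ℝ k m h, fun R _ => le_rfl⟩
  | succ K ih =>
    intro k m
    obtain ⟨C₁, h₁⟩ := ih k m
    obtain ⟨C₂, h₂⟩ := ih k (m + 1)
    refine ⟨‖2 * Real.pi * Complex.I * (t₀ : ℂ)‖ * C₁ + C₂, fun R hR => ?_⟩
    rw [Function.iterate_succ_apply', shiftedDeriv]
    set H := (shiftedDeriv t₀ R v)^[K] h
    have hd : SchwartzMap.seminorm ℝ k m (LineDeriv.lineDerivOp v H :
        𝓢(EuclideanSpace ℝ (Fin n), ℂ)) ≤ SchwartzMap.seminorm ℝ k (m + 1) H := by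
      refine SchwartzMap.seminorm_le_bound ℝ k m _ (apply_nonneg _ _) fun x => ?_
      refine le_trans ?_ (SchwartzMap.le_seminorm ℝ k (m + 1) H x)
      have := norm_iteratedFDeriv_lineDerivOp_le v H m x
      rw [hv, one_mul] at this
      gcongr
    have hs : ∀ (c : ℂ) (G : 𝓢(EuclideanSpace ℝ (Fin n), ℂ)),
        SchwartzMap.seminorm ℝ k m (c • G) ≤ ‖c‖ * SchwartzMap.seminorm ℝ k m G := fun c G => by
      have := map_smul_eq_mul (SchwartzMap.seminorm ℂ k m) c G
      exact this.le
    have hR' : ‖((R⁻¹ : ℝ) : ℂ)‖ ≤ 1 := by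
      rw [Complex.norm_real, Real.norm_of_nonneg (by positivity)]
      exact inv_le_one_of_one_le₀ hR
    refine (map_add_le_add _ _ _).trans (add_le_add ((hs _ _).trans ?_) ((hs _ _).trans ?_))
    · exact mul_le_mul_of_nonneg_left (h₁ R hR) (norm_nonneg _)
    · calc _ ≤ 1 * SchwartzMap.seminorm ℝ k (m + 1) H :=
            mul_le_mul hR' hd (apply_nonneg _ _) zero_le_one
        _ ≤ _ := by rw [one_mul]; exact h₂ R hR

/-- The test functions of unit width and frequency `R t₀ v` have bounded Hardy quasi-norms. -/
lemma exists_hardyNorm_test_le (Φ : 𝓢(EuclideanSpace ℝ (Fin n), ℂ)) {q : ℝ} (hq : 0 < q)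
    {M : ℕ} (hM : n < M * q) (t₀ : ℝ) (v : EuclideanSpace ℝ (Fin n)) (hv : ‖v‖ = 1)
    (G : 𝓢(EuclideanSpace ℝ (Fin n), ℂ)) :
    ∃ C' : ℝ≥0, ∀ R : ℝ, 1 ≤ R →
      hardyNorm Φ q ((scaledDeriv R v)^[M] (modulate (R • t₀ • v) G)) ≤ C' := by
  obtain ⟨C₁, hC₁, h₁⟩ := exists_one_add_pow_mul_le G (M + n + 1)
  obtain ⟨C₂, h₂⟩ := exists_seminorm_shiftedDeriv_iterate_le t₀ v hv G M 0 0
  obtain ⟨C₃, h₃⟩ := exists_seminorm_shiftedDeriv_iterate_le t₀ v hv G M M 0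
  obtain ⟨C', h'⟩ := exists_hardyNorm_scaledDeriv_le Φ hq hM v (max C₁ (2 ^ (M - 1) * (C₂ + C₃)))
  refine ⟨C', fun R hR => h' R _ hR (fun x => ?_) (fun x => ?_)⟩
  · rw [norm_modulate_apply]
    exact (h₁ x).trans (le_max_left _ _)
  · rw [scaledDeriv_iterate_modulate M (by positivity) hv, norm_modulate_apply]
    refine le_trans ?_ (le_max_right _ _)
    set H := (shiftedDeriv t₀ R v)^[M] G with hH
    have a1 : ‖H x‖ ≤ C₂ := (SchwartzMap.norm_le_seminorm ℝ H x).trans (h₂ R hR)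
    have a2 : ‖x‖ ^ M * ‖H x‖ ≤ C₃ := (SchwartzMap.norm_pow_mul_le_seminorm ℝ H M x).trans (h₃ R hR)
    have a3 : (1 + ‖x‖) ^ M ≤ 2 ^ (M - 1) * (1 ^ M + ‖x‖ ^ M) :=
      add_pow_le zero_le_one (norm_nonneg _) M
    calc _ ≤ 2 ^ (M - 1) * (1 ^ M + ‖x‖ ^ M) * ‖H x‖ := by gcongr
      _ = 2 ^ (M - 1) * (‖H x‖ + ‖x‖ ^ M * ‖H x‖) := by rw [one_pow]; ring
      _ ≤ _ := by gcongr

/-- A smooth function equal to `(2πit)^{-K}` near `t₀ > 0`. -/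
lemma exists_smooth_inverse_power {t₀ : ℝ} (ht₀ : 0 < t₀) (K : ℕ) :
    ∃ κ : ℝ → ℂ, ContDiff ℝ ∞ κ ∧
      ∀ t, |t - t₀| ≤ t₀ / 2 → (2 * Real.pi * Complex.I * (t : ℂ)) ^ K * κ t = 1 := by
  let b : ContDiffBump t₀ := ⟨t₀ / 2, 3 * t₀ / 4, by positivity, by linarith⟩
  refine ⟨fun t => (b t : ℂ) * ((2 * Real.pi * Complex.I * (t : ℂ)) ^ K)⁻¹,
    contDiff_iff_contDiffAt.2 fun t => ?_, fun t ht => ?_⟩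
  · rcases eq_or_ne t 0 with rfl | h0
    · have : (fun t : ℝ => (b t : ℂ) * ((2 * Real.pi * Complex.I * (t : ℂ)) ^ K)⁻¹) =ᶠ[nhds 0]
          fun _ => 0 := by
        filter_upwards [Metric.ball_mem_nhds (0 : ℝ) (by positivity : 0 < t₀ / 4)] with t ht
        have : b t = 0 := b.zero_of_le_dist (by
          rw [mem_ball_zero_iff, Real.norm_eq_abs, abs_lt] at ht
          rw [Real.dist_eq]
          refine le_trans ?_ (neg_le_abs _)
          change 3 * t₀ / 4 ≤ _
          linarith)
        simp [this]
      exact contDiffAt_const.congr_of_eventuallyEq this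
    · have hb : ContDiffAt ℝ ∞ (fun t => (b t : ℂ)) t :=
        (Complex.ofRealCLM.contDiff.comp b.contDiff).contDiffAt
      have ht : ContDiffAt ℝ ∞ (fun t : ℝ => (t : ℂ)) t := Complex.ofRealCLM.contDiff.contDiffAt
      refine hb.mul (((contDiffAt_const.mul ht).pow K).inv ?_)
      refine pow_ne_zero _ ?_
      have : (t : ℂ) ≠ 0 := by exact_mod_cast h0
      simp [this, Real.pi_ne_zero]
  · have h1 : b t = 1 := b.one_of_mem_closedBall (by
      rw [Metric.mem_closedBall, Real.dist_eq]; exact ht)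
    have h0 : (t : ℂ) ≠ 0 := by
      have := neg_le_of_abs_le ht
      exact_mod_cast (by linarith : 0 < t).ne'
    have : (2 * Real.pi * Complex.I * (t : ℂ)) ^ K ≠ 0 := by
      refine pow_ne_zero _ ?_
      simp [h0, Real.pi_ne_zero]
    beta_reduce
    rw [h1]
    simp [mul_inv_cancel₀ this]

end TestFunctions

/-! ### Humps made of layers of cut-offs -/

section Layers

open scoped ContDiff

variable {E : Type} [NormedAddCommGroup E] [InnerProductSpace ℝ E] [FiniteDimensional ℝ E]
  [MeasurableSpace E] [BorelSpace E]
variable {W : Type} [NormedAddCommGroup W] [NormedSpace ℝ W]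

/-- `LayerBound u s δ J c j` bounds, uniformly in `N`, the `L^u` norms of the combinations
`∑_{i < J N} c_{N,i} g_i` in which `g_i` obeys the sup and `L¹` bounds that hold for
`(1 - Δ)^{s/2}` of a slab cut-off of codimension `δ` and width `2^{-j_{N,i}}`. -/
def LayerBound (E : Type) [NormedAddCommGroup E] [InnerProductSpace ℝ E] [FiniteDimensional ℝ E]
    [MeasurableSpace E] [BorelSpace E] (u s δ : ℝ) (J : ℕ → ℕ) (c : ℕ → ℕ → ℝ)
    (j : ℕ → ℕ → ℕ) : Prop :=
  ∀ C : ℝ≥0, ∃ B : ℝ≥0, ∀ (N : ℕ) (g : ℕ → E → ℂ), (∀ i, Continuous (g i)) →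
    (∀ i x, ‖g i x‖ₑ ≤ C * ENNReal.ofReal (((2 : ℝ) ^ j N i) ^ s)) →
    (∀ i, ∫⁻ x, ‖g i x‖ₑ ≤ C * ENNReal.ofReal (((2 : ℝ) ^ j N i) ^ (s - δ))) →
    eLpNorm (fun x => ∑ i ∈ Finset.range (J N), (c N i : ℂ) * g i x) (ENNReal.ofReal u) volume ≤ B

/-- A single multiplier that carries, at each frequency scale `2^{4N}`, the `N`-th combination of
cut-offs about `a`. -/
lemma exists_layered_multiplier {Θ : 𝓢(E, ℂ)}
    (hΘ : ∀ ξ, 𝓕 Θ ξ ≠ 0 → 1 / 2 ≤ ‖ξ‖ ∧ ‖ξ‖ ≤ 2) {ψ : W → ℂ} (hψ : ContDiff ℝ ∞ ψ)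
    (hψc : HasCompactSupport ψ) {H : E → ℂ} (hH : ContDiff ℝ ∞ H)
    (hHs : ∀ ξ, H ξ ≠ 0 → 3 / 4 ≤ ‖ξ‖ ∧ ‖ξ‖ ≤ 5 / 4) {L : E →L[ℝ] W} {δ : ℝ}
    (hL : SlabBound L δ) (a : E) {u s : ℝ} (hs : 0 < s) {J : ℕ → ℕ} {c : ℕ → ℕ → ℝ}
    {j : ℕ → ℕ → ℕ} (hlb : LayerBound E u s δ J c j) :
    ∃ m : E → ℂ, Measurable m ∧ hormanderNorm Θ u s m < ⊤ ∧
      ∀ (N : ℕ) (ξ : E), 1 / 2 ≤ ‖ξ‖ → ‖ξ‖ ≤ 2 → m ((2 : ℝ) ^ (4 * N) • ξ) =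
        (∑ i ∈ Finset.range (J N), (c N i : ℂ) * ψ ((2 : ℝ) ^ j N i • L (ξ - a))) * H ξ := by
  have hfam : ∀ e : ℤ, _ := fun e => exists_besselFun_family_bound hΘ hψ hψc hH hL a hs
    (zpow_pos two_pos e : (0 : ℝ) < 2 ^ e)
  -- Only the dilations `2^e` with `|e| ≤ 1` matter, so three of the constants suffice.
  choose C hC using hfam
  obtain ⟨B, hB⟩ := hlb (C (-1) + C 0 + C 1)
  set A : ℕ → E → ℂ := fun N ξ =>
    (∑ i ∈ Finset.range (J N), (c N i : ℂ) * ψ ((2 : ℝ) ^ j N i • L (ξ - a))) * H ξ with hA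
  have hAc : ∀ N, Continuous (A N) := fun N => by
    have := hψ.continuous
    have := hH.continuous
    fun_prop
  obtain ⟨m, hm, hmn, hmA⟩ := exists_glidingHump hΘ u s (A := A) (fun N => (hAc N).measurable)
    (fun N ξ h => hHs ξ (right_ne_zero_of_mul h)) (B := B) (fun N e he => by
      choose F hF hF1 hF2 using fun i => hC e ((2 : ℝ) ^ j N i) (one_le_pow₀ one_le_two)
      have hCe : C e ≤ C (-1) + C 0 + C 1 := by
        have : e = -1 ∨ e = 0 ∨ e = 1 := by rw [abs_le] at he; omega
        rcases this with rfl | rfl | rfl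
        · exact le_add_right (le_add_right le_rfl)
        · exact le_add_right (le_add_left le_rfl)
        · exact le_add_left le_rfl
      have hCe' : (C e : ℝ≥0∞) ≤ (C (-1) + C 0 + C 1 : ℝ≥0) := by exact_mod_cast hCe
      have e1 : (fun ξ => A N ((2 : ℝ) ^ e • ξ) * 𝓕 Θ ξ) =
          (∑ i ∈ Finset.range (J N), (c N i : ℂ) • F i : 𝓢(E, ℂ)) := by
        ext ξ
        rw [sum_apply]
        simp only [hA, smul_apply, smul_eq_mul, hF, Finset.sum_mul]
        exact Finset.sum_congr rfl fun i _ => by ring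
      rw [e1]
      refine (sobolevNorm_le_eLpNorm_besselFun u s _).trans ?_
      have e2 := funext (besselFun_sum s (Finset.range (J N)) (fun i => (c N i : ℂ)) F)
      rw [e2]
      exact hB N (fun i => besselFun s (F i)) (fun i => continuous_besselFun s (F i))
        (fun i x => (hF1 i x).trans (by gcongr)) (fun i => (hF2 i).trans (by gcongr)))
  refine ⟨m, hm, hmn.trans_lt ENNReal.coe_lt_top, fun N ξ h1 h2 => ?_⟩
  have := hmA N ξ h1 h2
  rwa [show ((4 * N : ℤ)) = ((4 * N : ℕ) : ℤ) by push_cast; rfl, zpow_natCast] at this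

end Layers

/-! ### Testing the multiplier inequality -/

section Testing

open scoped ContDiff

variable {l n : ℕ} {W : Type} [NormedAddCommGroup W] [NormedSpace ℝ W]

/-- The frequency `(w, …, w)`. -/
noncomputable def diagonal (l : ℕ) (w : EuclideanSpace ℝ (Fin n)) : FreqSpace l n :=
  WithLp.toLp 2 fun _ => w

@[simp] lemma diagonal_apply (w : EuclideanSpace ℝ (Fin n)) (i : Fin l) :
    diagonal l w i = w := rfl

lemma norm_diagonal_sq (w : EuclideanSpace ℝ (Fin n)) : ‖diagonal l w‖ ^ 2 = l * ‖w‖ ^ 2 := by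
  rw [PiLp.norm_sq_eq_of_L2]
  simp

/-- On modulated test functions the multiplier operator reads off the multiplier near the
frequency `R (t₀ v, …, t₀ v)`. -/
lemma norm_multiplierOp_test (m : FreqSpace l n → ℂ) {R : ℝ} (K : ℕ) (t₀ : ℝ)
    (v : EuclideanSpace ℝ (Fin n)) (η : 𝓢(EuclideanSpace ℝ (Fin n), ℂ)) {S : FreqSpace l n → ℂ}
    (hS : ∀ ζ : FreqSpace l n, (∀ i, η (ζ i) ≠ 0) →
      m (R • diagonal l (t₀ • v) + ζ) * ∏ i, (2 * Real.pi * Complex.I *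
        ((inner ℝ ((R • diagonal l (t₀ • v) + ζ) i) v / R : ℝ) : ℂ)) ^ K = S ζ)
    (x : EuclideanSpace ℝ (Fin n)) :
    ‖multiplierOp m (fun _ => (scaledDeriv R v)^[K] (modulate (R • t₀ • v) (𝓕⁻ η))) x‖ =
      ‖∫ ζ : FreqSpace l n, S ζ * (∏ i, η (ζ i)) *
        Complex.exp (2 * Real.pi * Complex.I * ((inner ℝ x (∑ i, ζ i) : ℝ) : ℂ))‖ := by
  set a : FreqSpace l n := R • diagonal l (t₀ • v) with ha
  have hai : ∀ i, a i = R • t₀ • v := fun i => by rw [ha]; simp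
  set θ := Complex.exp (((2 * Real.pi * inner ℝ x (∑ i, a i) : ℝ) : ℂ) * Complex.I) with hθ
  have hθ1 : ‖θ‖ = 1 := Complex.norm_exp_ofReal_mul_I _
  rw [multiplierOp, ← integral_add_left_eq_self _ a]
  rw [← one_mul ‖∫ ζ : FreqSpace l n, S ζ * (∏ i, η (ζ i)) *
        Complex.exp (2 * Real.pi * Complex.I * ((inner ℝ x (∑ i, ζ i) : ℝ) : ℂ))‖, ← hθ1,
    ← norm_mul, ← integral_const_mul]
  congr 2 with ζ
  have e1 : ∀ i, 𝓕 ((scaledDeriv R v)^[K] (modulate (R • t₀ • v) (𝓕⁻ η))) ((a + ζ) i) =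
      (2 * Real.pi * Complex.I * ((inner ℝ ((a + ζ) i) v / R : ℝ) : ℂ)) ^ K * η (ζ i) := fun i => by
    rw [fourier_scaledDeriv_iterate, fourier_modulate, FourierTransform.fourier_fourierInv_eq,
      PiLp.add_apply, hai, add_sub_cancel_left]
  simp only [e1, Finset.prod_mul_distrib]
  by_cases h : ∀ i, η (ζ i) ≠ 0
  · rw [← hS ζ h]
    have e2 : Complex.exp (2 * Real.pi * Complex.I * ((inner ℝ x (∑ i, (a + ζ) i) : ℝ) : ℂ)) =
        θ * Complex.exp (2 * Real.pi * Complex.I * ((inner ℝ x (∑ i, ζ i) : ℝ) : ℂ)) := by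
      rw [hθ, ← Complex.exp_add]
      congr 1
      simp only [PiLp.add_apply, Finset.sum_add_distrib, inner_add_right]
      push_cast
      ring
    rw [e2]
    ring
  · push Not at h
    obtain ⟨i, hi⟩ := h
    rw [Finset.prod_eq_zero (f := fun i => η (ζ i)) (Finset.mem_univ i) hi]
    simp

lemma contDiff_prod_coord {κ : ℝ → ℂ} (hκ : ContDiff ℝ ∞ κ) (v : EuclideanSpace ℝ (Fin n)) :
    ContDiff ℝ ∞ fun ξ : FreqSpace l n => ∏ i, κ (inner ℝ (ξ i) v) := by
  refine contDiff_prod fun i _ => hκ.comp (ContDiff.inner ℝ ?_ contDiff_const)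
  exact (PiLp.proj 2 (fun _ : Fin l => EuclideanSpace ℝ (Fin n)) i :
    FreqSpace l n →L[ℝ] EuclideanSpace ℝ (Fin n)).contDiff

/-- Testing the hypothesized inequality against one multiplier that carries all the layered humps:
the functions `T_m(f_1, …, f_l)` stay bounded in `L^p`, uniformly in the scale `N`. -/
lemma exists_eLpNorm_layers_le (hl : 1 ≤ l) {p : ℝ} {q : Fin l → ℝ} (hq : ∀ i, 0 < q i)
    {u s : ℝ} (hs : 0 < s) {Θ : 𝓢(FreqSpace l n, ℂ)}
    (hΘ : ∀ ξ, 𝓕 Θ ξ ≠ 0 → 1 / 2 ≤ ‖ξ‖ ∧ ‖ξ‖ ≤ 2)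
    {Φ : 𝓢(EuclideanSpace ℝ (Fin n), ℂ)}
    (hbdd : ∀ m : FreqSpace l n → ℂ, Measurable m → hormanderNorm Θ u s m < ⊤ →
      ∃ C : ℝ≥0, ∀ f : Fin l → 𝓢(EuclideanSpace ℝ (Fin n), ℂ),
        eLpNorm (multiplierOp m f) (ENNReal.ofReal p) volume ≤
          C * hormanderNorm Θ u s m * ∏ i, hardyNorm Φ (q i) (f i))
    {v : EuclideanSpace ℝ (Fin n)} (hv : ‖v‖ = 1)
    {η : 𝓢(EuclideanSpace ℝ (Fin n), ℂ)} (hη : ∀ y, η y ≠ 0 → ‖y‖ ≤ 1 / l)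
    {ψ : W → ℂ} (hψ : ContDiff ℝ ∞ ψ) (hψc : HasCompactSupport ψ) {L : FreqSpace l n →L[ℝ] W}
    {δ : ℝ} (hL : SlabBound L δ) {J : ℕ → ℕ} {c : ℕ → ℕ → ℝ} {j : ℕ → ℕ → ℕ}
    (hlb : LayerBound (FreqSpace l n) u s δ J c j) :
    ∃ C : ℝ≥0, ∀ N : ℕ, 1 ≤ N → eLpNorm (fun x => ∫ ζ : FreqSpace l n,
      (∑ i ∈ Finset.range (J N), (c N i : ℂ) * ψ (((2 : ℝ) ^ j N i * ((2 : ℝ) ^ (4 * N))⁻¹) • L ζ)) *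
        (∏ i, η (ζ i)) * Complex.exp (2 * Real.pi * Complex.I *
          ((inner ℝ x (∑ i, ζ i) : ℝ) : ℂ))) (ENNReal.ofReal p) volume ≤ C := by
  have hl0 : (0 : ℝ) < l := by exact_mod_cast hl
  have hl1 : (1 : ℝ) ≤ l := by exact_mod_cast hl
  -- `t₀ = l^{-1/2}` makes `|(t₀v, …, t₀v)| = 1`.
  obtain ⟨t₀, ht₀, hlt⟩ : ∃ t₀ : ℝ, 0 < t₀ ∧ l * t₀ ^ 2 = 1 :=
    ⟨(Real.sqrt l)⁻¹, by positivity, by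
      rw [inv_pow, Real.sq_sqrt hl0.le, mul_inv_cancel₀ hl0.ne']⟩
  have hl2 : (1 : ℝ) / l = t₀ ^ 2 := by rw [div_eq_iff hl0.ne', mul_comm, hlt]
  have ht1 : t₀ ≤ 1 := by nlinarith
  obtain ⟨K, hK⟩ : ∃ K : ℕ, ∀ i, (n : ℝ) < K * q i := by
    obtain ⟨K, hK⟩ := exists_nat_gt (∑ i, n / q i)
    refine ⟨K, fun i => (div_lt_iff₀ (hq i)).1 (lt_of_le_of_lt ?_ hK)⟩
    exact Finset.single_le_sum (f := fun i => n / q i)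
      (fun i _ => div_nonneg (Nat.cast_nonneg _) (hq i).le) (Finset.mem_univ i)
  obtain ⟨κ, hκs, hκ⟩ := exists_smooth_inverse_power ht₀ K
  set a : FreqSpace l n := diagonal l (t₀ • v) with ha
  have ha1 : ‖a‖ = 1 := by
    have := norm_diagonal_sq (l := l) (t₀ • v)
    rw [norm_smul, hv, mul_one, Real.norm_of_nonneg ht₀.le, hlt] at this
    exact (pow_eq_one_iff_of_nonneg (norm_nonneg _) two_ne_zero).1 this
  -- The factor `H` localizes near `a` and undoes the powers of `⟨ξ, v⟩ / R` in the test functions.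
  let χ : ContDiffBump a := ⟨1 / 8, 1 / 4, by norm_num, by norm_num⟩
  set H : FreqSpace l n → ℂ := fun ξ => (χ ξ : ℂ) * ∏ i, κ (inner ℝ (ξ i) v) with hH
  have hHs : ContDiff ℝ ∞ H :=
    (Complex.ofRealCLM.contDiff.comp χ.contDiff).mul (contDiff_prod_coord hκs v)
  have hHsupp : ∀ ξ, H ξ ≠ 0 → 3 / 4 ≤ ‖ξ‖ ∧ ‖ξ‖ ≤ 5 / 4 := fun ξ h => by
    have h1 : ξ ∈ Function.support χ := by
      intro h0
      exact h (by rw [hH]; simp [h0])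
    rw [χ.support_eq, mem_ball_iff_norm] at h1
    have h2 := norm_sub_norm_le ξ a
    have h3 := norm_sub_norm_le a ξ
    rw [norm_sub_rev] at h3
    change ‖ξ - a‖ < 1 / 4 at h1
    constructor <;> linarith
  obtain ⟨m, hm, hmn, hmA⟩ := exists_layered_multiplier hΘ hψ hψc hHs hHsupp hL a hs hlb
  obtain ⟨C, hC⟩ := hbdd m hm hmn
  choose D hD using fun i => exists_hardyNorm_test_le Φ (hq i) (hK i) t₀ v hv (𝓕⁻ η)
  refine ⟨C * (hormanderNorm Θ u s m).toNNReal * ∏ i, D i, fun N hN => ?_⟩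
  set R : ℝ := 2 ^ (4 * N) with hR
  -- Since `1 ≤ N`, the unit ball about `R a` lies well inside the plateau of `χ(· / R)`.
  have hR16 : 16 ≤ R := by
    calc (16 : ℝ) = 2 ^ 4 := by norm_num
      _ ≤ _ := pow_le_pow_right₀ one_le_two (by omega)
  have hR0 : 0 < R := by linarith
  have key := norm_multiplierOp_test m (R := R) K t₀ v η
    (S := fun ζ => ∑ i ∈ Finset.range (J N), (c N i : ℂ) * ψ (((2 : ℝ) ^ j N i * R⁻¹) • L ζ))
    (fun ζ hζ => by
      have hζi : ∀ i, ‖ζ i‖ ≤ t₀ ^ 2 := fun i => hl2 ▸ hη _ (hζ i)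
      have hζ1 : ‖ζ‖ ≤ 1 := by
        have : ‖ζ‖ ^ 2 ≤ 1 := by
          rw [PiLp.norm_sq_eq_of_L2]
          calc ∑ i, ‖ζ i‖ ^ 2 ≤ ∑ i : Fin l, (t₀ ^ 2) ^ 2 :=
                Finset.sum_le_sum fun i _ => pow_le_pow_left₀ (norm_nonneg _) (hζi i) 2
            _ = l * t₀ ^ 2 * t₀ ^ 2 := by simp; ring
            _ ≤ 1 := by rw [hlt, one_mul]; exact pow_le_one₀ ht₀.le ht1
        exact (sq_le_one_iff₀ (norm_nonneg _)).1 this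
      set ξ : FreqSpace l n := a + R⁻¹ • ζ with hξ
      have hξR : R • a + ζ = R • ξ := by
        rw [hξ, smul_add, smul_smul, mul_inv_cancel₀ hR0.ne', one_smul]
      have hRi : R⁻¹ ≤ 1 / 16 := by rw [inv_le_comm₀ hR0 (by norm_num)]; linarith
      have hξa : ‖ξ - a‖ ≤ 1 / 16 := by
        rw [hξ, add_sub_cancel_left, norm_smul, Real.norm_of_nonneg (by positivity)]
        nlinarith [norm_nonneg ζ]
      have hn1 : 1 / 2 ≤ ‖ξ‖ := by
        have := norm_sub_norm_le a ξ
        rw [norm_sub_rev] at this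
        linarith
      have hn2 : ‖ξ‖ ≤ 2 := by
        have := norm_sub_norm_le ξ a
        linarith
      have hχ : χ ξ = 1 := χ.one_of_mem_closedBall (by
        rw [mem_closedBall_iff_norm]
        change _ ≤ (1 / 8 : ℝ)
        linarith)
      have hin : ∀ i, inner ℝ ((R • ξ) i) v / R = inner ℝ (ξ i) v := fun i => by
        rw [PiLp.smul_apply, inner_smul_left]
        simp
        field_simp
      rw [hξR, hmA N ξ hn1 hn2, hH, hξ]
      simp only
      rw [← hξ, hχ, Complex.ofReal_one, one_mul, mul_assoc, ← Finset.prod_mul_distrib,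
        Finset.prod_eq_one, mul_one]
      · refine Finset.sum_congr rfl fun i _ => ?_
        rw [hξ, add_sub_cancel_left, map_smul, smul_smul]
      · intro i _
        rw [hin, mul_comm]
        refine hκ _ ?_
        have e : inner ℝ (ξ i) v - t₀ = R⁻¹ * inner ℝ (ζ i) v := by
          rw [hξ, PiLp.add_apply, ha, diagonal_apply, PiLp.smul_apply, inner_add_left,
            inner_smul_left, inner_smul_left, real_inner_self_eq_norm_sq, hv]
          simp
        rw [e, abs_mul, abs_of_pos (by positivity : 0 < R⁻¹)]
        have h1 := abs_real_inner_le_norm (ζ i) v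
        rw [hv, mul_one] at h1
        have h2 := hζi i
        have h3 : |inner ℝ (ζ i) v| ≤ t₀ := by nlinarith
        nlinarith [abs_nonneg (inner ℝ (ζ i) v)])
  have := hC fun _ => (scaledDeriv R v)^[K] (modulate (R • t₀ • v) (𝓕⁻ η))
  rw [eLpNorm_congr_norm_ae (Filter.Eventually.of_forall key)] at this
  refine this.trans ?_
  rw [ENNReal.coe_mul, ENNReal.coe_mul, ENNReal.coe_toNNReal hmn.ne]
  push_cast
  gcongr with i
  exact hD i R (by linarith)

end Testing

/-! ### Integrals over the product of frequency spaces -/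

section ProductIntegrals

variable {l n : ℕ}

lemma volume_preserving_piCurry_symm (l n : ℕ) :
    MeasurePreserving (MeasurableEquiv.piCurry (fun (_ : Fin l) (_ : Fin n) => ℝ)).symm := by
  refine ⟨MeasurableEquiv.measurable _, ?_⟩
  symm
  refine Measure.pi_eq fun s hs => ?_
  rw [MeasurableEquiv.map_apply]
  have : (MeasurableEquiv.piCurry (fun (_ : Fin l) (_ : Fin n) => ℝ)).symm ⁻¹'
      Set.univ.pi s = Set.univ.pi fun i => Set.univ.pi fun k => s ⟨i, k⟩ := by
    ext f
    simp only [MeasurableEquiv.coe_piCurry_symm, Set.mem_preimage, Set.mem_univ_pi]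
    exact ⟨fun h i k => h ⟨i, k⟩, fun h i => h i.1 i.2⟩
  rw [this, volume_pi_pi, Fintype.prod_sigma]
  exact Finset.prod_congr rfl fun i _ => volume_pi_pi _

/-- Lebesgue measure on `(ℝⁿ)ˡ` with its Euclidean norm is the product measure. -/
lemma volume_preserving_freqSpace_toLp (l n : ℕ) :
    MeasurePreserving (WithLp.toLp 2 : (Fin l → EuclideanSpace ℝ (Fin n)) → FreqSpace l n) := by
  have h1 : MeasurePreserving (fun (f : Fin l → EuclideanSpace ℝ (Fin n)) (i : Fin l) =>
      (WithLp.ofLp (f i) : Fin n → ℝ)) :=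
    volume_preserving_pi fun _ => PiLp.volume_preserving_ofLp (Fin n)
  have h2 := (volume_preserving_piCurry_symm l n).comp h1
  have h3 := (PiLp.volume_preserving_toLp ((_ : Fin l) × Fin n)).comp h2
  have h4 := (Pi.orthonormalBasis
    (fun _ : Fin l => EuclideanSpace.basisFun (Fin n) ℝ)).measurePreserving_repr_symm.comp h3
  exact h4

lemma measurableEmbedding_freqSpace_toLp (l n : ℕ) :
    MeasurableEmbedding (WithLp.toLp 2 : (Fin l → EuclideanSpace ℝ (Fin n)) → FreqSpace l n) :=
  (PiLp.continuousLinearEquiv 2 ℝ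
    (fun _ : Fin l => EuclideanSpace ℝ (Fin n))).symm.toHomeomorph.measurableEmbedding

lemma integrable_prod_freqSpace {η : EuclideanSpace ℝ (Fin n) → ℂ} (hη : Integrable η) :
    Integrable fun ζ : FreqSpace l n => ∏ i, η (ζ i) := by
  rw [← (volume_preserving_freqSpace_toLp l n).integrable_comp_emb
    (measurableEmbedding_freqSpace_toLp l n)]
  exact Integrable.fintype_prod fun _ => hη

lemma integral_prod_freqSpace (η : EuclideanSpace ℝ (Fin n) → ℂ) :
    ∫ ζ : FreqSpace l n, ∏ i, η (ζ i) = (∫ y, η y) ^ l := by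
  rw [← (volume_preserving_freqSpace_toLp l n).integral_comp
    (measurableEmbedding_freqSpace_toLp l n)]
  refine (integral_fintype_prod_volume_eq_prod fun (_ : Fin l) => η).trans ?_
  simp

lemma integral_prod_mul_exp (η : 𝓢(EuclideanSpace ℝ (Fin n), ℂ)) (x : EuclideanSpace ℝ (Fin n)) :
    ∫ ζ : FreqSpace l n, (∏ i, η (ζ i)) *
      Complex.exp (2 * Real.pi * Complex.I * ((inner ℝ x (∑ i, ζ i) : ℝ) : ℂ)) =
      (𝓕⁻ η x) ^ l := by
  rw [SchwartzMap.fourierInv_coe, Real.fourierInv_eq', ← integral_prod_freqSpace]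
  congr 1 with ζ
  rw [inner_sum, Complex.ofReal_sum, Finset.mul_sum, Complex.exp_sum, ← Finset.prod_mul_distrib]
  refine Finset.prod_congr rfl fun i _ => ?_
  rw [smul_eq_mul, mul_comm, real_inner_comm]
  push_cast
  congr 2
  ring

/-- Inserting the dilated profile `η(b(ζ₁ + ⋯ + ζ_l))` averages the product of the test functions
against `γ` at scale `b`. -/
lemma integral_profile_mul_prod_mul_exp {η : 𝓢(EuclideanSpace ℝ (Fin n), ℂ)}
    {γ : EuclideanSpace ℝ (Fin n) → ℝ} (hγ : ∀ x, 𝓕⁻ η x = (γ x : ℂ)) (b : ℝ)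
    (x : EuclideanSpace ℝ (Fin n)) :
    ∫ ζ : FreqSpace l n, η (b • ∑ i, ζ i) * (∏ i, η (ζ i)) *
      Complex.exp (2 * Real.pi * Complex.I * ((inner ℝ x (∑ i, ζ i) : ℝ) : ℂ)) =
      ((∫ z, γ z * γ (x - b • z) ^ l : ℝ) : ℂ) := by
  have hη : ∀ y, η y = ∫ z, Complex.exp (((-2 * Real.pi * inner ℝ z y : ℝ) : ℂ) * Complex.I) *
      (γ z : ℂ) := fun y => by
    have e : η y = 𝓕 (𝓕⁻ η) y := by rw [FourierTransform.fourier_fourierInv_eq]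
    rw [e, SchwartzMap.fourier_coe, Real.fourier_eq']
    simp only [hγ, smul_eq_mul]
  have hγi : Integrable fun z => (γ z : ℂ) := by
    have := (𝓕⁻ η).integrable (μ := volume)
    simpa only [funext hγ] using this
  have hcomm : ∀ (z : EuclideanSpace ℝ (Fin n)) (ζ : FreqSpace l n),
      Complex.exp (((-2 * Real.pi * inner ℝ z (b • ∑ i, ζ i) : ℝ) : ℂ) * Complex.I) * (γ z : ℂ) *
        (∏ i, η (ζ i)) *
        Complex.exp (2 * Real.pi * Complex.I * ((inner ℝ x (∑ i, ζ i) : ℝ) : ℂ)) =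
      (γ z : ℂ) * ((∏ i, η (ζ i)) * Complex.exp (2 * Real.pi * Complex.I *
        ((inner ℝ (x - b • z) (∑ i, ζ i) : ℝ) : ℂ))) := fun z ζ => by
    have : Complex.exp (2 * Real.pi * Complex.I * ((inner ℝ (x - b • z) (∑ i, ζ i) : ℝ) : ℂ)) =
        Complex.exp (((-2 * Real.pi * inner ℝ z (b • ∑ i, ζ i) : ℝ) : ℂ) * Complex.I) *
        Complex.exp (2 * Real.pi * Complex.I * ((inner ℝ x (∑ i, ζ i) : ℝ) : ℂ)) := by
      rw [← Complex.exp_add]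
      congr 1
      rw [inner_sub_left, inner_smul_left, inner_smul_right]
      simp only [conj_trivial]
      push_cast
      ring
    rw [this]
    ring
  have hint : Integrable (Function.uncurry fun (ζ : FreqSpace l n) (z : EuclideanSpace ℝ (Fin n)) =>
      (γ z : ℂ) * ((∏ i, η (ζ i)) * Complex.exp (2 * Real.pi * Complex.I *
        ((inner ℝ (x - b • z) (∑ i, ζ i) : ℝ) : ℂ)))) (volume.prod volume) := by
    have h1 := (integrable_prod_freqSpace (l := l) (η.integrable (μ := volume))).mul_prod hγi
    have hc : Continuous fun w : FreqSpace l n × EuclideanSpace ℝ (Fin n) =>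
        Complex.exp (2 * Real.pi * Complex.I *
          ((inner ℝ (x - b • w.2) (∑ i, w.1 i) : ℝ) : ℂ)) := by fun_prop
    refine (h1.mul_bdd (c := 1) hc.aestronglyMeasurable
      (Filter.Eventually.of_forall fun w => ?_)).congr (Filter.Eventually.of_forall fun w => ?_)
    · rw [show 2 * Real.pi * Complex.I * ((inner ℝ (x - b • w.2) (∑ i, w.1 i) : ℝ) : ℂ) =
        ((2 * Real.pi * inner ℝ (x - b • w.2) (∑ i, w.1 i) : ℝ) : ℂ) * Complex.I by
          push_cast; ring, Complex.norm_exp_ofReal_mul_I]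
    · simp only [Function.uncurry]
      ring
  calc _ = ∫ ζ : FreqSpace l n, ∫ z, (γ z : ℂ) * ((∏ i, η (ζ i)) *
          Complex.exp (2 * Real.pi * Complex.I *
            ((inner ℝ (x - b • z) (∑ i, ζ i) : ℝ) : ℂ))) := by
        congr 1 with ζ
        rw [hη (b • ∑ i, ζ i), ← integral_mul_const, ← integral_mul_const]
        congr 1 with z
        exact hcomm z ζ
    _ = ∫ z, (γ z : ℂ) * (𝓕⁻ η (x - b • z)) ^ l := by
        rw [integral_integral_swap hint]
        congr 1 with z
        rw [integral_const_mul, integral_prod_mul_exp]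
    _ = _ := by
        rw [← integral_complex_ofReal]
        congr 1 with z
        rw [hγ]
        push_cast
        ring

end ProductIntegrals

/-! ### The condition `s > ln / u` -/

section FirstCondition

open scoped ContDiff

variable {l n : ℕ}

/-- An extended number whose multiples by an unbounded sequence stay bounded vanishes. -/
lemma eq_zero_of_forall_ofReal_mul_le {f : ℕ → ℝ} (hf : Filter.Tendsto f Filter.atTop Filter.atTop)
    {X : ℝ≥0∞} {C : ℝ≥0} (h : ∀ N, 1 ≤ N → ENNReal.ofReal (f N) * X ≤ C) : X = 0 := by
  by_contra hX
  have hfin : (C : ℝ≥0∞) / X ≠ ⊤ := ENNReal.div_ne_top ENNReal.coe_ne_top hX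
  obtain ⟨N, hN1, hN2⟩ := ((Filter.eventually_ge_atTop 1).and
    (hf.eventually_gt_atTop (max 0 ((C : ℝ≥0∞) / X).toReal))).exists
  have h0 : 0 < f N := (le_max_left _ _).trans_lt hN2
  have hXt : X ≠ ⊤ := by
    rintro rfl
    have := h N hN1
    rw [ENNReal.mul_top (by simpa using h0)] at this
    exact absurd this (by simp)
  have h1 : ENNReal.ofReal (f N) ≤ C / X :=
    (ENNReal.le_div_iff_mul_le (Or.inl hX) (Or.inl hXt)).2 (h N hN1)
  rw [ENNReal.ofReal_le_iff_le_toReal hfin] at h1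
  exact absurd ((le_max_right _ _).trans_lt hN2) (not_lt.2 h1)

lemma eLpNorm_ne_zero_of_continuous {V : Type*} [NormedAddCommGroup V] [InnerProductSpace ℝ V]
    [FiniteDimensional ℝ V] [MeasurableSpace V] [BorelSpace V] {g : V → ℝ} (hg : Continuous g)
    (h0 : g 0 ≠ 0) {p : ℝ} (hp : 0 < p) :
    eLpNorm g (ENNReal.ofReal p) volume ≠ 0 := by
  rw [Ne, eLpNorm_eq_zero_iff hg.aestronglyMeasurable (by simpa using hp),
    hg.ae_eq_iff_eq volume continuous_zero]
  exact fun h => h0 (congrFun h 0)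

/-- In the range `s ≤ d / u` the `L^u` norm of a sum of `N` concentric layers is `O(N^{1/u})`. -/
lemma layerBound_concentric {E : Type} [NormedAddCommGroup E] [InnerProductSpace ℝ E]
    [FiniteDimensional ℝ E] [MeasurableSpace E] [BorelSpace E] {u s d : ℝ} (hu : 1 < u)
    (hd : 0 < d) (hsd : s ≤ d / u) :
    LayerBound E u s d (fun N => N) (fun N _ => (N : ℝ) ^ (-(1 / u))) (fun _ i => i) := by
  intro C
  have hu0 : 0 < u := one_pos.trans hu
  set q : ℝ := 2 ^ (d / u) with hq
  have hq1 : 1 < q := Real.one_lt_rpow one_lt_two (by positivity)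
  obtain ⟨C', hC'⟩ := exists_eLpNorm_sum_le (μ := (volume : Measure E)) hu.le hq1 C
  have hpow : ∀ i : ℕ, q ^ i = ((2 : ℝ) ^ i) ^ (d / u) := fun i => by
    rw [hq, ← Real.rpow_natCast, ← Real.rpow_natCast, ← Real.rpow_mul zero_le_two,
      ← Real.rpow_mul zero_le_two, mul_comm]
  refine ⟨C', fun N g hg h1 h2 => ?_⟩
  have h2i : ∀ i : ℕ, 1 ≤ (2 : ℝ) ^ i := fun i => one_le_pow₀ one_le_two
  have key := hC' g (fun i => (hg i).measurable)
    (fun i x => (h1 i x).trans (by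
      gcongr
      rw [hpow]
      exact Real.rpow_le_rpow_of_exponent_le (h2i i) hsd))
    (fun i => (h2 i).trans (by
      gcongr
      rw [hpow, ← Real.rpow_mul (by positivity), ← Real.rpow_neg (by positivity)]
      refine Real.rpow_le_rpow_of_exponent_le (h2i i) ?_
      have : d / u * (u - 1) = d - d / u := by field_simp
      linarith)) N
  have e : (fun x => ∑ i ∈ Finset.range N, (((N : ℝ) ^ (-(1 / u)) : ℝ) : ℂ) * g i x) =
      (((N : ℝ) ^ (-(1 / u)) : ℝ) : ℂ) • fun x => ∑ i ∈ Finset.range N, g i x := by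
    ext x
    simp [Finset.mul_sum]
  rw [e, eLpNorm_const_smul]
  rcases N.eq_zero_or_pos with rfl | hN
  · simp
  have hN0 : (0 : ℝ) < N := by exact_mod_cast hN
  calc _ ≤ ‖(((N : ℝ) ^ (-(1 / u)) : ℝ) : ℂ)‖ₑ * (C' * (N : ℝ≥0∞) ^ (1 / u)) := by gcongr
    _ = C' * (ENNReal.ofReal ((N : ℝ) ^ (-(1 / u))) * (N : ℝ≥0∞) ^ (1 / u)) := by
        rw [← ofReal_norm, Complex.norm_real, Real.norm_of_nonneg (by positivity)]
        ring
    _ = C' := by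
        rw [← ENNReal.ofReal_natCast, ENNReal.ofReal_rpow_of_pos hN0,
          ← ENNReal.ofReal_mul (by positivity), ← Real.rpow_add hN0, neg_add_cancel,
          Real.rpow_zero, ENNReal.ofReal_one, mul_one]
    _ ≤ _ := le_rfl

/-- The smoothness condition `s > ln / u`: a sum of `N` concentric cut-offs, normalized in
`L^u_s`, takes the value `N^{1 - 1/u}` near the centre. -/
lemma lt_of_multiplier_bound (hl : 1 ≤ l) (hn : 1 ≤ n) {p : ℝ} (hp : 0 < p) {q : Fin l → ℝ}
    (hq : ∀ i, 0 < q i) {u s : ℝ} (hu : 1 < u) (hs : 0 < s) {Θ : 𝓢(FreqSpace l n, ℂ)}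
    (hΘ : ∀ ξ, 𝓕 Θ ξ ≠ 0 → 1 / 2 ≤ ‖ξ‖ ∧ ‖ξ‖ ≤ 2)
    {Φ : 𝓢(EuclideanSpace ℝ (Fin n), ℂ)}
    (hbdd : ∀ m : FreqSpace l n → ℂ, Measurable m → hormanderNorm Θ u s m < ⊤ →
      ∃ C : ℝ≥0, ∀ f : Fin l → 𝓢(EuclideanSpace ℝ (Fin n), ℂ),
        eLpNorm (multiplierOp m f) (ENNReal.ofReal p) volume ≤
          C * hormanderNorm Θ u s m * ∏ i, hardyNorm Φ (q i) (f i)) :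
    (l * n : ℝ) / u < s := by
  by_contra! hsd
  have hl0 : (0 : ℝ) < l := by exact_mod_cast hl
  have hn0 : (0 : ℝ) < n := by exact_mod_cast hn
  have hl1 : (1 : ℝ) ≤ l := by exact_mod_cast hl
  obtain ⟨η, γ, hη, hγc, hγ0, hγ1, hγ⟩ := exists_profile (V := EuclideanSpace ℝ (Fin n))
    (ρ := 1 / l) (by positivity)
  let φ : ContDiffBump (0 : FreqSpace l n) := ⟨1, 2, one_pos, one_lt_two⟩
  have hdim : (Module.finrank ℝ (FreqSpace l n) : ℝ) = l * n := by
    rw [(WithLp.linearEquiv 2 ℝ (Fin l → EuclideanSpace ℝ (Fin n))).finrank_eq,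
      Module.finrank_pi_fintype]
    simp
  have hslab := slabBound_of_rightInverse (ContinuousLinearMap.id ℝ (FreqSpace l n))
    (ContinuousLinearMap.id ℝ (FreqSpace l n)) (fun y => rfl)
  rw [hdim] at hslab
  obtain ⟨C, hC⟩ := exists_eLpNorm_layers_le hl hq hs hΘ hbdd
    (v := EuclideanSpace.single ⟨0, hn⟩ 1) (by simp) hη
    (ψ := fun ξ : FreqSpace l n => (φ ξ : ℂ))
    (Complex.ofRealCLM.contDiff.comp φ.contDiff)
    (φ.hasCompactSupport.comp_left (g := fun r : ℝ => (r : ℂ)) (by simp)) hslab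
    (layerBound_concentric hu (by positivity) hsd)
  have key : ∀ N : ℕ, 1 ≤ N → ENNReal.ofReal ((N : ℝ) ^ (1 - 1 / u)) *
      eLpNorm (fun x => γ x ^ l) (ENNReal.ofReal p) volume ≤ C := by
    intro N hN
    have hN0 : (0 : ℝ) < N := by exact_mod_cast hN
    refine le_trans (le_of_eq ?_) (hC N hN)
    rw [← Real.enorm_of_nonneg (by positivity : 0 ≤ (N : ℝ) ^ (1 - 1 / u)), ← eLpNorm_const_smul]
    refine eLpNorm_congr_norm_ae (Filter.Eventually.of_forall fun x => ?_)
    have e : ∀ ζ : FreqSpace l n, (∑ i ∈ Finset.range N, (((N : ℝ) ^ (-(1 / u)) : ℝ) : ℂ) *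
        (φ (((2 : ℝ) ^ i * ((2 : ℝ) ^ (4 * N))⁻¹) • (ContinuousLinearMap.id ℝ _) ζ) : ℂ)) *
        (∏ i, η (ζ i)) * Complex.exp (2 * Real.pi * Complex.I *
          ((inner ℝ x (∑ i, ζ i) : ℝ) : ℂ)) = (((N : ℝ) ^ (1 - 1 / u) : ℝ) : ℂ) *
        ((∏ i, η (ζ i)) * Complex.exp (2 * Real.pi * Complex.I *
          ((inner ℝ x (∑ i, ζ i) : ℝ) : ℂ))) := fun ζ => by
      by_cases h : ∀ i, η (ζ i) ≠ 0
      · have hζ : ‖ζ‖ ≤ 1 := by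
          have : ‖ζ‖ ^ 2 ≤ 1 := by
            rw [PiLp.norm_sq_eq_of_L2]
            calc ∑ i, ‖ζ i‖ ^ 2 ≤ ∑ i : Fin l, (1 / l : ℝ) ^ 2 :=
                  Finset.sum_le_sum fun i _ => pow_le_pow_left₀ (norm_nonneg _) (hη _ (h i)) 2
              _ = 1 / l := by simp; field_simp
              _ ≤ 1 := by rw [div_le_one hl0]; exact hl1
          exact (sq_le_one_iff₀ (norm_nonneg _)).1 this
        -- All `N` cut-offs are `1` on the support of the test functions, since `i ≤ 4N`.
        have hφ : ∀ i ∈ Finset.range N,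
            φ (((2 : ℝ) ^ i * ((2 : ℝ) ^ (4 * N))⁻¹) • (ContinuousLinearMap.id ℝ _) ζ) = 1 := by
          intro i hi
          rw [Finset.mem_range] at hi
          refine φ.one_of_mem_closedBall ?_
          rw [mem_closedBall_zero_iff, norm_smul, Real.norm_of_nonneg (by positivity)]
          have : (2 : ℝ) ^ i ≤ 2 ^ (4 * N) := pow_le_pow_right₀ one_le_two (by omega)
          have h1 : (2 : ℝ) ^ i * ((2 : ℝ) ^ (4 * N))⁻¹ ≤ 1 := by
            rw [← div_eq_mul_inv]; exact div_le_one_of_le₀ this (by positivity)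
          exact mul_le_one₀ h1 (norm_nonneg _) hζ
        rw [Finset.sum_congr rfl fun i hi => by rw [hφ i hi]]
        rw [Finset.sum_const, Finset.card_range, nsmul_eq_mul, Complex.ofReal_one, mul_one,
          mul_assoc]
        congr 1
        rw [sub_eq_add_neg, Real.rpow_add hN0, Real.rpow_one]
        push_cast
        rfl
      · push Not at h
        obtain ⟨i, hi⟩ := h
        rw [Finset.prod_eq_zero (f := fun i => η (ζ i)) (Finset.mem_univ i) hi]
        simp
    simp only [e]
    rw [integral_const_mul, integral_prod_mul_exp, hγ, norm_mul, norm_pow, Complex.norm_real,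
      Complex.norm_real, Pi.smul_apply, smul_eq_mul, norm_mul, norm_pow]
  have hlim : Filter.Tendsto (fun N : ℕ => (N : ℝ) ^ (1 - 1 / u)) Filter.atTop Filter.atTop :=
    (tendsto_rpow_atTop (by
      rw [sub_pos, div_lt_one (one_pos.trans hu)]; exact hu)).comp tendsto_natCast_atTop_atTop
  exact eLpNorm_ne_zero_of_continuous (hγc.pow l) (pow_pos hγ1 l).ne' hp
    (eq_zero_of_forall_ofReal_mul_le hlim key)

end FirstCondition

/-! ### The condition `s / n > 1 / p - 1 / u'` -/

section SecondCondition

open scoped ContDiff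

/-- An average of layers, each normalized by its own `L^u` norm `2^{j(s - δ/u)}`, stays bounded. -/
lemma layerBound_average {E : Type} [NormedAddCommGroup E] [InnerProductSpace ℝ E]
    [FiniteDimensional ℝ E] [MeasurableSpace E] [BorelSpace E] {u s δ : ℝ} (hu : 1 < u)
    (J : ℕ → ℕ) :
    LayerBound E u s δ J
      (fun N i => (J N : ℝ)⁻¹ * ((2 : ℝ) ^ (4 * N + i)) ^ (-(s - δ / u)))
      (fun N i => 4 * N + i) := by
  intro C
  have hu0 : 0 < u := one_pos.trans hu
  refine ⟨C, fun N g hg h1 h2 => ?_⟩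
  have hterm : ∀ i, eLpNorm (g i) (ENNReal.ofReal u) volume ≤
      C * ENNReal.ofReal (((2 : ℝ) ^ (4 * N + i)) ^ (s - δ / u)) := by
    intro i
    set a : ℝ := 2 ^ (4 * N + i) with ha
    have ha0 : 0 < a := by positivity
    have hC := C.coe_nonneg
    refine (eLpNorm_le_of_sup_of_lintegral hu.le (K := C * (a ^ s).toNNReal)
      (fun x => by rw [ENNReal.coe_mul]; exact h1 i x) (h2 i)).trans (le_of_eq ?_)
    have e1 : ((C * (a ^ s).toNNReal : ℝ≥0) : ℝ≥0∞) = ENNReal.ofReal (C * a ^ s) := by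
      rw [ENNReal.ofReal_mul hC, ENNReal.ofReal_coe_nnreal, ENNReal.coe_mul]; rfl
    rw [e1, ENNReal.ofReal_rpow_of_nonneg (by positivity) (by linarith), ← ENNReal.ofReal_coe_nnreal,
      ← ENNReal.ofReal_mul hC, ← ENNReal.ofReal_mul (by positivity),
      ENNReal.ofReal_rpow_of_nonneg (by positivity) (by positivity), ← ENNReal.ofReal_mul hC]
    congr 1
    have e2 : ((C : ℝ) * a ^ s) ^ (u - 1) * (C * a ^ (s - δ)) =
        (C * a ^ (s - δ / u)) ^ u := by
      rw [Real.mul_rpow hC (by positivity), Real.mul_rpow hC (by positivity),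
        ← Real.rpow_mul ha0.le, ← Real.rpow_mul ha0.le,
        show (C : ℝ) ^ (u - 1) * a ^ (s * (u - 1)) * (C * a ^ (s - δ)) =
          ((C : ℝ) ^ (u - 1) * C) * (a ^ (s * (u - 1)) * a ^ (s - δ)) by ring,
        ← Real.rpow_add ha0, ← Real.rpow_add_one' hC (by linarith)]
      congr 2
      · ring
      · field_simp
        ring
    rw [e2, ← Real.rpow_mul (by positivity), mul_one_div_cancel hu0.ne', Real.rpow_one]
  rw [show (fun x => ∑ i ∈ Finset.range (J N), (((J N : ℝ)⁻¹ * ((2 : ℝ) ^ (4 * N + i)) ^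
      (-(s - δ / u)) : ℝ) : ℂ) * g i x) = ∑ i ∈ Finset.range (J N), (((J N : ℝ)⁻¹ *
      ((2 : ℝ) ^ (4 * N + i)) ^ (-(s - δ / u)) : ℝ) : ℂ) • g i by ext x; simp]
  refine (eLpNorm_sum_le (fun i _ => ((hg i).const_smul _).aestronglyMeasurable)
    (by rw [ENNReal.one_le_ofReal]; exact hu.le)).trans ?_
  calc _ ≤ ∑ i ∈ Finset.range (J N), ENNReal.ofReal ((J N : ℝ)⁻¹) * C := by
        refine Finset.sum_le_sum fun i _ => ?_
        rw [eLpNorm_const_smul, ← ofReal_norm, Complex.norm_real,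
          Real.norm_of_nonneg (by positivity)]
        refine (mul_le_mul_right (hterm i) _).trans (le_of_eq ?_)
        rw [mul_left_comm, ← ENNReal.ofReal_mul (by positivity), mul_assoc,
          ← Real.rpow_add (by positivity), neg_add_cancel, Real.rpow_zero, mul_one, mul_comm]
    _ = (J N : ℝ≥0∞) * ENNReal.ofReal ((J N : ℝ)⁻¹) * C := by
        rw [Finset.sum_const, Finset.card_range, nsmul_eq_mul, mul_assoc]
    _ ≤ 1 * C := by
        gcongr
        rw [← ENNReal.ofReal_natCast, ← ENNReal.ofReal_mul (by positivity)]
        exact ENNReal.ofReal_le_one.2 mul_inv_le_one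
    _ = _ := one_mul _

/-- A function of size `A 2^{-id}` on the balls of radius `r 2^i` for `i < J` picks up the same
amount of mass from each of `J` shells. -/
lemma mul_le_setLIntegral_of_tower {V : Type*} [NormedAddCommGroup V] [InnerProductSpace ℝ V]
    [FiniteDimensional ℝ V] [MeasurableSpace V] [BorelSpace V] (hd : 1 ≤ Module.finrank ℝ V)
    {F : V → ℝ≥0∞} {A : ℝ≥0∞} {r : ℝ} (hr : 0 < r) {J : ℕ}
    (hF : ∀ i < J, ∀ x, ‖x‖ ≤ r * 2 ^ i →
      A * (ENNReal.ofReal (((2 : ℝ) ^ i) ^ Module.finrank ℝ V))⁻¹ ≤ F x) :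
    ∀ k ≤ J, k * A * volume (Metric.closedBall (0 : V) (r / 2)) ≤
      ∫⁻ x in Metric.closedBall (0 : V) (r / 2 * 2 ^ k), F x := by
  set d := Module.finrank ℝ V
  set v₀ := volume (Metric.closedBall (0 : V) (r / 2)) with hv₀
  have hvol : ∀ k : ℕ, volume (Metric.closedBall (0 : V) (r / 2 * 2 ^ k)) =
      ENNReal.ofReal (((2 : ℝ) ^ k) ^ d) * v₀ := fun k => by
    rw [hv₀, Measure.addHaar_closedBall _ _ (by positivity),
      Measure.addHaar_closedBall _ _ (by positivity), mul_pow, mul_comm ((r / 2) ^ d),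
      ENNReal.ofReal_mul (by positivity), mul_assoc]
  intro k
  induction k with
  | zero => simp
  | succ k ih =>
    intro hk
    set D := Metric.closedBall (0 : V) (r / 2 * 2 ^ k) with hD
    set D' := Metric.closedBall (0 : V) (r / 2 * 2 ^ (k + 1)) with hD'
    have hDD : D ⊆ D' := Metric.closedBall_subset_closedBall (by
      gcongr
      · exact one_le_two
      · exact k.le_succ)
    have hDm : MeasurableSet D := Metric.isClosed_closedBall.measurableSet
    have hDm' : MeasurableSet D' := Metric.isClosed_closedBall.measurableSet
    -- Doubling the radius at least doubles the volume, as `V ≠ 0`.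
    have hdiff : volume D ≤ volume (D' \ D) := by
      rw [measure_sdiff hDD hDm.nullMeasurableSet measure_closedBall_lt_top.ne]
      refine ENNReal.le_sub_of_add_le_right measure_closedBall_lt_top.ne ?_
      rw [hvol, hvol, ← two_mul, ← mul_assoc, ← ENNReal.ofReal_ofNat 2,
        ← ENNReal.ofReal_mul (by norm_num)]
      gcongr
      rw [pow_succ, mul_pow, mul_comm]
      gcongr
      exact le_self_pow₀ one_le_two (by omega)
    have hshell : A * v₀ ≤ ∫⁻ x in D' \ D, F x := by
      have hpos : ENNReal.ofReal (((2 : ℝ) ^ k) ^ d) ≠ 0 := by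
        rw [Ne, ENNReal.ofReal_eq_zero, not_le]; positivity
      calc A * v₀ = A * (ENNReal.ofReal (((2 : ℝ) ^ k) ^ d))⁻¹ * volume D := by
            rw [hvol, mul_assoc, ← mul_assoc (_⁻¹), ENNReal.inv_mul_cancel hpos
              ENNReal.ofReal_ne_top, one_mul]
        _ ≤ A * (ENNReal.ofReal (((2 : ℝ) ^ k) ^ d))⁻¹ * volume (D' \ D) := by gcongr
        _ = ∫⁻ x in D' \ D, A * (ENNReal.ofReal (((2 : ℝ) ^ k) ^ d))⁻¹ := by
            rw [setLIntegral_const]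
        _ ≤ _ := by
            refine setLIntegral_mono' (hDm'.diff hDm) fun x hx => hF k (by omega) x ?_
            have := hx.1
            rw [hD', mem_closedBall_zero_iff, pow_succ] at this
            linarith
    calc ((k + 1 : ℕ) : ℝ≥0∞) * A * v₀ = k * A * v₀ + A * v₀ := by push_cast; ring
      _ ≤ (∫⁻ x in D, F x) + ∫⁻ x in D' \ D, F x := add_le_add (ih (by omega)) hshell
      _ = ∫⁻ x in D ∪ (D' \ D), F x :=
          (lintegral_union (hDm'.diff hDm) Set.disjoint_sdiff_right).symm
      _ = _ := by rw [Set.union_sdiff_cancel hDD]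

variable {l n : ℕ}

/-- The averages of `γ^l` at scale `b` are of size at least `b^{-n}` up to distance `∼ b`. -/
lemma exists_le_integral_profile {η : 𝓢(EuclideanSpace ℝ (Fin n), ℂ)}
    {γ : EuclideanSpace ℝ (Fin n) → ℝ} (hγ : ∀ x, 𝓕⁻ η x = (γ x : ℂ)) (hγc : Continuous γ)
    (hγ0 : ∀ x, 0 ≤ γ x) (hγ1 : 0 < γ 0) (l : ℕ) :
    ∃ c r : ℝ, 0 < c ∧ 0 < r ∧ ∀ (b : ℝ) (x : EuclideanSpace ℝ (Fin n)), 1 ≤ b → ‖x‖ ≤ r * b →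
      c * (b ^ n)⁻¹ ≤ ∫ z, γ z * γ (x - b • z) ^ l := by
  obtain ⟨ε, hε, hball⟩ := Metric.eventually_nhds_iff_ball.1
    (hγc.continuousAt.eventually_const_lt (half_lt_self hγ1) : ∀ᶠ x in nhds 0, γ 0 / 2 < γ x)
  set c₀ := γ 0 / 2
  have hc₀ : 0 < c₀ := half_pos hγ1
  set r := ε / 4 with hr
  have hr0 : 0 < r := by positivity
  have hnorm : ∀ x, ‖𝓕⁻ η x‖ = γ x := fun x => by
    rw [hγ, Complex.norm_real, Real.norm_of_nonneg (hγ0 x)]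
  have hγi : Integrable γ := by
    exact ((𝓕⁻ η).integrable (μ := volume)).norm.congr (Filter.Eventually.of_forall hnorm)
  have hγb : ∀ x, γ x ≤ SchwartzMap.seminorm ℝ 0 0 (𝓕⁻ η) := fun x => by
    rw [← hnorm]; exact SchwartzMap.norm_le_seminorm ℝ _ x
  set β := volume.real (Metric.ball (0 : EuclideanSpace ℝ (Fin n)) 1)
  have hβ : 0 < β := ENNReal.toReal_pos (Metric.measure_ball_pos _ _ one_pos).ne'
    measure_ball_lt_top.ne
  refine ⟨c₀ ^ (l + 1) * (r ^ n * β), r, by positivity, hr0, fun b x hb1 hx => ?_⟩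
  have hb : 0 < b := one_pos.trans_le hb1
  have hint : Integrable fun z => γ z * γ (x - b • z) ^ l := by
    refine hγi.mul_bdd (c := SchwartzMap.seminorm ℝ 0 0 (𝓕⁻ η) ^ l)
      (by fun_prop : Continuous fun z => γ (x - b • z) ^ l).aestronglyMeasurable
      (Filter.Eventually.of_forall fun z => ?_)
    rw [Real.norm_of_nonneg (pow_nonneg (hγ0 _) _)]
    exact pow_le_pow_left₀ (hγ0 _) (hγb _) _
  -- For `z` in this ball both `z` and `x - b z` are near `0`, where `γ ≥ c₀`.
  set S := Metric.closedBall (b⁻¹ • x) (b⁻¹ * r)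
  have hSm : MeasurableSet S := Metric.isClosed_closedBall.measurableSet
  calc c₀ ^ (l + 1) * (r ^ n * β) * (b ^ n)⁻¹ = ∫ _ in S, c₀ ^ (l + 1) := by
        rw [setIntegral_const, Measure.addHaar_real_closedBall _ _ (by positivity),
          finrank_euclideanSpace_fin, mul_pow, inv_pow, smul_eq_mul]
        ring
    _ ≤ ∫ z in S, γ z * γ (x - b • z) ^ l := by
        refine setIntegral_mono_on (integrableOn_const measure_closedBall_lt_top.ne)
          hint.integrableOn hSm fun z hz => ?_
        rw [mem_closedBall_iff_norm] at hz
        have h1 : ‖x - b • z‖ ≤ r := by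
          have : x - b • z = -(b • (z - b⁻¹ • x)) := by
            rw [smul_sub, smul_smul, mul_inv_cancel₀ hb.ne', one_smul, neg_sub]
          rw [this, norm_neg, norm_smul, Real.norm_of_nonneg hb.le]
          calc b * ‖z - b⁻¹ • x‖ ≤ b * (b⁻¹ * r) := by gcongr
            _ = r := by field_simp
        have h2 : ‖z‖ ≤ 2 * r := by
          have h3 : ‖z‖ ≤ ‖z - b⁻¹ • x‖ + ‖b⁻¹ • x‖ := by simpa using norm_add_le (z - b⁻¹ • x) (b⁻¹ • x)
          have h4 : ‖b⁻¹ • x‖ ≤ r := by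
            rw [norm_smul, Real.norm_of_nonneg (by positivity), inv_mul_le_iff₀ hb, mul_comm]
            exact hx
          have h5 : b⁻¹ * r ≤ r := mul_le_of_le_one_left hr0.le (inv_le_one_of_one_le₀ hb1)
          linarith
        have h6 := (hball z (by rw [mem_ball_zero_iff]; linarith)).le
        have h7 := (hball (x - b • z) (by rw [mem_ball_zero_iff]; linarith)).le
        have h8 := hγ0 z
        rw [pow_succ, mul_comm]
        gcongr
    _ ≤ _ := setIntegral_le_integral hint (Filter.Eventually.of_forall fun z =>
        mul_nonneg (hγ0 _) (pow_nonneg (hγ0 _) _))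

/-- The condition `s / n > 1 / p - 1 / u'`: cut-offs in the single direction `ξ₁ + ⋯ + ξ_l` at
`J` dyadic scales produce an average of `J` functions that put comparable `L^p` mass on different
shells, which is too large in `L^p` because `p < 1`. -/
lemma sub_lt_of_multiplier_bound (hl : 1 ≤ l) (hn : 1 ≤ n) {p : ℝ} (hp : 0 < p) {q : Fin l → ℝ}
    (hq : ∀ i, 0 < q i) {u s : ℝ} (hu : 1 < u) (hs : (l * n : ℝ) / u < s)
    {Θ : 𝓢(FreqSpace l n, ℂ)}
    (hΘ : ∀ ξ, 𝓕 Θ ξ ≠ 0 → 1 / 2 ≤ ‖ξ‖ ∧ ‖ξ‖ ≤ 2)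
    {Φ : 𝓢(EuclideanSpace ℝ (Fin n), ℂ)}
    (hbdd : ∀ m : FreqSpace l n → ℂ, Measurable m → hormanderNorm Θ u s m < ⊤ →
      ∃ C : ℝ≥0, ∀ f : Fin l → 𝓢(EuclideanSpace ℝ (Fin n), ℂ),
        eLpNorm (multiplierOp m f) (ENNReal.ofReal p) volume ≤
          C * hormanderNorm Θ u s m * ∏ i, hardyNorm Φ (q i) (f i)) :
    1 / p - (1 - 1 / u) < s / n := by
  by_contra! hsn
  have hu0 : 0 < u := one_pos.trans hu
  have hl0 : (0 : ℝ) < l := by exact_mod_cast hl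
  have hn0 : (0 : ℝ) < n := by exact_mod_cast hn
  have hl1 : (1 : ℝ) ≤ l := by exact_mod_cast hl
  have hs0 : 0 < s := lt_of_le_of_lt (by positivity) hs
  -- The failure of the condition forces `p < 1`.
  have hp1 : 0 < 1 / p - 1 := by
    have h1 : (l : ℝ) / u < s / n := by
      rw [div_lt_div_iff₀ hu0 hn0]
      rwa [div_lt_iff₀ hu0] at hs
    have h2 : 1 / u ≤ (l : ℝ) / u := by gcongr
    linarith
  set σ : ℝ := s - n / u with hσ
  have hσ0 : 0 < σ := by
    have : (n : ℝ) / u ≤ l * n / u := by gcongr; nlinarith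
    linarith
  have hσn : (σ + n) * p ≤ n := by
    rw [div_le_iff₀ hn0] at hsn
    have : σ + n ≤ n / p := by
      calc σ + n ≤ (1 / p - (1 - 1 / u)) * n - n / u + n := by linarith
        _ = n / p := by ring
    rwa [le_div_iff₀ hp] at this
  obtain ⟨η, γ, hη, hγc, hγ0, hγ1, hγ⟩ := exists_profile (V := EuclideanSpace ℝ (Fin n))
    (ρ := 1 / l) (by positivity)
  have hηc : HasCompactSupport η :=
    HasCompactSupport.intro (isCompact_closedBall 0 (1 / (l : ℝ))) fun x hx => by
      by_contra h
      exact hx (by simpa using hη x h)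
  -- The number of scales is so large that it beats the loss `2^{-4Nσ}` of the `N`-th hump.
  have hJ : ∀ N : ℕ, ∃ J : ℕ, 1 ≤ J ∧ N * ((2 : ℝ) ^ (4 * N)) ^ σ ≤ (J : ℝ) ^ (1 / p - 1) := by
    intro N
    have := (tendsto_rpow_atTop hp1).comp (tendsto_natCast_atTop_atTop (R := ℝ))
    exact ((Filter.eventually_ge_atTop 1).and
      (this.eventually_ge_atTop (N * ((2 : ℝ) ^ (4 * N)) ^ σ))).exists
  choose J hJ1 hJ2 using hJ
  let L : FreqSpace l n →L[ℝ] EuclideanSpace ℝ (Fin n) := ∑ i, PiLp.proj 2 _ i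
  have hL : ∀ ζ, L ζ = ∑ i, ζ i := fun ζ => by simp [L]
  let ι : EuclideanSpace ℝ (Fin n) →L[ℝ] FreqSpace l n :=
    (PiLp.continuousLinearEquiv 2 ℝ _).symm.toContinuousLinearMap ∘L
      ContinuousLinearMap.pi fun _ => (l : ℝ)⁻¹ • ContinuousLinearMap.id ℝ _
  have hι : ∀ y, L (ι y) = y := fun y => by
    rw [hL]
    simp [ι, ← Nat.cast_smul_eq_nsmul ℝ, smul_smul, mul_inv_cancel₀ hl0.ne']
  have hslab := slabBound_of_rightInverse L ι hι
  rw [finrank_euclideanSpace_fin] at hslab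
  obtain ⟨C, hC⟩ := exists_eLpNorm_layers_le hl hq hs0 hΘ hbdd
    (v := EuclideanSpace.single ⟨0, hn⟩ 1) (by simp) hη η.smooth' hηc hslab
    (layerBound_average hu J)
  obtain ⟨c, r, hc, hr, hcr⟩ := exists_le_integral_profile hγ hγc hγ0 hγ1 l
  set v₀ := volume (Metric.closedBall (0 : EuclideanSpace ℝ (Fin n)) (r / 2))
  have key : ∀ N : ℕ, 1 ≤ N →
      ENNReal.ofReal (N : ℝ) * (ENNReal.ofReal c * v₀ ^ (1 / p)) ≤ C := by
    intro N hN
    refine le_trans ?_ (hC N hN)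
    set T : EuclideanSpace ℝ (Fin n) → ℂ := fun x => ∫ ζ : FreqSpace l n,
      (∑ i ∈ Finset.range (J N), (((J N : ℝ)⁻¹ * ((2 : ℝ) ^ (4 * N + i)) ^ (-σ) : ℝ) : ℂ) *
        η (((2 : ℝ) ^ (4 * N + i) * ((2 : ℝ) ^ (4 * N))⁻¹) • L ζ)) *
        (∏ i, η (ζ i)) * Complex.exp (2 * Real.pi * Complex.I *
          ((inner ℝ x (∑ i, ζ i) : ℝ) : ℂ)) with hT
    have hTx : ∀ x, T x = ((∑ i ∈ Finset.range (J N), (J N : ℝ)⁻¹ *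
        ((2 : ℝ) ^ (4 * N + i)) ^ (-σ) * ∫ z, γ z * γ (x - (2 : ℝ) ^ i • z) ^ l : ℝ) : ℂ) := by
      intro x
      have hI : ∀ b : ℝ, Integrable fun ζ : FreqSpace l n => η (b • ∑ i, ζ i) * (∏ i, η (ζ i)) *
          Complex.exp (2 * Real.pi * Complex.I * ((inner ℝ x (∑ i, ζ i) : ℝ) : ℂ)) := fun b => by
        have hc : Continuous fun ζ : FreqSpace l n => η (b • ∑ i, ζ i) *
            Complex.exp (2 * Real.pi * Complex.I * ((inner ℝ x (∑ i, ζ i) : ℝ) : ℂ)) := by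
          have := η.continuous
          fun_prop
        refine ((integrable_prod_freqSpace (l := l) (η.integrable (μ := volume))).mul_bdd
          (c := SchwartzMap.seminorm ℝ 0 0 η) hc.aestronglyMeasurable
          (Filter.Eventually.of_forall fun ζ => ?_)).congr
          (Filter.Eventually.of_forall fun ζ => ?_)
        · rw [norm_mul, show 2 * Real.pi * Complex.I * ((inner ℝ x (∑ i, ζ i) : ℝ) : ℂ) =
            ((2 * Real.pi * inner ℝ x (∑ i, ζ i) : ℝ) : ℂ) * Complex.I by push_cast; ring,
            Complex.norm_exp_ofReal_mul_I, mul_one]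
          exact SchwartzMap.norm_le_seminorm ℝ _ _
        · simp only
          ring
      rw [Complex.ofReal_sum]
      simp only [hT, hL, Finset.sum_mul]
      have e : ∀ i : ℕ, (2 : ℝ) ^ (4 * N + i) * ((2 : ℝ) ^ (4 * N))⁻¹ = 2 ^ i := fun i => by
        rw [pow_add]
        field_simp
      simp only [e, mul_assoc (((_ : ℝ) : ℂ)) (η _)]
      rw [integral_finsetSum]
      · refine Finset.sum_congr rfl fun i _ => ?_
        simp only [mul_assoc (((_ : ℝ) : ℂ)) _]
        rw [integral_const_mul, integral_profile_mul_prod_mul_exp hγ]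
        push_cast
        ring
      · intro i _
        simp only [mul_assoc (((_ : ℝ) : ℂ)) _]
        exact (hI _).const_mul _
    set a : ℝ := (J N : ℝ)⁻¹ * ((2 : ℝ) ^ (4 * N)) ^ (-σ) * c with ha
    have hJ0 : (0 : ℝ) < J N := by exact_mod_cast hJ1 N
    have ha0 : 0 < a := by positivity
    -- All summands are nonnegative, so one of them is a lower bound; `(σ + n) p ≤ n` is the failure
    -- of the condition.
    have hlow : ∀ i < J N, ∀ x, ‖x‖ ≤ r * 2 ^ i → ENNReal.ofReal (a ^ p) *
        (ENNReal.ofReal (((2 : ℝ) ^ i) ^ n))⁻¹ ≤ ‖T x‖ₑ ^ p := by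
      intro i hi x hx
      have h2i : (1 : ℝ) ≤ 2 ^ i := one_le_pow₀ one_le_two
      have hnn : ∀ i : ℕ, 0 ≤ (J N : ℝ)⁻¹ * ((2 : ℝ) ^ (4 * N + i)) ^ (-σ) *
          ∫ z, γ z * γ (x - (2 : ℝ) ^ i • z) ^ l := fun i =>
        mul_nonneg (by positivity) (integral_nonneg fun z =>
          mul_nonneg (hγ0 _) (pow_nonneg (hγ0 _) _))
      have h1 : a * ((2 : ℝ) ^ i) ^ (-(σ + n)) ≤ ‖T x‖ := by
        rw [hTx, Complex.norm_real, Real.norm_of_nonneg (Finset.sum_nonneg fun i _ => hnn i)]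
        refine le_trans ?_ (Finset.single_le_sum (fun i _ => hnn i) (Finset.mem_range.2 hi))
        calc a * ((2 : ℝ) ^ i) ^ (-(σ + n)) = (J N : ℝ)⁻¹ * ((2 : ℝ) ^ (4 * N + i)) ^ (-σ) *
              (c * (((2 : ℝ) ^ i) ^ n)⁻¹) := by
              rw [ha, pow_add, Real.mul_rpow (by positivity) (by positivity), neg_add,
                Real.rpow_add (by positivity), Real.rpow_neg (by positivity) (n : ℝ),
                Real.rpow_natCast]
              ring
          _ ≤ _ := by
              gcongr
              exact hcr _ x h2i hx
      rw [← ENNReal.ofReal_inv_of_pos (by positivity), ← ENNReal.ofReal_mul (by positivity),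
        ← ofReal_norm, ENNReal.ofReal_rpow_of_nonneg (norm_nonneg _) hp.le]
      refine ENNReal.ofReal_le_ofReal (le_trans ?_ (Real.rpow_le_rpow (by positivity) h1 hp.le))
      rw [Real.mul_rpow ha0.le (by positivity), ← Real.rpow_mul (by positivity)]
      gcongr
      rw [← Real.rpow_natCast, ← Real.rpow_neg (by positivity)]
      exact Real.rpow_le_rpow_of_exponent_le h2i (by linarith)
    have hmass := mul_le_setLIntegral_of_tower (V := EuclideanSpace ℝ (Fin n))
      (by rw [finrank_euclideanSpace_fin]; exact hn) hr
      (by rw [finrank_euclideanSpace_fin]; exact hlow) (J N) le_rfl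
    have hmass' := hmass.trans (setLIntegral_le_lintegral _ _)
    rw [eLpNorm_eq_lintegral_rpow_enorm_toReal (by simpa using hp) ENNReal.ofReal_ne_top,
      ENNReal.toReal_ofReal hp.le]
    refine le_trans ?_ (ENNReal.rpow_le_rpow hmass' (by positivity))
    rw [← ENNReal.ofReal_natCast (J N), ← ENNReal.ofReal_mul hJ0.le,
      ENNReal.mul_rpow_of_nonneg _ _ (by positivity),
      ENNReal.ofReal_rpow_of_nonneg (by positivity) (by positivity), ← mul_assoc,
      ← ENNReal.ofReal_mul (by positivity)]
    gcongr
    rw [Real.mul_rpow hJ0.le (by positivity), ← Real.rpow_mul ha0.le, mul_one_div_cancel hp.ne',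
      Real.rpow_one, ha]
    have h3 := hJ2 N
    rw [Real.rpow_sub hJ0, Real.rpow_one, ← le_div_iff₀ (by positivity), div_eq_mul_inv,
      ← Real.rpow_neg (by positivity)] at h3
    calc (N : ℝ) * c ≤ (J N : ℝ) ^ (1 / p) / J N * ((2 : ℝ) ^ (4 * N)) ^ (-σ) * c := by gcongr
      _ = _ := by ring
  have hzero := eq_zero_of_forall_ofReal_mul_le tendsto_natCast_atTop_atTop key
  rw [mul_eq_zero, ENNReal.ofReal_eq_zero, ENNReal.rpow_eq_zero_iff] at hzero
  rcases hzero with h | ⟨h, -⟩ | ⟨h, h'⟩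
  · linarith
  · exact (Metric.measure_closedBall_pos volume 0 (half_pos hr)).ne' h
  · exact measure_closedBall_lt_top.ne h

end SecondCondition

end MultilinearMultiplier

theorem theorem6p3 (l n : ℕ) (hl : 1 ≤ l) (hn : 1 ≤ n)
    (p : ℝ) (q : Fin l → ℝ) (hq : ∀ i, 0 < q i) (hpq : 1 / p = ∑ i, 1 / q i)
    (u u' : ℝ) (hu : 1 < u) (huu' : 1 / u + 1 / u' = 1)
    (s : ℝ) (hs : 0 < s)
    (Θ : 𝓢(MultilinearMultiplier.FreqSpace l n, ℂ))
    (hΘ : ∀ ξ, 𝓕 Θ ξ ≠ 0 → 1 / 2 ≤ ‖ξ‖ ∧ ‖ξ‖ ≤ 2)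
    (Φ : 𝓢(EuclideanSpace ℝ (Fin n), ℂ)) (hΦ : ∫ x, Φ x ≠ 0)
    (hbdd : ∀ m : MultilinearMultiplier.FreqSpace l n → ℂ, Measurable m →
      MultilinearMultiplier.hormanderNorm Θ u s m < ∞ →
      ∃ C : ℝ≥0, ∀ f : Fin l → 𝓢(EuclideanSpace ℝ (Fin n), ℂ),
        eLpNorm (MultilinearMultiplier.multiplierOp m f) (ENNReal.ofReal p) volume ≤
          C * MultilinearMultiplier.hormanderNorm Θ u s m *
            ∏ i, MultilinearMultiplier.hardyNorm Φ (q i) (f i)) :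
    max ((l : ℝ) / u) (1 / p - 1 / u') < s / n := by
  have hn0 : (0 : ℝ) < n := by exact_mod_cast hn
  have hp : 0 < p := by
    have : 0 < ∑ i, 1 / q i :=
      Finset.sum_pos (fun i _ => one_div_pos.2 (hq i)) ⟨⟨0, hl⟩, Finset.mem_univ _⟩
    exact one_div_pos.1 (hpq ▸ this)
  have h1 := MultilinearMultiplier.lt_of_multiplier_bound hl hn hp hq hu hs hΘ hbdd
  have h2 := MultilinearMultiplier.sub_lt_of_multiplier_bound hl hn hp hq hu h1 hΘ hbdd
  rw [show 1 / u' = 1 - 1 / u by linarith, max_lt_iff, lt_div_iff₀ hn0]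
  exact ⟨by rwa [div_mul_eq_mul_div], h2⟩
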